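/- Let $q\ge 1$, let $X\subset\mathbb R^q$ be a compact connected set with $X=\overline{\mathrm{Int}\,X}$, let $W\supset X$ be a bounded open connected subset of $\mathbb R^q$, and let $E$ be a countable (finite or infinite) set. Let $\theta$ be an invertible ergodic measure-preserving transformation of a probability space $(\Lambda,\mathcal F,m)$. For all $e\in E$, $\lambda\in\Lambda$ let $\varphi_e^\lambda:W\to W$ be an injective $C^1$ conformal map with $\varphi_e^\lambda(X)\subset X$, such that: (i) for some $0<s<1$ all maps $\varphi_e^\lambda|_X$ are Lipschitz with constant $s$; (ii) there is a function $K:[0,1)\to[1,\infty)$ with $\lim_{t\downarrow 0}K(t)=K(0)=1$ and $|(\varphi_e^\lambda)'(y)|/|(\varphi_e^\lambda)'(x)|\le K(t)$ for all $t\in[0,1)$, $e\in E$, $\lambda\in\Lambda$, $x\in X$ and $\|y-x\|\le t\cdot\mathrm{dist}(x,\mathbb R^q\setminus W)$; (iii) $\lambda\mapsto\varphi_e^\lambda(x)$ is measurable for all $e\in E$, $x\in X$. Let $\mathcal S$ denote this random countable conformal iterated function system. For $\omega=(\omega_1,\omega_2,\dots)\in E^\infty$ let $\pi_\lambda(\omega)$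 be the unique point of $\bigcap_{n\ge1}\varphi_{\omega_1}^{\lambda}\circ\varphi_{\omega_2}^{\theta(\lambda)}\circ\dots\circ\varphi_{\omega_n}^{\theta^{n-1}(\lambda)}(X)$. Let $J_\lambda=\pi_\lambda(E^\infty)$, let $\sigma$ be the shift on $E^\infty$, let $\pi_\Lambda,\pi_{E^\infty}$ be the projections of $\Lambda\times E^\infty$ onto its factors, and let $\pi_{\mathbb R^q}(\lambda,\omega)=\pi_\lambda(\omega)$. Let $\xi$ be the partition of $E^\infty$ according to the first letter $\omega_1$, let $\mathcal B$ be the Borel $\sigma$-algebra of $\mathbb R^q$, and let $H_\mu(\cdot\mid\cdot)$ denote conditional entropy. Let $\mu$ be a $(\theta\times\sigma)$-invariant and ergodic probability measure on $\Lambda\times E^\infty$ whose marginal on $\Lambda$ is $m$, with disintegration $\mu=\int_\Lambda \delta_\lambda\otimes\mu_\lambda\,dm(\lambda)$. Assume that $H_\mu(\pi_{E^\infty}^{-1}\xi\mid\pi_\Lambda^{-1}\mathcal F)<\infty$. Put $$h_\mu(\mathcal S)=H_\mu\big(\pi_{E^\infty}^{-1}\xi\,\big|\,\pi_\Lambda^{-1}\mathcal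 F\vee(\theta\times\sigma)^{-1}\pi_{\mathbb R^q}^{-1}\mathcal B\big)-H_\mu\big(\pi_{E^\infty}^{-1}\xi\,\big|\,\pi_\Lambda^{-1}\mathcal F\vee\pi_{\mathbb R^q}^{-1}\mathcal B\big),$$ $$\chi_\mu=\int_{\Lambda\times E^\infty}-\log\big|(\varphi_{\omega_1}^\lambda)'(\pi_{\theta(\lambda)}(\sigma\omega))\big|\,d\mu(\lambda,\omega)\in(0,\infty].$$ For a finite Borel measure $\nu$ on $\mathbb R^q$ put $HD_\star(\nu)=\inf\{HD(Y):\nu(Y)>0\}$ and $HD^\star(\nu)=\inf\{HD(Y):\nu(\mathbb R^q\setminus Y)=0\}$ ($Y$ Borel, $HD$ the Hausdorff dimension). The Hausdorff dimension $HD(\nu)$ of $\nu$ is well defined if $HD_\star(\nu)=HD^\star(\nu)$, and it is then this common value. The packing dimension $PD(\nu)$ is defined in the same way from the packing dimension of sets. Then, for $m$-a.e. $\lambda\in\Lambda$, the Hausdorff dimension and the packing dimension of the measure $\mu_\lambda\circ\pi_\lambda^{-1}$ on $J_\lambda$ are well defined, and $$HD(\mu_\lambda\circ\pi_\lambda^{-1})=PD(\mu_\lambda\circ\pi_\lambda^{-1})=\frac{h_\mu(\mathcal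 S)}{\chi_\mu},$$ where the quotient is $0$ if $\chi_\mu=\infty$. -/

import Mathlib

open MeasureTheory ProbabilityTheory Filter Topology
open scoped NNReal ENNReal

/-! ### Packing measure, packing dimension, dimensions of a measure -/

/-- `t` is a finite `δ`-packing of `Y`: a finite family of (center, radius) pairs with centers in
`Y`, radii in `(0, δ]`, and pairwise disjoint closed balls. -/
def IsBallPacking {α : Type*} [PseudoMetricSpace α] (δ : ℝ) (Y : Set α) (t : Finset (α × ℝ)) :
    Prop :=
  (∀ p ∈ t, p.1 ∈ Y ∧ 0 < p.2 ∧ p.2 ≤ δ) ∧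
    (t : Set (α × ℝ)).PairwiseDisjoint fun p => Metric.closedBall p.1 p.2

/-- The `s`-dimensional packing pre-measure `P₀ˢ(Y)`: the limit as `δ ↓ 0` (an infimum, by
monotonicity) of the supremum of `∑ (2 rᵢ)ˢ` over all `δ`-packings of `Y` by balls of radii `rᵢ`.
The supremum over countable packings is the supremum over their finite subfamilies. -/
noncomputable def packingPreMeasure {α : Type*} [PseudoMetricSpace α] (s : ℝ) (Y : Set α) :
    ℝ≥0∞ :=
  ⨅ (δ : ℝ) (_ : 0 < δ), ⨆ (t : Finset (α × ℝ)) (_ : IsBallPacking δ Y t),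
    ∑ p ∈ t, ENNReal.ofReal (2 * p.2) ^ s

/-- The `s`-dimensional packing measure `Pˢ(Y) = inf {∑ᵢ P₀ˢ(Yᵢ) : Y ⊆ ⋃ᵢ Yᵢ}`. -/
noncomputable def packingMeasure {α : Type*} [PseudoMetricSpace α] (s : ℝ) (Y : Set α) : ℝ≥0∞ :=
  ⨅ (c : ℕ → Set α) (_ : Y ⊆ ⋃ i, c i), ∑' i, packingPreMeasure s (c i)

/-- The packing dimension `PD(Y) = sup {s ≥ 0 : Pˢ(Y) = ∞}` of a set (compare `dimH`). -/
noncomputable def packingDim {α : Type*} [PseudoMetricSpace α] (Y : Set α) : ℝ≥0∞ :=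
  ⨆ (s : ℝ≥0) (_ : packingMeasure (s : ℝ) Y = ∞), (s : ℝ≥0∞)

/-- For a notion `dim` of dimension of sets: `dim_⋆(ν) = inf {dim Y : ν(Y) > 0}`, over Borel `Y`. -/
noncomputable def lowerMeasureDim {α : Type*} [MeasurableSpace α] (dim : Set α → ℝ≥0∞)
    (ν : Measure α) : ℝ≥0∞ :=
  ⨅ (Y : Set α) (_ : MeasurableSet Y) (_ : 0 < ν Y), dim Y

/-- For a notion `dim` of dimension of sets: `dim^⋆(ν) = inf {dim Y : ν(Yᶜ) = 0}`, over Borel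
`Y`. -/
noncomputable def upperMeasureDim {α : Type*} [MeasurableSpace α] (dim : Set α → ℝ≥0∞)
    (ν : Measure α) : ℝ≥0∞ :=
  ⨅ (Y : Set α) (_ : MeasurableSet Y) (_ : ν Yᶜ = 0), dim Y

/-- The Hausdorff dimension of the measure `ν` is well defined and equal to `d`, that is
`HD_⋆(ν) = HD^⋆(ν) = d`. -/
def HasHausdorffDim {α : Type*} [MetricSpace α] [MeasurableSpace α] [BorelSpace α]
    (ν : Measure α) (d : EReal) : Prop :=
  (lowerMeasureDim dimH ν : EReal) = d ∧ (upperMeasureDim dimH ν : EReal) = d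

/-- The packing dimension of the measure `ν` is well defined and equal to `d`, that is
`PD_⋆(ν) = PD^⋆(ν) = d`. -/
def HasPackingDim {α : Type*} [MetricSpace α] [MeasurableSpace α] [BorelSpace α]
    (ν : Measure α) (d : EReal) : Prop :=
  (lowerMeasureDim packingDim ν : EReal) = d ∧ (upperMeasureDim packingDim ν : EReal) = d

/-! ### Conditional entropy -/

/-- The conditional entropy `H_μ(P | 𝒜)` of a countable measurable partition `P = (Pᵢ)` given a
sub-σ-algebra `𝒜`: the integral of the conditional information function
`-∑ᵢ 1_{Pᵢ} log E_μ(1_{Pᵢ} | 𝒜)`. -/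
noncomputable def condEntropy {Ω ι : Type*} [MeasurableSpace Ω] (μ : Measure Ω)
    (P : ι → Set Ω) (𝒜 : MeasurableSpace Ω) : ℝ≥0∞ :=
  ∫⁻ x, ∑' i, (P i).indicator
    (fun y => ENNReal.ofReal (-Real.log ((μ[(P i).indicator (fun _ => (1 : ℝ)) | 𝒜]) y))) x ∂μ

/-! ### Random countable conformal iterated function systems -/

/-- The one-sided shift `(ω₁, ω₂, …) ↦ (ω₂, ω₃, …)`; the coordinate `ωₙ` is `ω (n - 1)`. -/
def seqShift {E : Type*} (ω : ℕ → E) : ℕ → E := fun n => ω (n + 1)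

/-- A random countable conformal iterated function system on `X ⊆ W ⊆ ℝ^q`, with alphabet `E`, over
the probability space `(Λ, m)`, satisfying the Bounded Distortion Property and the measurability
condition. The map `φ e l : W → W` is the conformal extension of `φ_e^l : X → X`; its values
outside `W` are irrelevant. -/
structure RandomConformalIFS (Λ : Type*) [MeasurableSpace Λ] (m : Measure Λ) (E : Type*) (q : ℕ)
    where
  /-- the phase space -/
  X : Set (EuclideanSpace ℝ (Fin q))
  isCompact_X : IsCompact X
  isConnected_X : IsConnected X
  closure_interior_X : X = closure (interior X)
  /-- the domain to which all maps extend conformally -/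
  W : Set (EuclideanSpace ℝ (Fin q))
  isOpen_W : IsOpen W
  isBounded_W : Bornology.IsBounded W
  isConnected_W : IsConnected W
  X_subset_W : X ⊆ W
  /-- the base transformation -/
  θ : Λ ≃ᵐ Λ
  ergodic_θ : Ergodic θ m
  /-- the contractions -/
  φ : E → Λ → EuclideanSpace ℝ (Fin q) → EuclideanSpace ℝ (Fin q)
  mapsTo_X : ∀ e l, Set.MapsTo (φ e l) X X
  mapsTo_W : ∀ e l, Set.MapsTo (φ e l) W W
  injOn_W : ∀ e l, Set.InjOn (φ e l) W
  contDiffOn_W : ∀ e l, ContDiffOn ℝ 1 (φ e l) W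
  conformalAt_W : ∀ e l, ∀ x ∈ W, ConformalAt (φ e l) x
  contracting : ∃ s : ℝ≥0, 0 < s ∧ s < 1 ∧ ∀ e l, LipschitzOnWith s (φ e l) X
  bounded_distortion : ∃ K : ℝ → ℝ, (∀ t ∈ Set.Ico (0 : ℝ) 1, 1 ≤ K t) ∧ K 0 = 1 ∧
    Tendsto K (𝓝[>] 0) (𝓝 1) ∧
    ∀ t ∈ Set.Ico (0 : ℝ) 1, ∀ e l, ∀ x ∈ X, ∀ y, ‖y - x‖ ≤ t * Metric.infDist x Wᶜ →
      ‖fderiv ℝ (φ e l) y‖ / ‖fderiv ℝ (φ e l) x‖ ≤ K t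
  measurable_φ : ∀ e, ∀ x ∈ X, Measurable fun l => φ e l x

namespace RandomConformalIFS

variable {Λ : Type*} [MeasurableSpace Λ] {m : Measure Λ} {E : Type*} {q : ℕ}

/-- `φ_{ω|ₙ}^l = φ_{ω₁}^l ∘ φ_{ω₂}^{θ l} ∘ ⋯ ∘ φ_{ωₙ}^{θ^{n-1} l}`. -/
def wordMap (S : RandomConformalIFS Λ m E q) (l : Λ) (ω : ℕ → E) :
    ℕ → EuclideanSpace ℝ (Fin q) → EuclideanSpace ℝ (Fin q)
  | 0 => id
  | n + 1 => S.wordMap l ω n ∘ S.φ (ω n) (S.θ^[n] l)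

theorem wordMap_mapsTo (S : RandomConformalIFS Λ m E q) (l : Λ) (ω : ℕ → E) (n : ℕ) :
    Set.MapsTo (S.wordMap l ω n) S.X S.X := by
  induction n with
  | zero => exact Set.mapsTo_id _
  | succ n ih => exact ih.comp (S.mapsTo_X _ _)

theorem wordMap_lipschitz (S : RandomConformalIFS Λ m E q) (l : Λ) (ω : ℕ → E) {s : ℝ≥0}
    (hs : ∀ e l, LipschitzOnWith s (S.φ e l) S.X) (n : ℕ) :
    LipschitzOnWith (s ^ n) (S.wordMap l ω n) S.X := by
  induction n with
  | zero => simpa [wordMap] using LipschitzWith.id.lipschitzOnWith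
  | succ n ih =>
    rw [pow_succ]
    exact ih.comp (hs _ _) (S.mapsTo_X _ _)

theorem exists_iInter_eq_singleton (S : RandomConformalIFS Λ m E q) (l : Λ) (ω : ℕ → E) :
    ∃ x, (⋂ n : ℕ, S.wordMap l ω (n + 1) '' S.X) = {x} := by
  obtain ⟨s, -, hs1, hs⟩ := S.contracting
  have hcomp : ∀ n, IsCompact (S.wordMap l ω n '' S.X) := fun n =>
    S.isCompact_X.image_of_continuousOn (S.wordMap_lipschitz l ω hs n).continuousOn
  have hne : (⋂ n : ℕ, S.wordMap l ω (n + 1) '' S.X).Nonempty := by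
    refine IsCompact.nonempty_iInter_of_sequence_nonempty_isCompact_isClosed _ (fun n => ?_)
      (fun n => S.isConnected_X.nonempty.image _) (hcomp _) (fun n => (hcomp _).isClosed)
    change (S.wordMap l ω (n + 1) ∘ S.φ (ω (n + 1)) (S.θ^[n + 1] l)) '' S.X ⊆ _
    rw [Set.image_comp]
    exact Set.image_mono (S.mapsTo_X _ _).image_subset
  obtain ⟨x, hx⟩ := hne
  refine ⟨x, Set.eq_singleton_iff_unique_mem.2 ⟨hx, fun y hy => ?_⟩⟩
  obtain ⟨C, hC⟩ := Metric.isBounded_iff.1 S.isCompact_X.isBounded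
  have hlim : Tendsto (fun n : ℕ => (s : ℝ) ^ (n + 1) * C) atTop (𝓝 (0 * C)) :=
    ((tendsto_pow_atTop_nhds_zero_of_lt_one s.2 (by exact_mod_cast hs1)).comp
      (tendsto_add_atTop_nat 1)).mul_const C
  have hle : dist y x ≤ 0 * C := by
    refine ge_of_tendsto' hlim fun n => ?_
    obtain ⟨a, ha, rfl⟩ := Set.mem_iInter.1 hx n
    obtain ⟨b, hb, rfl⟩ := Set.mem_iInter.1 hy n
    refine ((S.wordMap_lipschitz l ω hs (n + 1)).dist_le_mul b hb a ha).trans ?_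
    push_cast
    exact mul_le_mul_of_nonneg_left (hC hb ha) (by positivity)
  exact dist_le_zero.1 (by simpa using hle)

/-- The coding map: `π_l(ω)` is the unique point of `⋂_{n ≥ 1} φ_{ω|ₙ}^l(X)`. -/
noncomputable def proj (S : RandomConformalIFS Λ m E q) (l : Λ) (ω : ℕ → E) :
    EuclideanSpace ℝ (Fin q) :=
  (S.exists_iInter_eq_singleton l ω).choose

theorem iInter_eq_singleton_proj (S : RandomConformalIFS Λ m E q) (l : Λ) (ω : ℕ → E) :
    (⋂ n : ℕ, S.wordMap l ω (n + 1) '' S.X) = {S.proj l ω} :=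
  (S.exists_iInter_eq_singleton l ω).choose_spec

/-- The skew product `θ × σ` on `Λ × E^∞`. -/
def skew (S : RandomConformalIFS Λ m E q) : Λ × (ℕ → E) → Λ × (ℕ → E) :=
  Prod.map S.θ seqShift

/-- The map `π_{ℝ^q} : Λ × E^∞ → ℝ^q`, `(l, ω) ↦ π_l(ω)`. -/
noncomputable def jointProj (S : RandomConformalIFS Λ m E q) (p : Λ × (ℕ → E)) :
    EuclideanSpace ℝ (Fin q) :=
  S.proj p.1 p.2

end RandomConformalIFS

/-- The pullback `π_{E^∞}⁻¹(ξ)` to `Λ × E^∞` of the partition `ξ` of `E^∞` into cylinders of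
length one. -/
def firstLetterPartition (Λ E : Type*) (e : E) : Set (Λ × (ℕ → E)) :=
  {p | p.2 0 = e}

/-- The σ-algebra on `Λ × E^∞` of the partition `π_Λ⁻¹(ε_Λ)`: the pullback of the σ-algebra
of `Λ`. -/
@[reducible] def baseSigmaAlgebra (Λ E : Type*) [MeasurableSpace Λ] : MeasurableSpace (Λ × (ℕ → E)) :=
  MeasurableSpace.comap Prod.fst inferInstance

namespace RandomConformalIFS

variable {Λ : Type*} [MeasurableSpace Λ] {m : Measure Λ} {E : Type*} [MeasurableSpace E] {q : ℕ}

/-- The random projectional entropy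
`h_μ(S) = H_μ(π_{E^∞}⁻¹ ξ | π_Λ⁻¹ ε_Λ ∨ (θ × σ)⁻¹ π_{ℝ^q}⁻¹ ε_{ℝ^q})
  - H_μ(π_{E^∞}⁻¹ ξ | π_Λ⁻¹ ε_Λ ∨ π_{ℝ^q}⁻¹ ε_{ℝ^q})`. -/
noncomputable def projEntropy (S : RandomConformalIFS Λ m E q) (μ : Measure (Λ × (ℕ → E))) :
    EReal :=
  (condEntropy μ (firstLetterPartition Λ E)
    (baseSigmaAlgebra Λ E ⊔
      MeasurableSpace.comap S.skew (MeasurableSpace.comap S.jointProj inferInstance)) : EReal) -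
  (condEntropy μ (firstLetterPartition Λ E)
    (baseSigmaAlgebra Λ E ⊔ MeasurableSpace.comap S.jointProj inferInstance) : EReal)

/-- The Lyapunov exponent `χ_μ = ∫ -log |(φ_{ω₁}^l)'(π_{θ l}(σ ω))| dμ(l, ω)`, possibly infinite.
The integrand is positive, since the derivatives have norm at most `s < 1` on `X`. -/
noncomputable def lyapunovExponent (S : RandomConformalIFS Λ m E q)
    (μ : Measure (Λ × (ℕ → E))) : ℝ≥0∞ :=
  ∫⁻ p, ENNReal.ofReal
    (-Real.log ‖fderiv ℝ (S.φ (p.2 0) p.1) (S.proj (S.θ p.1) (seqShift p.2))‖) ∂μ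

end RandomConformalIFS

/-!
Let `ν l` be the image of the fibre measure `κ l` under the coding map `S.proj l`, let `μ = m ⊗ₘ
κ`, `h` the projectional entropy and `χ` the Lyapunov exponent. The measures `ν l` turn out to be
exact dimensional: almost everywhere `ν l (closedBall (S.proj l ω) r)` lies between `r ^ (d + η)`
and `r ^ (d - η)` for small `r`, with `d = h / χ` (`RandomConformalIFS.ae_local_dim`). The mass
distribution principle and covering arguments turn this into the equality of all four dimensions of
`ν l` with `d` (`hasDim_of_local_dim`).

*Masses.* By invertibility of `θ` and invariance of `μ` the fibre measures are equivariant,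
`κ (θ l) = (κ l).map seqShift` for almost every `l` (`ae_map_seqShift`). If `φ e l` were a
similarity of ratio `ρ` on `X`, the preimage under the shift of the ball of radius `r` around the
shifted point would coincide, within the cylinder of the first letter, with the ball of radius `ρ r`
around the point itself. So the quotient of the masses of these two balls is a quotient of two
conditional proportions of the first letter (`letterRatio`, `gain`). Near-similarity suffices for
one inequality in either direction, with radii changed by factors `e ^ (± ε)`
(`gain_add_log_ballMass_le`, `log_ballMass_le_gain_add`). Along an orbit, the logarithm of the mass
of the ball of radius `ρₙ` is thus bounded on either side by a sum of `n` gains up to an error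
`o(n)`, where `-log ρₙ ~ n χ` by Birkhoff's theorem, also if `χ = ∞`, up to multiples of `ε n`.

*Entropy.* As the radius tends to zero, `-log letterRatio` tends to the conditional information
function of the first letter, whose integral is the conditional entropy (`exists_info_limit`). The
convergence is dominated: the Besicovitch covering theorem gives a maximal inequality for quotients
of masses of balls (`exists_measure_le_of_closedBall_ratio_le`), and finiteness of the entropy
given the base then makes the maximal information function integrable
(`lintegral_maximalInfo_lt_top`). Since the radii vary along the orbit, Birkhoff's theorem is
needed in the form of Maker (`Ergodic.ae_tendsto_sum_div`); it shows that the sum of `n` gains is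
`-n h + o(n)`. Interpolation between the scales `ρₙ` (`eventually_rpow_le`, `eventually_le_rpow`)
yields the pointwise dimension.

*Geometry.* It remains to see that all maps are near-similarities on `X` at small scales
(`exists_scale`). The upper bound is the mean value inequality. For the lower bound, distortion is
controlled only on balls with centers in `X`, while the image of such a ball may a priori miss
points close to its center, and `X` need not be convex, so the inverse maps cannot be integrated
along segments. For `q ≥ 2` a length-area estimate (`IsConformalOnBall.le_lintegral_image_annulus`)
bounds the logarithmic size of the image of an annulus from below, and shows that the image of a
ball nearly fills the ball of radius `|f' x| r` (`IsConformalOnBall.volume_ball_diff_image_le`). As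
the images of two disjoint balls are disjoint, their centers are mapped nearly as far apart as they
should be (`IsConformalOnBall.le_norm_image_sub`). For `q = 1` the set `X` is an interval and the
mean value theorem suffices.
-/

/-! ### The pointwise ergodic theorem -/

section Birkhoff

variable {Ω : Type*} {T : Ω → Ω} {f : Ω → ℝ}

/-- The running maximum `max (0, S₁ f, …, Sₙ f)` of the Birkhoff sums of `f`, defined by the
recursion `M (n + 1) = max 0 (f + M n ∘ T)`. -/
def birkhoffMax (T : Ω → Ω) (f : Ω → ℝ) : ℕ → Ω → ℝ
  | 0 => fun _ => 0
  | n + 1 => fun x => max 0 (f x + birkhoffMax T f n (T x))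

lemma birkhoffMax_nonneg (n : ℕ) (x : Ω) : 0 ≤ birkhoffMax T f n x := by
  cases n with
  | zero => exact le_rfl
  | succ n => exact le_max_left _ _

lemma birkhoffMax_le_succ (n : ℕ) (x : Ω) : birkhoffMax T f n x ≤ birkhoffMax T f (n + 1) x := by
  induction n generalizing x with
  | zero => exact birkhoffMax_nonneg 1 x
  | succ n ih => exact max_le_max le_rfl (by linarith [ih (T x)])

lemma birkhoffSum_le_birkhoffMax {k n : ℕ} (h : k ≤ n) (x : Ω) :
    birkhoffSum T f k x ≤ birkhoffMax T f n x := by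
  induction n generalizing k x with
  | zero => simp [Nat.le_zero.1 h, birkhoffMax]
  | succ n ih =>
    cases k with
    | zero => simpa using birkhoffMax_nonneg (n + 1) x
    | succ k =>
      rw [birkhoffSum_succ']
      exact (by linarith [ih (Nat.le_of_succ_le_succ h) (T x)] :
        _ ≤ f x + birkhoffMax T f n (T x)).trans
        (le_max_right _ _)

variable [MeasurableSpace Ω] {μ : Measure Ω}

lemma integrable_birkhoffMax (hT : MeasurePreserving T μ μ) (hf : Integrable f μ) (n : ℕ) :
    Integrable (birkhoffMax T f n) μ := by
  induction n with
  | zero => exact integrable_zero _ _ _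
  | succ n ih =>
    exact (integrable_zero _ _ _).sup (hf.add (hT.integrable_comp_of_integrable ih))

lemma measurable_birkhoffSum (hT : Measurable T) (hf : Measurable f) (n : ℕ) :
    Measurable (birkhoffSum T f n) := by
  unfold birkhoffSum
  exact Finset.measurable_sum _ fun k _ => hf.comp (hT.iterate k)

/-- If the Birkhoff sums were unbounded above on a set of positive measure, then by ergodicity they
would be so almost everywhere, and `M (n + 1) - M n ∘ T = max (-M n ∘ T) f` would decrease to `f`;
as its integral is nonnegative, so would be the integral of `f`. -/
lemma Ergodic.ae_bddAbove_birkhoffSum [IsProbabilityMeasure μ] (hT : Ergodic T μ)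
    (hfm : Measurable f) (hf : Integrable f μ) (hneg : ∫ x, f x ∂μ < 0) :
    ∀ᵐ x ∂μ, BddAbove (Set.range fun n => birkhoffSum T f n x) := by
  set A : Set Ω := {x | BddAbove (Set.range fun n => birkhoffSum T f n x)} with hA
  have hAm : MeasurableSet A := by
    have : A = ⋃ C : ℕ, ⋂ n : ℕ, {x | birkhoffSum T f n x ≤ C} := by
      ext x
      simp only [hA, Set.mem_ofPred_eq, Set.mem_iUnion, Set.mem_iInter, bddAbove_def,
        Set.forall_mem_range]
      constructor
      · rintro ⟨C, hC⟩
        obtain ⟨N, hN⟩ := exists_nat_ge C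
        exact ⟨N, fun n => (hC n).trans hN⟩
      · rintro ⟨N, hN⟩
        exact ⟨N, hN⟩
    rw [this]
    exact MeasurableSet.iUnion fun C => MeasurableSet.iInter fun n =>
      measurableSet_le (measurable_birkhoffSum hT.measurable hfm n) measurable_const
  have hinv : T ⁻¹' A = A := by
    ext x
    simp only [hA, Set.mem_preimage, Set.mem_ofPred_eq, bddAbove_def, Set.forall_mem_range]
    constructor
    · rintro ⟨C, hC⟩
      refine ⟨max 0 (f x + C), fun n => ?_⟩
      cases n with
      | zero => simp
      | succ n =>
        rw [birkhoffSum_succ']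
        exact le_max_of_le_right (by linarith [hC n])
    · rintro ⟨C, hC⟩
      refine ⟨C - f x, fun n => ?_⟩
      have := hC (n + 1)
      rw [birkhoffSum_succ'] at this
      linarith
  rcases hT.toPreErgodic.ae_mem_or_ae_notMem hAm hinv with h | h
  · exact h
  exfalso
  have hlim : Tendsto (fun n => ∫ x, (birkhoffMax T f (n + 1) x - birkhoffMax T f n (T x)) ∂μ) atTop
      (𝓝 (∫ x, f x ∂μ)) := by
    refine tendsto_integral_of_dominated_convergence (fun x => |f x|) (fun n => ?_) hf.abs
      (fun n => Eventually.of_forall fun x => ?_) ?_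
    · exact ((integrable_birkhoffMax hT.toMeasurePreserving hf _).sub
        (hT.toMeasurePreserving.integrable_comp_of_integrable
          (integrable_birkhoffMax hT.toMeasurePreserving hf n))).aestronglyMeasurable
    · have h0 := birkhoffMax_nonneg (T := T) (f := f) n (T x)
      rw [Real.norm_eq_abs]
      simp only [birkhoffMax]
      rcases max_cases 0 (f x + birkhoffMax T f n (T x)) with ⟨h1, h2⟩ | ⟨h1, h2⟩ <;> rw [h1] <;>
      rcases abs_cases (f x) with ⟨h3, h4⟩ | ⟨h3, h4⟩ <;> rw [h3, abs_le] <;>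
        constructor <;> linarith
    · filter_upwards [h] with x hx
      rw [← hinv] at hx
      obtain ⟨k, hk⟩ : ∃ k, -f x < birkhoffSum T f k (T x) := by
        by_contra! hcon
        exact hx ⟨-f x, by rintro _ ⟨n, rfl⟩; exact hcon n⟩
      refine tendsto_const_nhds.congr' ?_
      filter_upwards [eventually_ge_atTop k] with n hn
      have := birkhoffSum_le_birkhoffMax (f := f) (T := T) hn (T x)
      simp only [birkhoffMax]
      rw [max_eq_right (by linarith)]
      ring
  refine absurd (ge_of_tendsto' hlim fun n => ?_) (not_le.2 hneg)
  have hi := integrable_birkhoffMax hT.toMeasurePreserving hf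
  have hcomp : ∫ x, birkhoffMax T f n (T x) ∂μ = ∫ x, birkhoffMax T f n x ∂μ := by
    conv_rhs => rw [← hT.map_eq]
    rw [integral_map hT.measurable.aemeasurable]
    rw [hT.map_eq]; exact (hi n).aestronglyMeasurable
  have hTi : Integrable (fun x => birkhoffMax T f n (T x)) μ :=
    hT.toMeasurePreserving.integrable_comp_of_integrable (hi n)
  rw [integral_sub (hi _) hTi, hcomp, sub_nonneg]
  exact integral_mono (hi _) (hi _) fun x => birkhoffMax_le_succ n x

lemma Ergodic.ae_eventually_birkhoffAverage_lt [IsProbabilityMeasure μ] (hT : Ergodic T μ)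
    (hfm : Measurable f) (hf : Integrable f μ) {a : ℝ} (ha : ∫ x, f x ∂μ < a) :
    ∀ᵐ x ∂μ, ∀ᶠ n in atTop, birkhoffAverage ℝ T f n x < a := by
  obtain ⟨b, hb, hba⟩ := exists_between ha
  have := hT.ae_bddAbove_birkhoffSum (f := fun x => f x - b) (hfm.sub_const b)
    (hf.sub (integrable_const b)) (by
      rw [integral_sub hf (integrable_const b)]; simpa using hb)
  filter_upwards [this] with x ⟨C, hC⟩
  have hlim : Tendsto (fun n : ℕ => C / n) atTop (𝓝 0) := tendsto_const_div_atTop_nhds_zero_nat C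
  filter_upwards [hlim.eventually (gt_mem_nhds (sub_pos.2 hba)),
      eventually_gt_atTop 0] with n hn hn0
  have h1 : birkhoffSum T (fun x => f x - b) n x = birkhoffSum T f n x - n * b := by
    simp [birkhoffSum, Finset.sum_sub_distrib]
  have h2 := hC ⟨n, rfl⟩
  simp only [h1] at h2
  have hn0' : (0 : ℝ) < n := by exact_mod_cast hn0
  rw [birkhoffAverage, smul_eq_mul, inv_mul_lt_iff₀ hn0']
  rw [div_lt_iff₀ hn0'] at hn
  linarith

/-- **Birkhoff's pointwise ergodic theorem** for an ergodic transformation of a probability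
space. -/
theorem Ergodic.ae_tendsto_birkhoffAverage [IsProbabilityMeasure μ] (hT : Ergodic T μ)
    (hfm : Measurable f) (hf : Integrable f μ) :
    ∀ᵐ x ∂μ, Tendsto (fun n => birkhoffAverage ℝ T f n x) atTop (𝓝 (∫ x, f x ∂μ)) := by
  have h1 : ∀ k : ℕ, ∀ᵐ x ∂μ, ∀ᶠ n in atTop,
      birkhoffAverage ℝ T f n x < ∫ x, f x ∂μ + 1 / (k + 1) := fun k =>
    hT.ae_eventually_birkhoffAverage_lt hfm hf (lt_add_of_pos_right _ Nat.one_div_pos_of_nat)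
  have h2 : ∀ k : ℕ, ∀ᵐ x ∂μ, ∀ᶠ n in atTop,
      birkhoffAverage ℝ T (-f) n x < -∫ x, f x ∂μ + 1 / (k + 1) := fun k =>
    hT.ae_eventually_birkhoffAverage_lt hfm.neg hf.neg (by
      simp only [Pi.neg_apply, integral_neg]
      exact lt_add_of_pos_right _ Nat.one_div_pos_of_nat)
  filter_upwards [ae_all_iff.2 h1, ae_all_iff.2 h2] with x hx1 hx2
  refine tendsto_order.2 ⟨fun a ha => ?_, fun a ha => ?_⟩
  · obtain ⟨k, hk⟩ := exists_nat_one_div_lt (sub_pos.2 ha)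
    filter_upwards [hx2 k] with n hn
    simp only [birkhoffAverage_neg, Pi.neg_apply] at hn
    linarith
  · obtain ⟨k, hk⟩ := exists_nat_one_div_lt (sub_pos.2 ha)
    filter_upwards [hx1 k] with n hn
    linarith

/-- Birkhoff averages of a nonnegative function of infinite integral tend to infinity. -/
theorem Ergodic.ae_tendsto_birkhoffAverage_atTop [IsProbabilityMeasure μ] (hT : Ergodic T μ)
    (hfm : Measurable f) (hf0 : ∀ x, 0 ≤ f x) (hf : ∫⁻ x, ENNReal.ofReal (f x) ∂μ = ∞) :
    ∀ᵐ x ∂μ, Tendsto (fun n => birkhoffAverage ℝ T f n x) atTop atTop := by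
  have hm : ∀ N : ℕ, Measurable fun x => min (f x) N := fun N => hfm.min measurable_const
  have hi : ∀ N : ℕ, Integrable (fun x => min (f x) N) μ := fun N => by
    refine (integrable_const (N : ℝ)).mono' (hm N).aestronglyMeasurable
      (Eventually.of_forall fun x => ?_)
    rw [Real.norm_of_nonneg (le_min (hf0 x) N.cast_nonneg)]
    exact min_le_right _ _
  have hlim : Tendsto (fun N : ℕ => ∫⁻ x, ENNReal.ofReal (min (f x) N) ∂μ) atTop (𝓝 ∞) := by
    rw [← hf]
    refine lintegral_tendsto_of_tendsto_of_monotone (fun N => (hm N).ennreal_ofReal.aemeasurable)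
      (Eventually.of_forall fun x N M h => ENNReal.ofReal_le_ofReal
        (min_le_min le_rfl (by exact_mod_cast h))) (Eventually.of_forall fun x => ?_)
    refine tendsto_const_nhds.congr' ?_
    obtain ⟨M, hM⟩ := exists_nat_ge (f x)
    filter_upwards [eventually_ge_atTop M] with N hN
    rw [min_eq_left (hM.trans (by exact_mod_cast hN))]
  filter_upwards [ae_all_iff.2 fun N => hT.ae_tendsto_birkhoffAverage (hm N) (hi N)] with x hx
  refine tendsto_atTop.2 fun b => ?_
  obtain ⟨N, hN⟩ := (hlim.eventually (lt_mem_nhds (ENNReal.ofReal_lt_top (r := max b 0)))).exists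
  rw [← ofReal_integral_eq_lintegral_ofReal (hi N)
    (Eventually.of_forall fun x => le_min (hf0 x) N.cast_nonneg)] at hN
  have hN' := (ENNReal.ofReal_lt_ofReal_iff_of_nonneg (le_max_right _ _)).1 hN
  filter_upwards [(hx N).eventually (lt_mem_nhds ((le_max_left _ _).trans_lt hN'))] with n hn
  refine hn.le.trans ?_
  simp only [birkhoffAverage, birkhoffSum, smul_eq_mul]
  gcongr
  exact min_le_left _ _

end Birkhoff

/-! ### Dimensions of a measure from its local dimensions -/

section Dimension

variable {α : Type*} [MetricSpace α]

/-- **Mass distribution principle**: an upper bound on the measures of small balls centered in `A`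
bounds the Hausdorff dimension of `A` from below. -/
lemma le_dimH_of_measure_closedBall_le [MeasurableSpace α] [BorelSpace α] {ν : Measure α}
    {A : Set α} {s : ℝ≥0} {r₀ : ℝ} (hr₀ : 0 < r₀)
    (h : ∀ x ∈ A, ∀ r ∈ Set.Ioo 0 r₀, ν (Metric.closedBall x r) ≤ ENNReal.ofReal r ^ (s : ℝ))
    (hA : ν A ≠ 0) : (s : ℝ≥0∞) ≤ dimH A := by
  by_contra! hlt
  have h0 := hausdorffMeasure_of_dimH_lt hlt
  have key : OuterMeasure.restrict A ν.toOuterMeasure ≤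
      (OuterMeasure.mkMetric fun r => r ^ (s : ℝ)) := by
    refine OuterMeasure.le_mkMetric _ _ (ENNReal.ofReal (r₀ / 2)) (by simpa using hr₀)
      fun t ht => ?_
    rw [OuterMeasure.restrict_apply]
    change ν (t ∩ A) ≤ _
    rcases (t ∩ A).eq_empty_or_nonempty with he | ⟨x, hxt, hxA⟩
    · simp [he]
    have hfin : Metric.ediam t ≠ ∞ := ne_top_of_le_ne_top ENNReal.ofReal_ne_top ht
    set D := (Metric.ediam t).toReal with hD
    have hD2 : D ≤ r₀ / 2 := ENNReal.toReal_le_of_le_ofReal (by positivity) ht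
    have hlim : Tendsto (fun r : ℝ => ENNReal.ofReal r ^ (s : ℝ)) (𝓝[>] D)
        (𝓝 (Metric.ediam t ^ (s : ℝ))) := by
      have : Tendsto (fun r : ℝ => ENNReal.ofReal r ^ (s : ℝ)) (𝓝 D)
        (𝓝 (ENNReal.ofReal D ^ (s : ℝ))) :=
        ((ENNReal.continuous_rpow_const).comp ENNReal.continuous_ofReal).tendsto D
      rw [hD, ENNReal.ofReal_toReal hfin] at this
      exact this.mono_left nhdsWithin_le_nhds
    refine ge_of_tendsto hlim ?_
    filter_upwards [Ioo_mem_nhdsGT (show D < r₀ by linarith)] with r hr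
    have hr0 : 0 < r := ENNReal.toReal_nonneg.trans_lt hr.1
    refine (measure_mono fun y hy => ?_).trans (h x hxA r ⟨hr0, hr.2⟩)
    have := Metric.edist_le_ediam_of_mem hy.1 hxt
    rw [Metric.mem_closedBall, ← ENNReal.toReal_ofReal hr0.le, dist_edist]
    refine (ENNReal.toReal_mono hfin this).trans ?_
    rw [ENNReal.toReal_ofReal hr0.le]
    exact hr.1.le
  have h1 := key A
  rw [OuterMeasure.restrict_apply, Set.inter_self] at h1
  have h2 : (OuterMeasure.mkMetric fun r => r ^ (s : ℝ)) A = Measure.hausdorffMeasure s A := by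
    rw [Measure.hausdorffMeasure, ← OuterMeasure.coe_mkMetric]
  rw [h2, h0] at h1
  exact hA (le_zero_iff.1 h1)

/-- If the packing sums of a set at scale `δ` are bounded, maximal separated subsets provide
coverings that are efficient enough for its Hausdorff measures of larger exponent to vanish. -/
lemma hausdorffMeasure_eq_zero_of_packingPreMeasure_ne_top [MeasurableSpace α] [BorelSpace α]
    {c : Set α} {s t : ℝ≥0} (hst : s < t) (h : packingPreMeasure (s : ℝ) c ≠ ∞) :
    Measure.hausdorffMeasure (t : ℝ) c = 0 := by
  obtain ⟨δ, hδ, K, hK⟩ : ∃ δ : ℝ, 0 < δ ∧ ∃ K : ℝ≥0, ∀ u : Finset (α × ℝ), IsBallPacking δ c u →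
      ∑ p ∈ u, ENNReal.ofReal (2 * p.2) ^ (s : ℝ) ≤ K := by
    have h' := lt_top_iff_ne_top.2 h
    simp only [packingPreMeasure, iInf_lt_iff] at h'
    obtain ⟨δ, hδ, hlt⟩ := h'
    refine ⟨δ, hδ, ENNReal.toNNReal (⨆ (t : Finset (α × ℝ)) (_ : IsBallPacking δ c t),
      ∑ p ∈ t, ENNReal.ofReal (2 * p.2) ^ (s : ℝ)), fun u hu => ?_⟩
    rw [ENNReal.coe_toNNReal hlt.ne]
    exact le_iSup₂_of_le (f := fun t (_ : IsBallPacking δ c t) =>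
      ∑ p ∈ t, ENNReal.ofReal (2 * p.2) ^ (s : ℝ)) u hu le_rfl
  -- finite `2r`-separated subsets are centers of packings by balls of radius `r`
  have hfin : ∀ r : ℝ≥0, 0 < r → (r : ℝ) ≤ δ → ∀ C : Finset α, (C : Set α) ⊆ c →
      Metric.IsSeparated (2 * r : ℝ≥0) (C : Set α) →
      (C.card : ℝ≥0∞) * (2 * r : ℝ≥0) ^ (s : ℝ) ≤ K := by
    intro r hr hrδ C hC hsep
    have := hK (C.map ⟨fun x => (x, (r : ℝ)), fun x y hxy => (Prod.ext_iff.1 hxy).1⟩) ⟨?_, ?_⟩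
    · rw [Finset.sum_map] at this
      change ∑ _x ∈ C, ENNReal.ofReal (2 * (r : ℝ)) ^ (s : ℝ) ≤ K at this
      rw [Finset.sum_const, nsmul_eq_mul, ENNReal.ofReal_mul (by norm_num),
        ENNReal.ofReal_coe_nnreal] at this
      simpa using this
    · intro p hp
      obtain ⟨x, hx, rfl⟩ := Finset.mem_map.1 hp
      exact ⟨hC hx, hr, hrδ⟩
    · intro p hp p' hp' hne
      obtain ⟨x, hx, rfl⟩ := Finset.mem_map.1 hp
      obtain ⟨y, hy, rfl⟩ := Finset.mem_map.1 hp'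
      have hxy : x ≠ y := fun h => hne (by rw [h])
      have h1 : ((2 * r : ℝ≥0) : ℝ≥0∞) < edist x y := hsep hx hy hxy
      rw [edist_nndist, ENNReal.coe_lt_coe, ← NNReal.coe_lt_coe] at h1
      refine Metric.closedBall_disjoint_closedBall ?_
      push_cast at h1
      change (r : ℝ) + r < dist x y
      linarith
  set r : ℕ → ℝ≥0 := fun n => δ.toNNReal / (n + 1) with hr
  have hδ' : 0 < δ.toNNReal := by simpa using hδ
  have hrpos : ∀ n, 0 < r n := fun n => by simp only [hr]; positivity
  have hrle : ∀ n, (r n : ℝ) ≤ δ := fun n => by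
    have : r n ≤ δ.toNNReal := by
      simp only [hr]
      exact div_le_self (zero_le) (by simp)
    rw [← Real.coe_toNNReal δ hδ.le]
    exact_mod_cast this
  have hpack : ∀ n, ∃ N : ℕ, Metric.packingNumber (2 * r n) c ≤ N := by
    intro n
    have hpos : ((2 * r n : ℝ≥0) : ℝ≥0∞) ^ (s : ℝ) ≠ 0 := by
      rw [← ENNReal.coe_rpow_of_nonneg _ s.coe_nonneg, ENNReal.coe_ne_zero]
      exact (NNReal.rpow_pos (by have := hrpos n; positivity)).ne'
    obtain ⟨N, hN⟩ := ENNReal.exists_nat_gt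
      (ENNReal.div_lt_top (ENNReal.coe_ne_top (r := K)) hpos).ne
    refine ⟨N, iSup₂_le fun C hC => iSup_le fun hsep => ?_⟩
    by_contra! hlt
    obtain ⟨D, hDC, hD⟩ := Set.exists_subset_encard_eq hlt.le
    have hDfin : D.Finite := Set.finite_of_encard_eq_coe hD
    have h1 := hfin (r n) (hrpos n) (hrle n) hDfin.toFinset (by simpa using hDC.trans hC)
      (by simpa using hsep.subset hDC)
    have h2 : hDfin.toFinset.card = N := by
      have := hDfin.encard_eq_coe_toFinset_card
      rw [hD] at this
      exact_mod_cast this.symm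
    rw [h2] at h1
    rw [ENNReal.div_lt_iff (Or.inl hpos) (Or.inr ENNReal.coe_ne_top)] at hN
    exact hN.not_ge h1
  have hne : ∀ n, Metric.packingNumber (2 * r n) c ≠ ⊤ := fun n =>
    ne_top_of_le_ne_top (ENat.natCast_ne_top _) (hpack n).choose_spec
  set M : ℕ → Set α := fun n => Metric.maximalSeparatedSet (2 * r n) c with hM
  have hMfin : ∀ n, (M n).Finite := fun n => by
    rw [← Set.encard_ne_top_iff, hM, Metric.encard_maximalSeparatedSet (hne n)]
    exact hne n
  have : ∀ n, Fintype (M n) := fun n => (hMfin n).fintype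
  have hdiam : ∀ n (x : M n), Metric.ediam (Metric.closedBall (x : α) (2 * r n)) ≤
      (2 * (2 * r n) : ℝ≥0) := fun n x => by
    refine Metric.ediam_le fun y hy z hz => ?_
    rw [edist_nndist, ENNReal.coe_le_coe, ← NNReal.coe_le_coe, coe_nndist]
    have := dist_triangle_right y z x
    rw [Metric.mem_closedBall] at hy hz
    push_cast
    linarith
  have hr0 : Tendsto (fun n => ((2 * (2 * r n) : ℝ≥0) : ℝ≥0∞)) atTop (𝓝 0) := by
    rw [← ENNReal.coe_zero, ENNReal.tendsto_coe]
    have h1 : Tendsto r atTop (𝓝 0) := by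
      rw [← NNReal.tendsto_coe]
      simp only [hr, NNReal.coe_div, NNReal.coe_add, NNReal.coe_natCast, NNReal.coe_one,
        NNReal.coe_zero]
      have := tendsto_one_div_add_atTop_nhds_zero_nat (𝕜 := ℝ)
      simpa [div_eq_mul_inv] using this.const_mul (δ.toNNReal : ℝ)
    simpa using (h1.const_mul 2).const_mul 2
  have hH := Measure.hausdorffMeasure_le_liminf_sum (t : ℝ) c _ hr0
    (fun n (x : M n) => Metric.closedBall (x : α) (2 * r n)) (Eventually.of_forall hdiam)
    (Eventually.of_forall fun n x hx => by
      obtain ⟨y, hy, hxy⟩ := Metric.isCover_maximalSeparatedSet (hne n) hx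
      refine Set.mem_iUnion.2 ⟨⟨y, hy⟩, ?_⟩
      simp only [Set.mem_ofPred_eq] at hxy
      rw [edist_nndist, ENNReal.coe_le_coe, ← NNReal.coe_le_coe] at hxy
      simpa using hxy)
  refine le_zero_iff.1 (hH.trans ?_)
  have hbound : ∀ n, ∑ x : M n, Metric.ediam (Metric.closedBall (x : α) (2 * r n)) ^ (t : ℝ) ≤
      2 ^ (t : ℝ) * K * ((2 * r n : ℝ≥0) : ℝ≥0∞) ^ ((t : ℝ) - s) := fun n => by
    have hne0 : ((2 * r n : ℝ≥0) : ℝ≥0∞) ≠ 0 := by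
      rw [ENNReal.coe_ne_zero]
      exact (mul_pos two_pos (hrpos n)).ne'
    calc ∑ x : M n, Metric.ediam (Metric.closedBall (x : α) (2 * r n)) ^ (t : ℝ)
        ≤ ∑ x : M n, ((2 * (2 * r n) : ℝ≥0) : ℝ≥0∞) ^ (t : ℝ) :=
          Finset.sum_le_sum fun x _ => ENNReal.rpow_le_rpow (hdiam n x) t.2
      _ = ((hMfin n).toFinset.card : ℝ≥0∞) * ((2 * (2 * r n) : ℝ≥0) : ℝ≥0∞) ^ (t : ℝ) := by
          rw [Finset.sum_const, nsmul_eq_mul, Finset.card_univ, ← Set.toFinset_card]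
          congr 3
          ext; simp
      _ = 2 ^ (t : ℝ) * (((hMfin n).toFinset.card : ℝ≥0∞) *
            ((2 * r n : ℝ≥0) : ℝ≥0∞) ^ (s : ℝ)) * ((2 * r n : ℝ≥0) : ℝ≥0∞) ^ ((t : ℝ) - s) := by
          have h2 : ((2 * r n : ℝ≥0) : ℝ≥0∞) ^ (t : ℝ) =
              ((2 * r n : ℝ≥0) : ℝ≥0∞) ^ (s : ℝ) * ((2 * r n : ℝ≥0) : ℝ≥0∞) ^ ((t : ℝ) - s) := by
            rw [← ENNReal.rpow_add _ _ hne0 ENNReal.coe_ne_top]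
            congr 1; ring
          rw [ENNReal.coe_mul, ENNReal.mul_rpow_of_nonneg _ _ t.coe_nonneg, h2]
          simp only [ENNReal.coe_ofNat]
          ring
      _ ≤ _ := by
          gcongr
          refine hfin (r n) (hrpos n) (hrle n) _ ?_ ?_
          · simpa using Metric.maximalSeparatedSet_subset
          · rw [Set.Finite.coe_toFinset]
            exact Metric.isSeparated_maximalSeparatedSet
  have hlim : Tendsto (fun n => 2 ^ (t : ℝ) * (K : ℝ≥0∞) *
      ((2 * r n : ℝ≥0) : ℝ≥0∞) ^ ((t : ℝ) - s)) atTop (𝓝 0) := by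
    have hts : (0 : ℝ) < t - s := sub_pos.2 (by exact_mod_cast hst)
    have h1 : Tendsto (fun n => ((2 * r n : ℝ≥0) : ℝ≥0∞)) atTop (𝓝 0) := by
      refine tendsto_of_tendsto_of_tendsto_of_le_of_le tendsto_const_nhds hr0 (fun _ => zero_le)
        fun n => ENNReal.coe_le_coe.2 (le_mul_of_one_le_left zero_le one_le_two)
    have h2 := (ENNReal.continuous_rpow_const (y := (t : ℝ) - s)).tendsto 0
    rw [ENNReal.zero_rpow_of_pos hts] at h2
    have h3 := ENNReal.Tendsto.const_mul (a := 2 ^ (t : ℝ) * (K : ℝ≥0∞)) (h2.comp h1)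
      (Or.inr (ENNReal.mul_ne_top (by simp) ENNReal.coe_ne_top))
    simpa using h3
  calc _ ≤ liminf (fun n => 2 ^ (t : ℝ) * (K : ℝ≥0∞) *
      ((2 * r n : ℝ≥0) : ℝ≥0∞) ^ ((t : ℝ) - s)) atTop :=
        liminf_le_liminf (Eventually.of_forall hbound)
    _ = 0 := hlim.liminf_eq

lemma dimH_le_packingDim (Y : Set α) : dimH Y ≤ packingDim Y := by
  borelize α
  refine le_of_forall_lt_imp_le_of_dense fun a ha => ?_
  obtain ⟨s, has, hs⟩ := ENNReal.lt_iff_exists_nnreal_btwn.1 ha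
  obtain ⟨t, hst, ht⟩ := ENNReal.lt_iff_exists_nnreal_btwn.1 hs
  refine has.le.trans (le_iSup₂_of_le s (top_unique (le_iInf₂ fun c hc => ?_)) le_rfl)
  have hY : Measure.hausdorffMeasure (t : ℝ) Y ≠ 0 := by
    rw [hausdorffMeasure_of_lt_dimH ht]
    exact ENNReal.top_ne_zero
  by_contra hne
  refine hY (measure_mono_null hc (measure_iUnion_null fun i => ?_))
  refine hausdorffMeasure_eq_zero_of_packingPreMeasure_ne_top (by exact_mod_cast hst) fun htop =>
    hne ?_
  exact htop.symm.le.trans (ENNReal.le_tsum (f := fun i => packingPreMeasure (s : ℝ) (c i)) i)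

/-- A lower bound on the measures of small balls centered in `A` makes the packing pre-measures of
`A` of larger exponents vanish. -/
lemma packingPreMeasure_eq_zero [MeasurableSpace α] [BorelSpace α] {ν : Measure α}
    [IsFiniteMeasure ν] {A : Set α} {t s r₀ : ℝ} (hr₀ : 0 < r₀) (hs : 0 ≤ s) (hts : t < s)
    (h : ∀ x ∈ A, ∀ r ∈ Set.Ioo 0 r₀, ENNReal.ofReal r ^ t ≤ ν (Metric.closedBall x r)) :
    packingPreMeasure s A = 0 := by
  have hle : ∀ δ ∈ Set.Ioo 0 r₀, packingPreMeasure s A ≤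
      2 ^ s * ν Set.univ * ENNReal.ofReal δ ^ (s - t) := by
    intro δ hδ
    refine iInf₂_le_of_le δ hδ.1 (iSup₂_le fun u hu => ?_)
    calc ∑ p ∈ u, ENNReal.ofReal (2 * p.2) ^ s
        ≤ ∑ p ∈ u, 2 ^ s * ENNReal.ofReal δ ^ (s - t) * ν (Metric.closedBall p.1 p.2) := by
          refine Finset.sum_le_sum fun p hp => ?_
          obtain ⟨hpA, hp0, hpδ⟩ := hu.1 p hp
          have hne : ENNReal.ofReal p.2 ≠ 0 := by simpa using hp0
          rw [ENNReal.ofReal_mul (by norm_num), ENNReal.mul_rpow_of_nonneg _ _ hs]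
          have h2 : ENNReal.ofReal p.2 ^ s =
              ENNReal.ofReal p.2 ^ (s - t) * ENNReal.ofReal p.2 ^ t := by
            rw [← ENNReal.rpow_add _ _ hne ENNReal.ofReal_ne_top]
            congr 1; ring
          rw [h2, ← mul_assoc]
          have h3 := h p.1 hpA p.2 ⟨hp0, hpδ.trans_lt hδ.2⟩
          have h4 : ENNReal.ofReal p.2 ^ (s - t) ≤ ENNReal.ofReal δ ^ (s - t) :=
            ENNReal.rpow_le_rpow (ENNReal.ofReal_le_ofReal hpδ) (sub_pos.2 hts).le
          simp only [ENNReal.ofReal_ofNat]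
          gcongr
      _ = 2 ^ s * ENNReal.ofReal δ ^ (s - t) * ν (⋃ p ∈ u, Metric.closedBall p.1 p.2) := by
          rw [← Finset.mul_sum, measure_biUnion_finset hu.2 fun p _ =>
              Metric.isClosed_closedBall.measurableSet]
      _ ≤ 2 ^ s * ENNReal.ofReal δ ^ (s - t) * ν Set.univ := by
          gcongr
          exact Set.subset_univ _
      _ = _ := by ring
  have hlim : Tendsto (fun δ : ℝ => 2 ^ s * ν Set.univ * ENNReal.ofReal δ ^ (s - t)) (𝓝[>] 0)
      (𝓝 0) := by
    have h1 : Tendsto (fun δ : ℝ => ENNReal.ofReal δ ^ (s - t)) (𝓝 0) (𝓝 0) := by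
      have := ((ENNReal.continuous_rpow_const (y := s - t)).comp
        ENNReal.continuous_ofReal).tendsto 0
      simpa [ENNReal.zero_rpow_of_pos (sub_pos.2 hts), Function.comp_def] using this
    have h3 := ENNReal.Tendsto.const_mul (a := 2 ^ s * ν Set.univ)
      (h1.mono_left (nhdsWithin_le_nhds (s := Set.Ioi 0)))
      (Or.inr (ENNReal.mul_ne_top (by simp) (measure_ne_top _ _)))
    simpa using h3
  refine le_zero_iff.1 (ge_of_tendsto hlim ?_)
  filter_upwards [Ioo_mem_nhdsGT hr₀] with δ hδ using hle δ hδ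

/-- If the local dimension of a probability measure `ν` is `ν`-almost everywhere equal to `d`, then
the Hausdorff and packing dimensions of `ν` are both equal to `d`. -/
theorem hasDim_of_local_dim [MeasurableSpace α] [BorelSpace α] {ν : Measure α}
    [IsProbabilityMeasure ν] {d : ℝ}
    (h : ∀ᵐ x ∂ν, ∀ ε > 0, ∀ᶠ r in 𝓝[>] (0 : ℝ),
      ENNReal.ofReal r ^ (d + ε) ≤ ν (Metric.closedBall x r) ∧
      ν (Metric.closedBall x r) ≤ ENNReal.ofReal r ^ (d - ε)) :
    HasHausdorffDim ν (d : EReal) ∧ HasPackingDim ν (d : EReal) := by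
  have hd : 0 ≤ d := by
    by_contra! hd
    obtain ⟨x, hx⟩ := h.exists
    obtain ⟨r, ⟨h1, -⟩, hr⟩ := ((hx (-d / 2) (by linarith)).and
      (Ioo_mem_nhdsGT (zero_lt_one (α := ℝ)))).exists
    have h2 : 1 < ENNReal.ofReal r ^ (d + -d / 2) := by
      rw [← neg_neg (d + -d / 2), ENNReal.rpow_neg, ENNReal.one_lt_inv]
      exact ENNReal.rpow_lt_one (ENNReal.ofReal_lt_one.2 hr.2) (by linarith)
    exact (h2.trans_le h1).not_ge prob_le_one
  -- the Hausdorff dimension is at least `d` on every set of positive measure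
  have hlow : ENNReal.ofReal d ≤ lowerMeasureDim dimH ν := by
    refine le_iInf₂ fun Y _ => le_iInf fun hY => le_of_forall_lt_imp_le_of_dense fun a ha => ?_
    obtain ⟨s, has, hs⟩ := ENNReal.lt_iff_exists_nnreal_btwn.1 ha
    have hsd : (s : ℝ) < d := by
      rw [← ENNReal.ofReal_coe_nnreal] at hs
      exact ENNReal.lt_ofReal_iff_toReal_lt (by simp) |>.1 hs |>.trans_eq' (by simp)
    set A : ℕ → Set α := fun n => {x | ∀ r ∈ Set.Ioo (0 : ℝ) (1 / (n + 1)),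
      ν (Metric.closedBall x r) ≤ ENNReal.ofReal r ^ (s : ℝ)} with hA
    have hcov : ν (⋃ n, Y ∩ A n) ≠ 0 := by
      rw [← Set.inter_iUnion, measure_inter_conull]
      · exact hY.ne'
      filter_upwards [h] with x hx
      obtain ⟨ρ, hρ, hρ'⟩ := mem_nhdsGT_iff_exists_Ioo_subset.1 (hx (d - s) (by linarith))
      obtain ⟨n, hn⟩ := exists_nat_one_div_lt (Set.mem_Ioi.1 hρ)
      refine Set.mem_iUnion.2 ⟨n, fun r hr => ?_⟩
      have := (hρ' ⟨hr.1, hr.2.trans hn⟩).2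
      rwa [sub_sub_cancel] at this
    obtain ⟨n, hn⟩ : ∃ n, ν (Y ∩ A n) ≠ 0 := by
      by_contra! hcon
      exact hcov (measure_iUnion_null hcon)
    exact has.le.trans ((le_dimH_of_measure_closedBall_le (Nat.one_div_pos_of_nat (n := n))
      (fun x hx => hx.2) hn).trans (dimH_mono Set.inter_subset_left))
  -- some set of full measure has packing dimension at most `d`
  have hupp : upperMeasureDim packingDim ν ≤ ENNReal.ofReal d := by
    obtain ⟨N, hN, hNm, hN0⟩ := exists_measurable_superset_of_null (ae_iff.1 h)
    refine iInf₂_le_of_le Nᶜ hNm.compl (iInf_le_of_le (by rwa [compl_compl]) ?_)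
    refine iSup₂_le fun s hs => ?_
    by_contra! hlt
    have hsd : d < s := by
      rw [← ENNReal.ofReal_coe_nnreal] at hlt
      exact (ENNReal.ofReal_lt_ofReal_iff_of_nonneg hd).1 hlt
    set A : ℕ → Set α := fun n => {x | ∀ r ∈ Set.Ioo (0 : ℝ) (1 / (n + 1)),
      ENNReal.ofReal r ^ ((d + s) / 2) ≤ ν (Metric.closedBall x r)} with hA
    have hcov : Nᶜ ⊆ ⋃ n, A n := by
      intro x hx
      have hx' := by_contra fun hc => hx (hN hc)
      obtain ⟨ρ, hρ, hρ'⟩ := mem_nhdsGT_iff_exists_Ioo_subset.1 (hx' ((s - d) / 2) (by linarith))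
      obtain ⟨n, hn⟩ := exists_nat_one_div_lt (Set.mem_Ioi.1 hρ)
      refine Set.mem_iUnion.2 ⟨n, fun r hr => ?_⟩
      have := (hρ' ⟨hr.1, hr.2.trans hn⟩).1
      rwa [show d + (s - d) / 2 = (d + s) / 2 by ring] at this
    have h0 : packingMeasure (s : ℝ) Nᶜ = 0 := by
      refine le_zero_iff.1 (iInf₂_le_of_le A hcov ?_)
      exact (ENNReal.tsum_eq_zero.2 fun n => packingPreMeasure_eq_zero (ν := ν)
        (t := (d + s) / 2) (Nat.one_div_pos_of_nat (n := n)) s.coe_nonneg (by linarith)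
        fun x hx => hx).le
    exact ENNReal.top_ne_zero (hs ▸ h0)
  have hmono : ∀ dim : Set α → ℝ≥0∞, lowerMeasureDim dim ν ≤ upperMeasureDim dim ν := fun dim =>
    le_iInf₂ fun Y hY => le_iInf fun hY0 => iInf₂_le_of_le Y hY (iInf_le_of_le (by
      rw [(prob_compl_eq_zero_iff hY).1 hY0]
      exact one_pos) le_rfl)
  have h1 : lowerMeasureDim dimH ν ≤ lowerMeasureDim packingDim ν :=
    iInf_mono fun Y => iInf_mono fun _ => iInf_mono fun _ => dimH_le_packingDim Y
  have h2 : upperMeasureDim dimH ν ≤ upperMeasureDim packingDim ν :=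
    iInf_mono fun Y => iInf_mono fun _ => iInf_mono fun _ => dimH_le_packingDim Y
  have h3 : ∀ a : ℝ≥0∞, ENNReal.ofReal d ≤ a → a ≤ ENNReal.ofReal d → (a : EReal) = d := by
    intro a ha ha'
    rw [le_antisymm ha' ha, EReal.coe_ennreal_ofReal, max_eq_left hd]
  exact ⟨⟨h3 _ hlow ((hmono _).trans (h2.trans hupp)),
    h3 _ (hlow.trans (hmono _)) (h2.trans hupp)⟩,
    h3 _ (hlow.trans h1) ((hmono _).trans hupp), h3 _ (hlow.trans (h1.trans (hmono _))) hupp⟩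

end Dimension

/-! ### Conditional probabilities and conditional entropy over a disintegrated measure -/

section FiberMap

variable {Λ Ω V : Type*} [MeasurableSpace Λ] [MeasurableSpace Ω] [MeasurableSpace V]

/-- The kernel of the images `(κ l) ∘ p(l, ·)⁻¹` of the measures `κ l` under the fibre maps of
`p`. -/
noncomputable def fiberMap (κ : Kernel Λ Ω) [IsSFiniteKernel κ] (p : Λ × Ω → V)
    (hp : Measurable p) : Kernel Λ V where
  toFun l := (κ l).map fun ω => p (l, ω)
  measurable' := by
    refine Measure.measurable_of_measurable_coe _ fun B hB => ?_
    have h : ∀ l, Measurable fun ω => p (l, ω) := fun l => hp.comp measurable_prodMk_left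
    simp_rw [Measure.map_apply (h _) hB]
    exact Kernel.measurable_kernel_prodMk_left (hp hB)

lemma fiberMap_apply (κ : Kernel Λ Ω) [IsSFiniteKernel κ] {p : Λ × Ω → V}
    (hp : Measurable p) (l : Λ) : fiberMap κ p hp l = (κ l).map fun ω => p (l, ω) := rfl

lemma fiberMap_apply' (κ : Kernel Λ Ω) [IsSFiniteKernel κ] {p : Λ × Ω → V}
    (hp : Measurable p) (l : Λ) {B : Set V} (hB : MeasurableSet B) :
    fiberMap κ p hp l B = κ l {ω | p (l, ω) ∈ B} :=
  Measure.map_apply (hp.comp measurable_prodMk_left) hB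

instance (κ : Kernel Λ Ω) [IsFiniteKernel κ] (p : Λ × Ω → V) (hp : Measurable p) :
    IsFiniteKernel (fiberMap κ p hp) :=
  ⟨κ.bound, κ.bound_lt_top, fun l => by
    rw [fiberMap_apply' κ hp l MeasurableSet.univ]
    exact Kernel.measure_le_bound κ l _⟩

variable {m : Measure Λ} [IsProbabilityMeasure m] {κ : Kernel Λ Ω} [IsMarkovKernel κ]

/-- Conditional probabilities given the base point and the value of `p` can be computed fibre by
fibre. -/
theorem condExp_indicator_compProd {p : Λ × Ω → V} (hp : Measurable p) {C : Set (Λ × Ω)}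
    (hC : MeasurableSet C) {g : Λ × V → ℝ≥0∞} (hg : Measurable g)
    (h : ∀ l, ∀ B, MeasurableSet B → ∫⁻ ω in {ω | p (l, ω) ∈ B}, g (l, p (l, ω)) ∂κ l =
      κ l {ω | p (l, ω) ∈ B ∧ (l, ω) ∈ C}) :
    (m ⊗ₘ κ)[C.indicator (fun _ => (1 : ℝ)) |
      MeasurableSpace.comap Prod.fst inferInstance ⊔ MeasurableSpace.comap p inferInstance]
      =ᵐ[m ⊗ₘ κ] fun x => (g (x.1, p x)).toReal := by
  rw [← MeasurableSpace.comap_prodMk]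
  have hq : Measurable fun x : Λ × Ω => (x.1, p x) := measurable_fst.prodMk hp
  have hgq : Measurable fun x : Λ × Ω => g (x.1, p x) := hg.comp hq
  have key : ∀ s,
      MeasurableSet[MeasurableSpace.comap (fun x : Λ × Ω => (x.1, p x)) inferInstance] s →
      ∫⁻ x in s, g (x.1, p x) ∂(m ⊗ₘ κ) = (m ⊗ₘ κ) (s ∩ C) := by
    rintro s ⟨B, hB, rfl⟩
    rw [← lintegral_indicator (hq hB), Measure.lintegral_compProd (hgq.indicator (hq hB)),
      Measure.compProd_apply ((hq hB).inter hC)]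
    refine lintegral_congr fun l => ?_
    have hBl : MeasurableSet (Prod.mk l ⁻¹' B) := measurable_prodMk_left hB
    have := h l _ hBl
    have hpl : MeasurableSet {ω | p (l, ω) ∈ Prod.mk l ⁻¹' B} :=
      (hp.comp measurable_prodMk_left) hBl
    rw [← lintegral_indicator hpl] at this
    exact this
  have hfin : ∫⁻ x, g (x.1, p x) ∂(m ⊗ₘ κ) ≠ ∞ := by
    rw [← setLIntegral_univ, key _ MeasurableSet.univ]
    exact measure_ne_top _ _
  have hae : ∀ᵐ x ∂(m ⊗ₘ κ), g (x.1, p x) < ∞ := ae_lt_top hgq hfin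
  have hint : Integrable (fun x => (g (x.1, p x)).toReal) (m ⊗ₘ κ) :=
    integrable_toReal_of_lintegral_ne_top hgq.aemeasurable hfin
  symm
  refine ae_eq_condExp_of_forall_setIntegral_eq hq.comap_le
    ((integrable_const (1 : ℝ)).indicator hC) (fun s _ _ => hint.integrableOn) (fun s hs _ => ?_) ?_
  · rw [integral_toReal hgq.aemeasurable (ae_restrict_of_ae hae), key s hs,
      integral_indicator_const _ hC, Measure.real, Measure.restrict_apply hC, Set.inter_comm]
    simp
  · exact (hg.comp (comap_measurable _)).ennreal_toReal.stronglyMeasurable.aestronglyMeasurable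

end FiberMap

/-- The conditional entropy of the partition into the fibres of `b` is the integral of the
information function `-log g (b x) x`, for any versions `g e` of the conditional probabilities. -/
lemma condEntropy_eq_lintegral {Ω E : Type*} [Countable E] {𝒜 m₀ : MeasurableSpace Ω}
    {μ : Measure Ω} (b : Ω → E) {g : E → Ω → ℝ}
    (hg : ∀ e, μ[{x | b x = e}.indicator (fun _ => (1 : ℝ)) | 𝒜] =ᵐ[μ] g e) :
    condEntropy μ (fun e => {x | b x = e}) 𝒜 =
      ∫⁻ x, ENNReal.ofReal (-Real.log (g (b x) x)) ∂μ := by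
  refine lintegral_congr_ae ?_
  filter_upwards [ae_all_iff.2 hg] with x hx
  rw [tsum_eq_single (b x)]
  · rw [Set.indicator_of_mem (by simp), hx]
  · intro e he
    exact Set.indicator_of_notMem (fun h => he h.symm) _

/-! ### A maximal inequality for ratios of measures of balls -/

section Maximal

/-- A maximal inequality coming from the Besicovitch covering theorem: a set of points `x` such that
`ρ` is small relatively to `ν` on some ball centered at `x` has small `ρ`-measure. -/
theorem exists_measure_le_of_closedBall_ratio_le (V : Type*) [MetricSpace V] [MeasurableSpace V]
    [BorelSpace V] [SecondCountableTopology V] [HasBesicovitchCovering V] :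
    ∃ N : ℕ, ∀ (ρ ν : Measure V) (t : ℝ≥0∞) (A : Set V),
      (∀ x ∈ A, ∃ r ∈ Set.Ioo (0 : ℝ) 1,
        ρ (Metric.closedBall x r) ≤ t * ν (Metric.closedBall x r)) →
      ρ A ≤ N * t * ν Set.univ := by
  obtain ⟨N, τ, hτ, hN⟩ := HasBesicovitchCovering.no_satelliteConfig (α := V)
  refine ⟨N, fun ρ ν t A hA => ?_⟩
  choose! r hr hle using hA
  obtain ⟨s, hs, hcov⟩ := Besicovitch.exist_disjoint_covering_families hτ hN
    (⟨fun x : A => (x : V), fun x => r x, fun x => (hr x x.2).1, 1, fun x => (hr x x.2).2.le⟩ :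
      Besicovitch.BallPackage A V)
  have hcount : ∀ i, (s i).Countable := fun i =>
    (hs i).countable_of_nonempty_interior fun x _ =>
      ⟨x, Metric.ball_subset_interior_closedBall (Metric.mem_ball_self (hr x x.2).1)⟩
  calc ρ A ≤ ρ (⋃ i : Fin N, ⋃ j ∈ s i, Metric.closedBall (j : V) (r j)) := by
        refine measure_mono fun x hx => ?_
        have := hcov ⟨⟨x, hx⟩, rfl⟩
        simp only [Set.mem_iUnion] at this ⊢
        obtain ⟨i, j, hj, hxj⟩ := this
        exact ⟨i, j, hj, Metric.ball_subset_closedBall hxj⟩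
    _ ≤ ∑ i : Fin N, ρ (⋃ j ∈ s i, Metric.closedBall (j : V) (r j)) := measure_iUnion_fintype_le _ _
    _ ≤ ∑ _i : Fin N, t * ν Set.univ := by
        refine Finset.sum_le_sum fun i _ => ?_
        calc ρ (⋃ j ∈ s i, Metric.closedBall (j : V) (r j))
            = ∑' j : s i, ρ (Metric.closedBall (j : V) (r j)) :=
              measure_biUnion (hcount i) (hs i) fun _ _ => Metric.isClosed_closedBall.measurableSet
          _ ≤ ∑' j : s i, t * ν (Metric.closedBall (j : V) (r j)) :=
              ENNReal.tsum_le_tsum fun j => hle _ j.1.2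
          _ = t * ν (⋃ j ∈ s i, Metric.closedBall (j : V) (r j)) := by
              rw [ENNReal.tsum_mul_left, measure_biUnion (hcount i) (hs i)
                fun _ _ => Metric.isClosed_closedBall.measurableSet]
          _ ≤ t * ν Set.univ := by
              gcongr
              exact Set.subset_univ _
    _ = N * t * ν Set.univ := by simp [mul_assoc]

lemma ENNReal.le_ofReal_add_tsum_indicator (y : ℝ≥0∞) {c : ℝ} (hc : 0 ≤ c) :
    y ≤ ENNReal.ofReal c + ∑' n : ℕ, {z : ℝ≥0∞ | ENNReal.ofReal (c + n) < z}.indicator 1 y := by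
  refine le_of_forall_lt_imp_le_of_dense fun b hb => ?_
  lift b to ℝ≥0 using hb.ne_top
  rcases le_or_gt (b : ℝ) c with h | h
  · exact le_add_right (by rw [← ENNReal.ofReal_coe_nnreal]; exact ENNReal.ofReal_le_ofReal h)
  have hk := Nat.lt_floor_add_one ((b : ℝ) - c)
  have hk' := Nat.floor_le (sub_nonneg.2 h.le)
  set k := ⌊(b : ℝ) - c⌋₊
  calc (b : ℝ≥0∞) ≤ ENNReal.ofReal (c + (k + 1 : ℕ)) := by
        rw [← ENNReal.ofReal_coe_nnreal]
        refine ENNReal.ofReal_le_ofReal ?_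
        push_cast; linarith
    _ = ENNReal.ofReal c + ∑ n ∈ Finset.range (k + 1), 1 := by
        rw [ENNReal.ofReal_add hc (by positivity), ENNReal.ofReal_natCast]
        simp
    _ ≤ ENNReal.ofReal c + ∑ n ∈ Finset.range (k + 1),
          {z : ℝ≥0∞ | ENNReal.ofReal (c + n) < z}.indicator 1 y := by
        gcongr with n hn
        rw [Set.indicator_of_mem]
        · simp
        refine lt_of_le_of_lt ?_ hb
        rw [← ENNReal.ofReal_coe_nnreal]
        refine ENNReal.ofReal_le_ofReal ?_
        have : (n : ℝ) ≤ k := by exact_mod_cast Nat.lt_succ_iff.1 (Finset.mem_range.1 hn)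
        linarith
    _ ≤ _ := by
        gcongr
        exact ENNReal.sum_le_tsum _

end Maximal

/-! ### Conditional probabilities of letters as limits over shrinking balls -/

section LetterRatio

variable {Λ Ω V E : Type*} [MeasurableSpace Λ] [MeasurableSpace Ω]

/-- The proportion, within the points of the fibre of `x` whose image under `p` is `r`-close to the
image of `x`, of those having the same letter as `x`. -/
noncomputable def letterRatio [PseudoMetricSpace V] (κ : Kernel Λ Ω) (a : Ω → E) (p : Λ × Ω → V)
    (x : Λ × Ω) (r : ℝ) : ℝ :=
  (κ x.1).real {ω | a ω = a x.2 ∧ dist (p (x.1, ω)) (p x) ≤ r} /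
    (κ x.1).real {ω | dist (p (x.1, ω)) (p x) ≤ r}

lemma letterRatio_nonneg [PseudoMetricSpace V] (κ : Kernel Λ Ω) (a : Ω → E) (p : Λ × Ω → V)
    (x : Λ × Ω) (r : ℝ) : 0 ≤ letterRatio κ a p x r :=
  div_nonneg measureReal_nonneg measureReal_nonneg

lemma letterRatio_le_one [PseudoMetricSpace V] (κ : Kernel Λ Ω) [IsFiniteKernel κ] (a : Ω → E)
    (p : Λ × Ω → V) (x : Λ × Ω) (r : ℝ) : letterRatio κ a p x r ≤ 1 :=
  div_le_one_of_le₀ (measureReal_mono fun _ h => h.2) measureReal_nonneg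

variable [Countable E] [MeasurableSpace E] [DiscreteMeasurableSpace E]
  {κ : Kernel Λ Ω} {a : Ω → E}

/-- The part of the kernel `κ` carried by the points with letter `e`. -/
noncomputable def letterKernel (κ : Kernel Λ Ω) (ha : Measurable a) (e : E) : Kernel Λ Ω :=
  κ.restrict (ha (measurableSet_singleton e))

lemma letterKernel_apply (ha : Measurable a) (e : E) (l : Λ) :
    letterKernel κ ha e l = (κ l).restrict {ω | a ω = e} := rfl

lemma ae_of_forall_letter (ha : Measurable a) {l : Λ} {P : E → Ω → Prop}
    (h : ∀ e, ∀ᵐ ω ∂letterKernel κ ha e l, P e ω) : ∀ᵐ ω ∂κ l, P (a ω) ω := by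
  have h' : ∀ e, ∀ᵐ ω ∂κ l, a ω = e → P e ω := fun e =>
    (ae_restrict_iff' (ha (measurableSet_singleton e))).1 (h e)
  filter_upwards [ae_all_iff.2 h'] with ω hω using hω _ rfl

lemma measurableSet_letter_eq (ha : Measurable a) :
    MeasurableSet {y : (Λ × Ω) × Ω | a y.2 = a y.1.2} :=
  ((ha.comp measurable_snd).prodMk (ha.comp measurable_fst.snd))
    (MeasurableSet.of_discrete (s := {e : E × E | e.1 = e.2}))

lemma measurableSet_dist_le [PseudoMetricSpace V] [SecondCountableTopology V] [MeasurableSpace V]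
    [OpensMeasurableSpace V] {p : Λ × Ω → V} (hp : Measurable p) (r : ℝ) :
    MeasurableSet {y : (Λ × Ω) × Ω | dist (p (y.1.1, y.2)) (p y.1) ≤ r} :=
  measurableSet_le ((hp.comp (measurable_fst.fst.prodMk measurable_snd)).dist
    (hp.comp measurable_fst)) measurable_const

variable [IsMarkovKernel κ]

instance (ha : Measurable a) (e : E) : IsFiniteKernel (letterKernel κ ha e) := by
  unfold letterKernel; infer_instance

variable [MeasurableSpace V] {p : Λ × Ω → V}

lemma fiberMap_letterKernel_apply (ha : Measurable a) (hp : Measurable p) (e : E) (l : Λ)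
    {B : Set V} (hB : MeasurableSet B) : fiberMap (letterKernel κ ha e) p hp l B =
      κ l {ω | a ω = e ∧ p (l, ω) ∈ B} := by
  have hB' : MeasurableSet {ω | p (l, ω) ∈ B} := (hp.comp measurable_prodMk_left) hB
  rw [fiberMap_apply' _ hp l hB, letterKernel_apply, Measure.restrict_apply hB', Set.inter_comm]
  rfl

lemma fiberMap_letterKernel_le (ha : Measurable a) (hp : Measurable p) (e : E) (l : Λ) :
    fiberMap (letterKernel κ ha e) p hp l ≤ fiberMap κ p hp l :=
  Measure.map_mono Measure.restrict_le_self (hp.comp measurable_prodMk_left)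

variable [MetricSpace V] [BorelSpace V] [SecondCountableTopology V]

lemma measurable_letterRatio (ha : Measurable a) (hp : Measurable p) (r : ℝ) :
    Measurable fun x => letterRatio κ a p x r := by
  exact (Kernel.measurable_kernel_prodMk_left (κ := κ.comap Prod.fst measurable_fst)
      ((measurableSet_letter_eq ha).inter (measurableSet_dist_le hp r))).ennreal_toReal.div
    (Kernel.measurable_kernel_prodMk_left (κ := κ.comap Prod.fst measurable_fst)
      (measurableSet_dist_le hp r)).ennreal_toReal

/-- The conditional probability of the letter `e`, as a function of the base point and of the value
of `p`. -/
noncomputable def letterProb (κ : Kernel Λ Ω) [IsMarkovKernel κ] (ha : Measurable a)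
    (hp : Measurable p) (e : E) (y : Λ × V) : ℝ≥0∞ :=
  Kernel.rnDeriv (fiberMap (letterKernel κ ha e) p hp) (fiberMap κ p hp) y.1 y.2

lemma measurable_letterProb (ha : Measurable a) (hp : Measurable p) (e : E) :
    Measurable (letterProb κ ha hp e) := Kernel.measurable_rnDeriv _ _

theorem condExp_letter {m : Measure Λ} [IsProbabilityMeasure m] (ha : Measurable a)
    (hp : Measurable p) (e : E) :
    (m ⊗ₘ κ)[{x | a x.2 = e}.indicator (fun _ => (1 : ℝ)) |
      MeasurableSpace.comap Prod.fst inferInstance ⊔ MeasurableSpace.comap p inferInstance]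
      =ᵐ[m ⊗ₘ κ] fun x => (letterProb κ ha hp e (x.1, p x)).toReal := by
  refine condExp_indicator_compProd hp ((ha.comp measurable_snd) (measurableSet_singleton e))
    (measurable_letterProb ha hp e) fun l B hB => ?_
  have hpl : Measurable fun ω => p (l, ω) := hp.comp measurable_prodMk_left
  have h1 : ∫⁻ v in B, letterProb κ ha hp e (l, v) ∂fiberMap κ p hp l =
      fiberMap (letterKernel κ ha e) p hp l B :=
    Kernel.setLIntegral_rnDeriv (fiberMap_letterKernel_le ha hp e l).absolutelyContinuous hB
  have hg : Measurable fun v => letterProb κ ha hp e (l, v) :=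
    (measurable_letterProb ha hp e).comp measurable_prodMk_left
  rw [fiberMap_letterKernel_apply ha hp e l hB, fiberMap_apply, setLIntegral_map hB hg hpl] at h1
  simp only [and_comm (a := p (l, _) ∈ B)]
  exact h1

lemma ae_measure_letter_pos (ha : Measurable a) (hp : Measurable p) (l : Λ) :
    ∀ᵐ ω ∂κ l, ∀ r > 0, 0 < κ l {ω' | a ω' = a ω ∧ dist (p (l, ω')) (p (l, ω)) ≤ r} := by
  refine ae_of_forall_letter ha (P := fun e ω => ∀ r > 0,
    0 < κ l {ω' | a ω' = e ∧ dist (p (l, ω')) (p (l, ω)) ≤ r}) fun e => ?_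
  have h := (fiberMap (letterKernel κ ha e) p hp l).support_mem_ae
  have h2 := ae_of_ae_map (hp.comp measurable_prodMk_left).aemeasurable h
  filter_upwards [h2] with ω hω r hr
  have := (Measure.mem_support_iff_forall _).1 hω _ (Metric.closedBall_mem_nhds _ hr)
  rwa [fiberMap_letterKernel_apply ha hp e l Metric.isClosed_closedBall.measurableSet] at this

lemma ae_tendsto_letterRatio [HasBesicovitchCovering V] (ha : Measurable a) (hp : Measurable p)
    (l : Λ) : ∀ᵐ ω ∂κ l, 0 < (letterProb κ ha hp (a ω) (l, p (l, ω))).toReal ∧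
      Tendsto (fun r => letterRatio κ a p (l, ω) r) (𝓝[>] 0)
        (𝓝 (letterProb κ ha hp (a ω) (l, p (l, ω))).toReal) := by
  have hpl : Measurable fun ω => p (l, ω) := hp.comp measurable_prodMk_left
  refine ae_of_forall_letter ha (P := fun e ω =>
    0 < (letterProb κ ha hp e (l, p (l, ω))).toReal ∧
      Tendsto (fun r => (κ l).real {ω' | a ω' = e ∧ dist (p (l, ω')) (p (l, ω)) ≤ r} /
        (κ l).real {ω' | dist (p (l, ω')) (p (l, ω)) ≤ r}) (𝓝[>] 0)
        (𝓝 (letterProb κ ha hp e (l, p (l, ω))).toReal)) fun e => ?_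
  set ρ := fiberMap (letterKernel κ ha e) p hp with hρ
  set ν := fiberMap κ p hp with hν
  have hac : ρ l ≪ ν l := (fiberMap_letterKernel_le ha hp e l).absolutelyContinuous
  have h1 : ∀ᵐ v ∂ρ l, 0 < ρ.rnDeriv ν l v := Kernel.rnDeriv_pos hac
  have h2 : ∀ᵐ v ∂ρ l, ρ.rnDeriv ν l v < ∞ := hac.ae_le (Kernel.rnDeriv_lt_top ρ ν)
  have h3 : ∀ᵐ v ∂ρ l, ρ.rnDeriv ν l v = (ρ l).rnDeriv (ν l) v :=
    hac.ae_le Kernel.rnDeriv_eq_rnDeriv_measure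
  have h4 : ∀ᵐ v ∂ρ l, _ := hac.ae_le (Besicovitch.ae_tendsto_rnDeriv (ρ l) (ν l))
  filter_upwards [ae_of_ae_map hpl.aemeasurable h1, ae_of_ae_map hpl.aemeasurable h2,
    ae_of_ae_map hpl.aemeasurable h3, ae_of_ae_map hpl.aemeasurable h4] with ω h1 h2 h3 h4
  refine ⟨ENNReal.toReal_pos h1.ne' h2.ne, ?_⟩
  rw [← h3] at h4
  have h5 := (ENNReal.tendsto_toReal h2.ne).comp h4
  refine h5.congr fun r => ?_
  simp only [Function.comp_apply, ENNReal.toReal_div, Measure.real, hρ, hν]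
  rw [fiberMap_letterKernel_apply ha hp e l Metric.isClosed_closedBall.measurableSet,
    fiberMap_apply' κ hp l Metric.isClosed_closedBall.measurableSet]
  rfl

lemma tendsto_measureReal_and_le_right {Ω : Type*} [MeasurableSpace Ω]
    {μ : Measure Ω} [IsFiniteMeasure μ] {f : Ω → ℝ} (hf : Measurable f) {C : Set Ω}
    (hC : MeasurableSet C) (r : ℝ) :
    Tendsto (fun s => μ.real {ω | ω ∈ C ∧ f ω ≤ s}) (𝓝[>] r)
      (𝓝 (μ.real {ω | ω ∈ C ∧ f ω ≤ r})) := by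
  have h := tendsto_measure_biInter_gt (μ := μ) (s := fun s : ℝ => {ω | ω ∈ C ∧ f ω ≤ s}) (a := r)
    (fun s _ => (hC.inter (measurableSet_le hf measurable_const)).nullMeasurableSet)
    (fun s t _ hst ω hω => ⟨hω.1, hω.2.trans hst⟩) ⟨r + 1, by simp, measure_ne_top _ _⟩
  have h2 : (⋂ s > r, {ω | ω ∈ C ∧ f ω ≤ s}) = {ω | ω ∈ C ∧ f ω ≤ r} := by
    ext ω
    simp only [Set.mem_iInter, Set.mem_ofPred_eq]
    exact ⟨fun h => ⟨(h (r + 1) (by simp)).1, le_of_forall_gt_imp_ge_of_dense fun s hs =>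
        (h s hs).2⟩,
      fun h s hs => ⟨h.1, h.2.trans hs.le⟩⟩
  rw [h2] at h
  exact (ENNReal.tendsto_toReal (measure_ne_top _ _)).comp h

lemma tendsto_letterRatio_right (ha : Measurable a) (hp : Measurable p) {x : Λ × Ω} {r : ℝ}
    (h : 0 < κ x.1 {ω | dist (p (x.1, ω)) (p x) ≤ r}) :
    Tendsto (fun s => letterRatio κ a p x s) (𝓝[>] r) (𝓝 (letterRatio κ a p x r)) := by
  have hf : Measurable fun ω => dist (p (x.1, ω)) (p x) :=
    (hp.comp measurable_prodMk_left).dist measurable_const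
  refine Tendsto.div (tendsto_measureReal_and_le_right hf (ha (measurableSet_singleton (a x.2))) r)
    ?_ (ENNReal.toReal_pos h.ne' (measure_ne_top _ _)).ne'
  simpa using tendsto_measureReal_and_le_right (μ := κ x.1) hf MeasurableSet.univ r

end LetterRatio

/-! ### Dominated convergence of the information functions -/

section Information

variable {Λ Ω V E : Type*} [MeasurableSpace Λ] [MeasurableSpace Ω]
  [MetricSpace V] [MeasurableSpace V] [BorelSpace V] [SecondCountableTopology V]
  [Countable E] [MeasurableSpace E] [DiscreteMeasurableSpace E]
  {m : Measure Λ} [IsProbabilityMeasure m]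
  {κ : Kernel Λ Ω} [IsMarkovKernel κ] {a : Ω → E} {p : Λ × Ω → V}

/-- The supremum of the information `-log letterRatio` over all rational radii in `(0, 1)`. -/
noncomputable def maximalInfo (κ : Kernel Λ Ω) (a : Ω → E) (p : Λ × Ω → V) (x : Λ × Ω) : ℝ≥0∞ :=
  ⨆ (r : ℚ) (_ : (r : ℝ) ∈ Set.Ioo 0 1), ENNReal.ofReal (-Real.log (letterRatio κ a p x r))

lemma measurable_maximalInfo (ha : Measurable a) (hp : Measurable p) :
    Measurable (maximalInfo κ a p) :=
  Measurable.iSup fun r => Measurable.iSup fun _ =>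
    (measurable_letterRatio ha hp r).log.neg.ennreal_ofReal

lemma condEntropy_base_eq_lintegral (ha : Measurable a) :
    condEntropy (m ⊗ₘ κ) (fun e => {x | a x.2 = e})
      (MeasurableSpace.comap Prod.fst inferInstance) =
      ∫⁻ x, ENNReal.ofReal (-Real.log ((κ x.1).real {ω | a ω = a x.2})) ∂(m ⊗ₘ κ) := by
  refine condEntropy_eq_lintegral (fun x : Λ × Ω => a x.2)
    (g := fun e x => (κ x.1).real {ω | a ω = e}) fun e => ?_
  have hC : MeasurableSet {ω | a ω = e} := ha (measurableSet_singleton e)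
  have := condExp_indicator_compProd (m := m) (κ := κ) (p := fun _ => ()) measurable_const
    (C := {x | a x.2 = e}) (measurable_snd hC) (g := fun y => κ y.1 {ω | a ω = e})
    ((κ.measurable_coe hC).comp measurable_fst) fun l B _ => by
      rw [lintegral_const, Measure.restrict_apply MeasurableSet.univ, Set.univ_inter]
      by_cases h : () ∈ B <;> simp [h]
  rwa [MeasurableSpace.comap_const, sup_bot_eq] at this

omit [SecondCountableTopology V] in
/-- The tail estimate behind the integrability of the maximal information function. -/
lemma measure_maximalInfo_le {N : ℕ} (hN : ∀ (ρ ν : Measure V) (t : ℝ≥0∞) (A : Set V),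
      (∀ x ∈ A, ∃ r ∈ Set.Ioo (0 : ℝ) 1,
        ρ (Metric.closedBall x r) ≤ t * ν (Metric.closedBall x r)) → ρ A ≤ N * t * ν Set.univ)
    (ha : Measurable a) (hp : Measurable p) (l : Λ) (e : E) (n : ℕ) :
    κ l {ω | a ω = e ∧ ENNReal.ofReal (-Real.log ((κ l).real {ω | a ω = e}) + n) <
      maximalInfo κ a p (l, ω)} ≤ N * ENNReal.ofReal (Real.exp (-n)) * κ l {ω | a ω = e} := by
  rcases eq_or_ne (κ l {ω | a ω = e}) 0 with h0 | h0
  · exact (measure_mono (t := {ω | a ω = e}) fun ω hω => hω.1).trans (h0.le.trans zero_le)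
  have hq : 0 < (κ l).real {ω | a ω = e} := ENNReal.toReal_pos h0 (measure_ne_top _ _)
  have hq1 : (κ l).real {ω | a ω = e} ≤ 1 := measureReal_le_one
  set q := (κ l).real {ω | a ω = e} with hqdef
  have ht : ENNReal.ofReal (Real.exp (-n)) * κ l {ω | a ω = e} =
      ENNReal.ofReal (Real.exp (-(-Real.log q + n))) := by
    rw [neg_add, neg_neg, Real.exp_add, Real.exp_log hq, mul_comm q,
      ENNReal.ofReal_mul (Real.exp_pos _).le, hqdef, ofReal_measureReal]
  set A : Set V := {v | ∃ r ∈ Set.Ioo (0 : ℝ) 1,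
    fiberMap (letterKernel κ ha e) p hp l (Metric.closedBall v r) ≤
      ENNReal.ofReal (Real.exp (-(-Real.log q + n))) * fiberMap κ p hp l (Metric.closedBall v r)}
    with hA
  have hsub : {ω | a ω = e ∧ ENNReal.ofReal (-Real.log q + n) < maximalInfo κ a p (l, ω)} ⊆
      (fun ω => p (l, ω)) ⁻¹' A ∩ {ω | a ω = e} := by
    rintro ω ⟨rfl, hω⟩
    refine ⟨?_, rfl⟩
    simp only [maximalInfo, lt_iSup_iff] at hω
    obtain ⟨r, hr, hlt⟩ := hω
    have hc : 0 ≤ -Real.log q + n := add_nonneg (neg_nonneg.2 (Real.log_nonpos hq.le hq1))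
      n.cast_nonneg
    have hlt' := (ENNReal.ofReal_lt_ofReal_iff_of_nonneg hc).1 hlt
    have hpos : 0 < letterRatio κ a p (l, ω) r := by
      refine (letterRatio_nonneg κ a p _ _).lt_of_ne fun h => ?_
      rw [← h, Real.log_zero] at hlt'
      linarith
    have hle : letterRatio κ a p (l, ω) r ≤ Real.exp (-(-Real.log q + n)) := by
      rw [← Real.exp_log hpos]
      exact Real.exp_le_exp.2 (by linarith)
    refine ⟨r, hr, ?_⟩
    rw [fiberMap_letterKernel_apply ha hp _ l Metric.isClosed_closedBall.measurableSet,
      fiberMap_apply' κ hp l Metric.isClosed_closedBall.measurableSet]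
    have hden : 0 < (κ l).real {ω' | dist (p (l, ω')) (p (l, ω)) ≤ r} := by
      refine measureReal_nonneg.lt_of_ne fun h => ?_
      rw [letterRatio, ← h, div_zero] at hpos
      exact hpos.false
    have h1 := (div_le_iff₀ hden).1 hle
    have h2 := ENNReal.ofReal_le_ofReal h1
    rw [ENNReal.ofReal_mul (Real.exp_pos _).le, ofReal_measureReal, ofReal_measureReal] at h2
    exact h2
  calc κ l {ω | a ω = e ∧ ENNReal.ofReal (-Real.log q + n) < maximalInfo κ a p (l, ω)}
      ≤ letterKernel κ ha e l ((fun ω => p (l, ω)) ⁻¹' A) :=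
        (measure_mono hsub).trans (Measure.le_restrict_apply _ _)
    _ ≤ fiberMap (letterKernel κ ha e) p hp l A :=
        Measure.le_map_apply (hp.comp measurable_prodMk_left).aemeasurable _
    _ ≤ N * ENNReal.ofReal (Real.exp (-(-Real.log q + n))) * fiberMap κ p hp l Set.univ :=
        hN _ _ _ _ fun x hx => hx
    _ = _ := by
        rw [fiberMap_apply' κ hp l MeasurableSet.univ, ← ht]
        simp [mul_assoc]

/-- Chung's lemma in this setting: the maximal information function is integrable as soon as the
conditional entropy given the base is finite. -/
theorem lintegral_maximalInfo_lt_top [HasBesicovitchCovering V] (ha : Measurable a)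
    (hp : Measurable p) (hent : condEntropy (m ⊗ₘ κ) (fun e => {x | a x.2 = e})
      (MeasurableSpace.comap Prod.fst inferInstance) < ∞) :
    ∫⁻ x, maximalInfo κ a p x ∂(m ⊗ₘ κ) < ∞ := by
  obtain ⟨N, hN⟩ := exists_measure_le_of_closedBall_ratio_le V
  rw [condEntropy_base_eq_lintegral ha] at hent
  set c : Λ × Ω → ℝ := fun x => -Real.log ((κ x.1).real {ω | a ω = a x.2}) with hc
  have hcm : Measurable c := (Kernel.measurable_kernel_prodMk_left
    (κ := κ.comap Prod.fst measurable_fst) (measurableSet_letter_eq ha)).ennreal_toReal.log.neg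
  have hc0 : ∀ x, 0 ≤ c x := fun x => neg_nonneg.2 (Real.log_nonpos measureReal_nonneg
    measureReal_le_one)
  have hFm : Measurable (maximalInfo κ a p) := measurable_maximalInfo ha hp
  have hSm : ∀ n : ℕ, MeasurableSet {x | ENNReal.ofReal (c x + n) < maximalInfo κ a p x} := fun n =>
    measurableSet_lt (hcm.add_const _).ennreal_ofReal hFm
  have hS : ∀ n : ℕ, (m ⊗ₘ κ) {x | ENNReal.ofReal (c x + n) < maximalInfo κ a p x} ≤
      N * ENNReal.ofReal (Real.exp (-n)) := fun n => by
    rw [Measure.compProd_apply (hSm n)]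
    have hle : ∀ l, κ l (Prod.mk l ⁻¹' {x | ENNReal.ofReal (c x + n) < maximalInfo κ a p x}) ≤
        N * ENNReal.ofReal (Real.exp (-n)) := fun l => by
      have hcov : Prod.mk l ⁻¹' {x | ENNReal.ofReal (c x + n) < maximalInfo κ a p x} ⊆
          ⋃ e, {ω | a ω = e ∧ ENNReal.ofReal (-Real.log ((κ l).real {ω | a ω = e}) + n) <
            maximalInfo κ a p (l, ω)} := fun ω hω => Set.mem_iUnion.2 ⟨a ω, rfl, hω⟩
      calc _ ≤ ∑' e, N * ENNReal.ofReal (Real.exp (-n)) * κ l {ω | a ω = e} :=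
            (measure_mono hcov).trans ((measure_iUnion_le _).trans
              (ENNReal.tsum_le_tsum fun e => measure_maximalInfo_le hN ha hp l e n))
        _ = N * ENNReal.ofReal (Real.exp (-n)) * κ l (⋃ e, {ω | a ω = e}) := by
            rw [ENNReal.tsum_mul_left, measure_iUnion]
            · exact fun e e' hee' => Set.disjoint_left.2 fun ω h h' => hee' (h.symm.trans h')
            · exact fun e => ha (measurableSet_singleton e)
        _ ≤ N * ENNReal.ofReal (Real.exp (-n)) * 1 := by
            gcongr
            exact prob_le_one
        _ = _ := mul_one _
    calc _ ≤ ∫⁻ _l, N * ENNReal.ofReal (Real.exp (-n)) ∂m := lintegral_mono hle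
      _ = _ := by simp
  have hsum : ∑' n : ℕ, ENNReal.ofReal (Real.exp (-n)) < ∞ := by
    rw [← ENNReal.ofReal_tsum_of_nonneg (fun n => (Real.exp_pos _).le) Real.summable_exp_neg_nat]
    exact ENNReal.ofReal_lt_top
  calc ∫⁻ x, maximalInfo κ a p x ∂(m ⊗ₘ κ)
      ≤ ∫⁻ x, (ENNReal.ofReal (c x) + ∑' n : ℕ,
          {x | ENNReal.ofReal (c x + n) < maximalInfo κ a p x}.indicator 1 x) ∂(m ⊗ₘ κ) :=
        lintegral_mono fun x => ENNReal.le_ofReal_add_tsum_indicator _ (hc0 x)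
    _ = ∫⁻ x, ENNReal.ofReal (c x) ∂(m ⊗ₘ κ) + ∑' n : ℕ,
          (m ⊗ₘ κ) {x | ENNReal.ofReal (c x + n) < maximalInfo κ a p x} := by
        rw [lintegral_add_left hcm.ennreal_ofReal,
          lintegral_tsum fun n => (measurable_one.indicator (hSm n)).aemeasurable]
        congr 2
        ext n
        rw [lintegral_indicator_one (hSm n)]
    _ ≤ ∫⁻ x, ENNReal.ofReal (c x) ∂(m ⊗ₘ κ) + ∑' n : ℕ, N * ENNReal.ofReal (Real.exp (-n)) := by
        gcongr with n
        exact hS n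
    _ < ∞ := by
        rw [ENNReal.tsum_mul_left]
        exact ENNReal.add_lt_top.2 ⟨hent, ENNReal.mul_lt_top (ENNReal.natCast_lt_top N) hsum⟩

omit [IsProbabilityMeasure m] in
/-- Almost every point has, in every ball around it, a positive mass of points with its letter. -/
lemma ae_compProd_letter_pos (ha : Measurable a) (hp : Measurable p) :
    ∀ᵐ x ∂(m ⊗ₘ κ), ∀ r > 0, 0 < κ x.1 {ω | a ω = a x.2 ∧ dist (p (x.1, ω)) (p x) ≤ r} := by
  have hm : ∀ r : ℝ, Measurable fun x : Λ × Ω =>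
      κ x.1 {ω | a ω = a x.2 ∧ dist (p (x.1, ω)) (p x) ≤ r} := fun r => by
    exact Kernel.measurable_kernel_prodMk_left (κ := κ.comap Prod.fst measurable_fst)
      ((measurableSet_letter_eq ha).inter (measurableSet_dist_le hp r))
  have h : ∀ᵐ x ∂(m ⊗ₘ κ), ∀ k : ℕ,
      0 < κ x.1 {ω | a ω = a x.2 ∧ dist (p (x.1, ω)) (p x) ≤ 1 / (k + 1)} := by
    refine ae_all_iff.2 fun k => Measure.ae_compProd_of_ae_ae
      (measurableSet_lt measurable_const (hm _)) (Eventually.of_forall fun l => ?_)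
    filter_upwards [ae_measure_letter_pos ha hp l] with ω hω using hω _ Nat.one_div_pos_of_nat
  filter_upwards [h] with x hx r hr
  obtain ⟨k, hk⟩ := exists_nat_one_div_lt hr
  exact (hx k).trans_le (measure_mono fun ω hω => ⟨hω.1, hω.2.trans hk.le⟩)

lemma frequently_rat_nhdsGT {r d : ℝ} (h : r < d) :
    ∃ᶠ s in 𝓝[>] r, s ∈ Set.Ioo r d ∧ ∃ q : ℚ, (q : ℝ) = s := by
  refine frequently_iff.2 fun {U} hU => ?_
  obtain ⟨ρ, hρ, hρ'⟩ := mem_nhdsGT_iff_exists_Ioo_subset.1 hU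
  obtain ⟨q, hq, hq'⟩ := exists_rat_btwn (lt_min hρ h)
  exact ⟨q, hρ' ⟨hq, hq'.trans_le (min_le_left _ _)⟩, ⟨hq, hq'.trans_le (min_le_right _ _)⟩, q, rfl⟩

/-- The information functions `-log letterRatio` at radii tending to zero converge to an integrable
function `I`, whose integral is the conditional entropy given the base and `p`; the errors at radii
in `(0, δ N)` are bounded by integrable functions whose integrals tend to zero. -/
theorem exists_info_limit [HasBesicovitchCovering V] (ha : Measurable a) (hp : Measurable p)
    (hent : condEntropy (m ⊗ₘ κ) (fun e => {x | a x.2 = e})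
      (MeasurableSpace.comap Prod.fst inferInstance) < ∞)
    {δ : ℕ → ℝ} (hδ1 : ∀ n, δ n ≤ 1) (hδ : Tendsto δ atTop (𝓝 0)) :
    condEntropy (m ⊗ₘ κ) (fun e => {x | a x.2 = e}) (MeasurableSpace.comap Prod.fst inferInstance ⊔
      MeasurableSpace.comap p inferInstance) < ∞ ∧
    ∃ I : Λ × Ω → ℝ, Measurable I ∧ Integrable I (m ⊗ₘ κ) ∧
      ∫ x, I x ∂(m ⊗ₘ κ) = (condEntropy (m ⊗ₘ κ) (fun e => {x | a x.2 = e})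
        (MeasurableSpace.comap Prod.fst inferInstance ⊔
          MeasurableSpace.comap p inferInstance)).toReal ∧
      ∃ G : ℕ → Λ × Ω → ℝ≥0∞, (∀ n, Measurable (G n)) ∧ (∀ n, ∫⁻ x, G n x ∂(m ⊗ₘ κ) < ∞) ∧
        Tendsto (fun n => ∫⁻ x, G n x ∂(m ⊗ₘ κ)) atTop (𝓝 0) ∧
        ∀ᵐ x ∂(m ⊗ₘ κ), ∀ n, ∀ r ∈ Set.Ioo 0 (δ n),
          ENNReal.ofReal |-Real.log (letterRatio κ a p x r) - I x| ≤ G n x := by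
  set I : Λ × Ω → ℝ := fun x => -Real.log (letterProb κ ha hp (a x.2) (x.1, p x)).toReal with hI
  have hIm : Measurable I := by
    have : Measurable fun y : E × (Λ × V) => letterProb κ ha hp y.1 y.2 :=
      measurable_from_prod_countable_right fun e => measurable_letterProb ha hp e
    exact (this.comp ((ha.comp measurable_snd).prodMk
      (measurable_fst.prodMk hp))).ennreal_toReal.log.neg
  have hentI : condEntropy (m ⊗ₘ κ) (fun e => {x | a x.2 = e})
      (MeasurableSpace.comap Prod.fst inferInstance ⊔ MeasurableSpace.comap p inferInstance) =
      ∫⁻ x, ENNReal.ofReal (I x) ∂(m ⊗ₘ κ) :=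
    condEntropy_eq_lintegral (fun x : Λ × Ω => a x.2) fun e => condExp_letter ha hp e
  set u : Λ × Ω → ℝ → ℝ := fun x r => -Real.log (letterRatio κ a p x r) with hu
  have hum : ∀ r, Measurable fun x => u x r := fun r => (measurable_letterRatio ha hp r).log.neg
  have hu0 : ∀ x r, 0 ≤ u x r := fun x r =>
    neg_nonneg.2 (Real.log_nonpos (letterRatio_nonneg _ _ _ _ _) (letterRatio_le_one _ _ _ _ _))
  set G : ℕ → Λ × Ω → ℝ≥0∞ := fun n x =>
    ⨆ (r : ℚ) (_ : (r : ℝ) ∈ Set.Ioo 0 (δ n)), ENNReal.ofReal |u x r - I x| with hG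
  have hGm : ∀ n, Measurable (G n) := fun n => Measurable.iSup fun r => Measurable.iSup fun _ =>
    ((hum r).sub hIm).abs.ennreal_ofReal
  have hF := lintegral_maximalInfo_lt_top (m := m) ha hp hent
  have hFm : Measurable (maximalInfo κ a p) := measurable_maximalInfo ha hp
  have hlim : ∀ᵐ x ∂(m ⊗ₘ κ), 0 ≤ I x ∧ ENNReal.ofReal (I x) ≤ maximalInfo κ a p x ∧
      Tendsto (fun n => G n x) atTop (𝓝 0) := by
    refine Measure.ae_compProd_of_ae_ae ((measurableSet_le measurable_const hIm).inter
      ((measurableSet_le hIm.ennreal_ofReal hFm).inter (measurableSet_tendsto _ hGm)))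
      (Eventually.of_forall fun l => ?_)
    filter_upwards [ae_tendsto_letterRatio ha hp l] with ω ⟨hpos, hω⟩
    have hu : Tendsto (u (l, ω)) (𝓝[>] 0) (𝓝 (I (l, ω))) :=
      ((Real.continuousAt_log hpos.ne').tendsto.comp hω).neg
    refine ⟨ge_of_tendsto' hu fun r => hu0 _ _, ?_, ?_⟩
    · refine (isClosed_Iic.preimage ENNReal.continuous_ofReal).mem_of_frequently_of_tendsto
        ((frequently_rat_nhdsGT zero_lt_one).mono ?_) hu
      rintro _ ⟨hr, q, rfl⟩
      exact le_iSup₂_of_le (f := fun (r : ℚ) (_ : (r : ℝ) ∈ Set.Ioo 0 1) =>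
        ENNReal.ofReal (-Real.log (letterRatio κ a p (l, ω) r))) q hr le_rfl
    · refine ENNReal.tendsto_nhds_zero.2 fun ε hε => ?_
      have h1 : Tendsto (fun r => ENNReal.ofReal |u (l, ω) r - I (l, ω)|) (𝓝[>] 0) (𝓝 0) := by
        have := (ENNReal.continuous_ofReal.tendsto _).comp (hu.sub_const (I (l, ω))).abs
        simpa [Function.comp_def] using this
      obtain ⟨ρ, hρ, hρ'⟩ :=
        mem_nhdsGT_iff_exists_Ioo_subset.1 (ENNReal.tendsto_nhds_zero.1 h1 ε hε)
      filter_upwards [hδ.eventually (gt_mem_nhds (Set.mem_Ioi.1 hρ))] with n hn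
      exact iSup₂_le fun r hr => hρ' ⟨hr.1, hr.2.trans hn⟩
  have hIfin : ∫⁻ x, ENNReal.ofReal (I x) ∂(m ⊗ₘ κ) < ∞ :=
    (lintegral_mono_ae (hlim.mono fun x hx => hx.2.1)).trans_lt hF
  have hbound : ∀ n, ∀ᵐ x ∂(m ⊗ₘ κ), G n x ≤ maximalInfo κ a p x + ENNReal.ofReal (I x) := by
    intro n
    filter_upwards [hlim] with x hx
    refine iSup₂_le fun r hr => ?_
    have h1 : ENNReal.ofReal (u x r) ≤ maximalInfo κ a p x :=
      le_iSup₂_of_le (f := fun (r : ℚ) (_ : (r : ℝ) ∈ Set.Ioo 0 1) =>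
        ENNReal.ofReal (-Real.log (letterRatio κ a p x r))) r ⟨hr.1, hr.2.trans_le (hδ1 n)⟩ le_rfl
    refine le_trans ?_ (add_le_add_left h1 _)
    rw [← ENNReal.ofReal_add (hu0 _ _) hx.1]
    refine ENNReal.ofReal_le_ofReal (abs_le.2 ⟨?_, ?_⟩) <;> linarith [hu0 x r, hx.1]
  have hboundfin : ∫⁻ x, (maximalInfo κ a p x + ENNReal.ofReal (I x)) ∂(m ⊗ₘ κ) < ∞ := by
    rw [lintegral_add_left hFm]
    exact ENNReal.add_lt_top.2 ⟨hF, hIfin⟩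
  have hI0 : 0 ≤ᵐ[m ⊗ₘ κ] I := hlim.mono fun x hx => hx.1
  refine ⟨hentI.trans_lt hIfin, I, hIm, ⟨hIm.aestronglyMeasurable, ?_⟩, ?_, G, hGm, fun n =>
    (lintegral_mono_ae (hbound n)).trans_lt hboundfin, ?_, ?_⟩
  · rwa [hasFiniteIntegral_iff_ofReal hI0]
  · rw [hentI, integral_eq_lintegral_of_nonneg_ae hI0 hIm.aestronglyMeasurable]
  · have := tendsto_lintegral_of_dominated_convergence _ hGm hbound hboundfin.ne
      (hlim.mono fun x hx => hx.2.2)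
    simpa using this
  · filter_upwards [ae_compProd_letter_pos (m := m) ha hp] with x hx n r hr
    have hpos : 0 < letterRatio κ a p x r :=
      div_pos (ENNReal.toReal_pos (hx r hr.1).ne' (measure_ne_top _ _))
        (ENNReal.toReal_pos ((hx r hr.1).trans_le (measure_mono fun _ h => h.2)).ne'
          (measure_ne_top _ _))
    have h1 : Tendsto (u x) (𝓝[>] r) (𝓝 (u x r)) :=
      ((Real.continuousAt_log hpos.ne').tendsto.comp (tendsto_letterRatio_right ha hp
        ((hx r hr.1).trans_le (measure_mono fun _ h => h.2)))).neg
    have h2 := (ENNReal.continuous_ofReal.tendsto _).comp (h1.sub_const (I x)).abs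
    refine isClosed_Iic.mem_of_frequently_of_tendsto
      ((frequently_rat_nhdsGT hr.2).mono ?_) h2
    rintro _ ⟨hs, q, rfl⟩
    exact le_iSup₂_of_le (f := fun (r : ℚ) (_ : (r : ℝ) ∈ Set.Ioo 0 (δ n)) =>
      ENNReal.ofReal |u x r - I x|) q ⟨hr.1.trans hs.1, hs.2⟩ le_rfl

end Information

/-! ### Polar coordinates -/

section Polar

variable {V : Type*} [NormedAddCommGroup V] [InnerProductSpace ℝ V] [FiniteDimensional ℝ V]
  [MeasurableSpace V] [BorelSpace V]

/-- Integration in polar coordinates around a point. -/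
theorem lintegral_polar [Nontrivial V] (w₀ : V) {h : V → ℝ≥0∞} (hh : Measurable h) :
    ∫⁻ w, h w = ∫⁻ θ : Metric.sphere (0 : V) 1, (∫⁻ s in Set.Ioi (0 : ℝ),
      ENNReal.ofReal (s ^ (Module.finrank ℝ V - 1)) * h (w₀ + s • (θ : V)))
        ∂(volume : Measure V).toSphere := by
  have hm : Measurable fun y : Metric.sphere (0 : V) 1 × Set.Ioi (0 : ℝ) =>
      h (w₀ + (y.2 : ℝ) • (y.1 : V)) :=
    hh.comp (measurable_const.add
      ((measurable_subtype_coe.comp measurable_snd).smul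
        (measurable_subtype_coe.comp measurable_fst)))
  calc ∫⁻ w, h w = ∫⁻ w, h (w₀ + w) := (lintegral_add_left_eq_self h w₀).symm
    _ = ∫⁻ w in {0}ᶜ, h (w₀ + w) := by
        rw [setLIntegral_congr (t := Set.univ), setLIntegral_univ]
        exact eventuallyEq_univ.2 (compl_mem_ae_iff.2 (measure_singleton _))
    _ = ∫⁻ w : ({0}ᶜ : Set V), h (w₀ + w) ∂(volume.comap Subtype.val) :=
        (lintegral_subtype_comap (measurableSet_singleton _).compl fun w => h (w₀ + w)).symm
    _ = ∫⁻ y, h (w₀ + (y.2 : ℝ) • (y.1 : V)) ∂((volume : Measure V).toSphere.prod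
          (Measure.volumeIoiPow (Module.finrank ℝ V - 1))) := by
        rw [← (volume : Measure V).measurePreserving_homeomorphUnitSphereProd.lintegral_comp hm]
        refine lintegral_congr fun w => ?_
        have : ‖(w : V)‖ ≠ 0 := norm_ne_zero_iff.2 w.2
        simp [smul_smul, this]
    _ = ∫⁻ θ : Metric.sphere (0 : V) 1, (∫⁻ s : Set.Ioi (0 : ℝ), h (w₀ + (s : ℝ) • (θ : V))
          ∂(Measure.volumeIoiPow (Module.finrank ℝ V - 1))) ∂(volume : Measure V).toSphere :=
        lintegral_prod _ hm.aemeasurable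
    _ = _ := by
        refine lintegral_congr fun θ => ?_
        have hθ : Measurable fun s : Set.Ioi (0 : ℝ) => h (w₀ + (s : ℝ) • (θ : V)) :=
          hm.comp measurable_prodMk_left
        rw [Measure.volumeIoiPow, lintegral_withDensity_eq_lintegral_mul _ (by fun_prop) hθ]
        exact lintegral_subtype_comap measurableSet_Ioi fun s : ℝ =>
          ENNReal.ofReal (s ^ (Module.finrank ℝ V - 1)) * h (w₀ + s • (θ : V))

lemma lintegral_Ioo_inv {a b : ℝ} (ha : 0 < a) (hab : a ≤ b) :
    ∫⁻ s in Set.Ioo a b, ENNReal.ofReal s⁻¹ = ENNReal.ofReal (Real.log (b / a)) := by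
  have h : IntervalIntegrable (fun s : ℝ => s⁻¹) volume a b :=
    intervalIntegral.intervalIntegrable_inv (fun s hs => by
      rw [Set.uIcc_of_le hab] at hs
      exact (ha.trans_le hs.1).ne') continuousOn_id
  rw [← integral_inv_of_pos ha (ha.trans_le hab), intervalIntegral.integral_of_le hab,
    ofReal_integral_eq_lintegral_ofReal h.1, Measure.restrict_congr_set Ioo_ae_eq_Ioc]
  filter_upwards [ae_restrict_mem measurableSet_Ioc] with s hs
  exact inv_nonneg.2 (ha.trans hs.1).le

/-- The function `‖w - w₀‖ ^ (-dim V)` has logarithmic integrals over annuli. -/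
lemma lintegral_annulus [Nontrivial V] (w₀ : V) {a b : ℝ} (ha : 0 < a) (hab : a ≤ b) :
    ∫⁻ w in {w | a < ‖w - w₀‖ ∧ ‖w - w₀‖ < b},
      ENNReal.ofReal (‖w - w₀‖⁻¹ ^ Module.finrank ℝ V) =
      (volume : Measure V).toSphere Set.univ * ENNReal.ofReal (Real.log (b / a)) := by
  have hq : 0 < Module.finrank ℝ V := Module.finrank_pos
  have hA : MeasurableSet {w : V | a < ‖w - w₀‖ ∧ ‖w - w₀‖ < b} :=
    (measurableSet_lt measurable_const (measurable_id.sub_const w₀).norm).inter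
      (measurableSet_lt (measurable_id.sub_const w₀).norm measurable_const)
  rw [← lintegral_indicator hA, lintegral_polar w₀]
  · rw [mul_comm, ← lintegral_const]
    refine lintegral_congr fun θ => ?_
    rw [← lintegral_Ioo_inv ha hab, ← lintegral_indicator measurableSet_Ioi,
      ← lintegral_indicator measurableSet_Ioo]
    refine lintegral_congr fun s => ?_
    by_cases hs : s ∈ Set.Ioo a b
    · have hs0 : 0 < s := ha.trans hs.1
      have hn : ‖w₀ + s • (θ : V) - w₀‖ = s := by
        simp [norm_smul, abs_of_pos hs0]
      rw [Set.indicator_of_mem (Set.mem_Ioi.2 hs0), Set.indicator_of_mem, Set.indicator_of_mem hs,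
        hn, ← ENNReal.ofReal_mul (by positivity)]
      · congr 1
        obtain ⟨n, hn⟩ := Nat.exists_eq_succ_of_ne_zero hq.ne'
        rw [hn, Nat.succ_sub_one, pow_succ, inv_pow]
        field_simp
      · rw [Set.mem_ofPred_eq, hn]; exact hs
    · rw [Set.indicator_of_notMem hs]
      by_cases hs0 : s ∈ Set.Ioi (0 : ℝ)
      · have hn : ‖w₀ + s • (θ : V) - w₀‖ = s := by
          simp [norm_smul, abs_of_pos (Set.mem_Ioi.1 hs0)]
        rw [Set.indicator_of_mem hs0, Set.indicator_of_notMem, mul_zero]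
        rw [Set.mem_ofPred_eq, hn]; exact hs
      · rw [Set.indicator_of_notMem hs0]
  · exact ((measurable_id.sub_const w₀).norm.inv.pow_const _).ennreal_ofReal.indicator hA

end Polar

/-! ### Conformal linear maps -/

section ConformalLinear

variable {V : Type*} [NormedAddCommGroup V] [InnerProductSpace ℝ V]

lemma IsConformalMap.norm_apply [Nontrivial V] {A : V →L[ℝ] V} (hA : IsConformalMap A) (v : V) :
    ‖A v‖ = ‖A‖ * ‖v‖ := by
  obtain ⟨c, hc, li, rfl⟩ := hA
  simp [norm_smul]

lemma IsConformalMap.norm_pos [Nontrivial V] {A : V →L[ℝ] V} (hA : IsConformalMap A) : 0 < ‖A‖ :=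
  norm_pos_iff.2 hA.ne_zero

lemma IsConformalMap.abs_det [Nontrivial V] [FiniteDimensional ℝ V] {A : V →L[ℝ] V}
    (hA : IsConformalMap A) : |A.det| = ‖A‖ ^ Module.finrank ℝ V := by
  obtain ⟨c, hc, li, rfl⟩ := hA
  have h1 := LinearMap.normDet_eq_abs_det (c • li.toLinearMap)
  rw [LinearMap.normDet_smul, li.normDet_eq_one, mul_one] at h1
  rw [ContinuousLinearMap.det]
  simp only [norm_smul, LinearIsometry.norm_toContinuousLinearMap, mul_one]
  rw [h1]
  rfl

/-- A conformal linear endomorphism of a finite-dimensional space, as an equivalence. -/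
lemma IsConformalMap.exists_equiv [FiniteDimensional ℝ V] {A : V →L[ℝ] V}
    (hA : IsConformalMap A) : ∃ e : V ≃L[ℝ] V, (e : V →L[ℝ] V) = A :=
  ⟨(LinearEquiv.ofInjectiveEndo (A : V →ₗ[ℝ] V) hA.injective).toContinuousLinearEquiv, by
    ext v; rfl⟩

end ConformalLinear

/-! ### A length-area estimate for injective conformal maps -/

/-- `f` is an injective conformal map of class `C¹` on the open ball of center `x` and radius `R`.
-/
structure IsConformalOnBall {V : Type*} [NormedAddCommGroup V] [InnerProductSpace ℝ V] (f : V → V)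
    (x : V) (R : ℝ) : Prop where
  contDiffOn : ContDiffOn ℝ 1 f (Metric.ball x R)
  conformalAt : ∀ z ∈ Metric.ball x R, ConformalAt f z
  injOn : Set.InjOn f (Metric.ball x R)

namespace IsConformalOnBall

variable {V : Type*} [NormedAddCommGroup V] [InnerProductSpace ℝ V] {f : V → V} {x : V} {R : ℝ}

lemma mono (h : IsConformalOnBall f x R) {r : ℝ} (hr : r ≤ R) : IsConformalOnBall f x r :=
  ⟨h.contDiffOn.mono (Metric.ball_subset_ball hr),
    fun z hz => h.conformalAt z (Metric.ball_subset_ball hr hz),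
    h.injOn.mono (Metric.ball_subset_ball hr)⟩

lemma isConformalMap (h : IsConformalOnBall f x R) {z : V} (hz : z ∈ Metric.ball x R) :
    IsConformalMap (fderiv ℝ f z) :=
  conformalAt_iff_isConformalMap_fderiv.1 (h.conformalAt z hz)

lemma hasStrictFDerivAt (h : IsConformalOnBall f x R) {z : V} (hz : z ∈ Metric.ball x R) :
    HasStrictFDerivAt f (fderiv ℝ f z) z :=
  (h.contDiffOn.contDiffAt (Metric.isOpen_ball.mem_nhds hz)).hasStrictFDerivAt one_ne_zero

/-- The density `1 / (|f'| |ψ - x|)` on the image of a ball, where `ψ` is the inverse of `f`: the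
norm of the derivative of `log |ψ - x|`. -/
noncomputable def logDensity (f : V → V) (x : V) (R : ℝ) (w : V) : ℝ :=
  (‖fderiv ℝ f (Function.invFunOn f (Metric.ball x R) w)‖ *
    ‖Function.invFunOn f (Metric.ball x R) w - x‖)⁻¹

lemma invFunOn_apply (h : IsConformalOnBall f x R) {z : V} (hz : z ∈ Metric.ball x R) :
    Function.invFunOn f (Metric.ball x R) (f z) = z := h.injOn.leftInvOn_invFunOn hz

lemma logDensity_apply (h : IsConformalOnBall f x R) {z : V} (hz : z ∈ Metric.ball x R) :
    logDensity f x R (f z) = (‖fderiv ℝ f z‖ * ‖z - x‖)⁻¹ := by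
  rw [logDensity, h.invFunOn_apply hz]

variable [FiniteDimensional ℝ V]

lemma isOpen_image (h : IsConformalOnBall f x R) {U : Set V} (hU : IsOpen U)
    (hUR : U ⊆ Metric.ball x R) : IsOpen (f '' U) := by
  refine isOpen_iff_mem_nhds.2 ?_
  rintro _ ⟨z, hz, rfl⟩
  obtain ⟨e, he⟩ := (h.isConformalMap (hUR hz)).exists_equiv
  have h1 := h.hasStrictFDerivAt (hUR hz)
  rw [← he] at h1
  rw [← h1.map_nhds_eq_of_equiv]
  exact image_mem_map (hU.mem_nhds hz)

/-- A connected set that meets both `f (ball x t)` and its complement meets `f (sphere x t)`. -/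
lemma exists_mem_image_sphere (h : IsConformalOnBall f x R) {t : ℝ} (ht : t < R) {C : Set V}
    (hC : IsPreconnected C) (h1 : (C ∩ f '' Metric.ball x t).Nonempty)
    (h2 : (C \ f '' Metric.ball x t).Nonempty) : ∃ z ∈ Metric.sphere x t, f z ∈ C := by
  by_contra! hcon
  have hcomp : IsCompact (f '' Metric.closedBall x t) :=
    (isCompact_closedBall x t).image_of_continuousOn
      (h.contDiffOn.continuousOn.mono (Metric.closedBall_subset_ball ht))
  obtain ⟨w, hwC, hw⟩ := h2
  have hsub : C ∩ f '' Metric.closedBall x t ⊆ f '' Metric.ball x t := by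
    rintro _ ⟨hzC, z, hz, rfl⟩
    refine ⟨z, lt_of_le_of_ne hz fun heq => hcon z heq hzC, rfl⟩
  obtain ⟨y, -, hy1, hy2⟩ := hC (f '' Metric.ball x t) (f '' Metric.closedBall x t)ᶜ
    (h.isOpen_image Metric.isOpen_ball (Metric.ball_subset_ball ht.le)) hcomp.isClosed.isOpen_compl
    (fun y hy => (em (y ∈ f '' Metric.closedBall x t)).imp (fun h => hsub ⟨hy, h⟩) id)
    h1 ⟨w, hwC, fun h => hw (hsub ⟨hwC, h⟩)⟩
  exact hy2 (Set.image_mono Metric.ball_subset_closedBall hy1)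

lemma hasFDerivAt_invFunOn (h : IsConformalOnBall f x R) {z : V} (hz : z ∈ Metric.ball x R) :
    ∃ e : V ≃L[ℝ] V, (e : V →L[ℝ] V) = fderiv ℝ f z ∧
      HasFDerivAt (Function.invFunOn f (Metric.ball x R)) (e.symm : V →L[ℝ] V) (f z) := by
  obtain ⟨e, he⟩ := (h.isConformalMap hz).exists_equiv
  have h1 := h.hasStrictFDerivAt hz
  rw [← he] at h1
  exact ⟨e, he, (h1.to_local_left_inverse (Filter.eventually_of_mem
    (Metric.isOpen_ball.mem_nhds hz) fun y hy => h.invFunOn_apply hy)).hasFDerivAt⟩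

variable [Nontrivial V]

/-- Along a ray issued from `f x`, the function `log |ψ - x|` takes all values in
`(log ρ, log r)`. -/
lemma log_le_lintegral_ray (h : IsConformalOnBall f x R) {ρ r : ℝ} (hρ : 0 < ρ) (hρr : ρ ≤ r)
    (hr : r < R) (θ : V) (hθ : ‖θ‖ = 1) :
    ENNReal.ofReal (Real.log (r / ρ)) ≤ ∫⁻ s in Set.Ioi (0 : ℝ),
      (f '' {z | ρ < ‖z - x‖ ∧ ‖z - x‖ < r}).indicator
        (fun w => ENNReal.ofReal (logDensity f x R w)) (f x + s • θ) := by
  set A : Set V := {z | ρ < ‖z - x‖ ∧ ‖z - x‖ < r} with hA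
  have hAR : A ⊆ Metric.ball x R := fun z hz => mem_ball_iff_norm.2 (hz.2.trans hr)
  have hcn : Continuous fun z : V => ‖z - x‖ := by fun_prop
  have hAo : IsOpen A := by
    have : IsOpen ({z : V | ρ < ‖z - x‖} ∩ {z | ‖z - x‖ < r}) :=
      (isOpen_lt continuous_const hcn).inter (isOpen_lt hcn continuous_const)
    exact this
  have hfA : IsOpen (f '' A) := h.isOpen_image hAo hAR
  have hγ : Continuous fun s : ℝ => f x + s • θ := by fun_prop
  set S : Set ℝ := {s | 0 < s ∧ f x + s • θ ∈ f '' A} with hS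
  have hSo : IsOpen S := isOpen_Ioi.inter (hfA.preimage hγ)
  set ψ := Function.invFunOn f (Metric.ball x R) with hψ
  set u : ℝ → ℝ := fun s => 1 / 2 * Real.log (‖ψ (f x + s • θ) - x‖ ^ 2) with hu
  have hderiv : ∀ s ∈ S, ∃ d : ℝ, HasDerivAt u d s ∧ |d| ≤ logDensity f x R (f x + s • θ) := by
    rintro s ⟨hs, z, hz, hzs⟩
    obtain ⟨e, he, hed⟩ := h.hasFDerivAt_invFunOn (hAR hz)
    have hz0 : 0 < ‖z - x‖ := hρ.trans hz.1
    have h1 : HasDerivAt (fun s : ℝ => f x + s • θ) θ s := by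
      simpa using ((hasDerivAt_id s).smul_const θ).const_add (f x)
    have h2 : HasDerivAt (fun s : ℝ => ψ (f x + s • θ) - x) (e.symm θ) s := by
      rw [hzs] at hed
      exact (hed.comp_hasDerivAt s h1).sub_const x
    have hψz : ψ (f x + s • θ) = z := by rw [← hzs]; exact h.invFunOn_apply (hAR hz)
    have h3 := (h2.norm_sq.log (by rw [hψz]; positivity)).const_mul (1 / 2 : ℝ)
    refine ⟨_, h3, ?_⟩
    have hc := h.isConformalMap (hAR hz)
    have hnorm : ‖e.symm θ‖ = ‖fderiv ℝ f z‖⁻¹ := by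
      have := hc.norm_apply (e.symm θ)
      rw [← he, ContinuousLinearEquiv.coe_coe, ContinuousLinearEquiv.apply_symm_apply, hθ,
          he] at this
      exact (inv_eq_of_mul_eq_one_right this.symm).symm
    rw [← hzs, h.logDensity_apply (hAR hz), hzs, hψz, mul_inv, ← hnorm]
    have h5 : (1 / 2 : ℝ) * (2 * inner ℝ (z - x) (e.symm θ) / ‖z - x‖ ^ 2) =
        inner ℝ (z - x) (e.symm θ) / ‖z - x‖ ^ 2 := by ring
    rw [h5, abs_div, abs_of_pos (by positivity : (0 : ℝ) < ‖z - x‖ ^ 2),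
      div_le_iff₀ (by positivity)]
    calc |inner ℝ (z - x) (e.symm θ)| ≤ ‖z - x‖ * ‖e.symm θ‖ := abs_real_inner_le_norm _ _
      _ = ‖e.symm θ‖ * ‖z - x‖⁻¹ * ‖z - x‖ ^ 2 := by field_simp
  choose! d hd hdle using hderiv
  have himg : Set.Ioo (Real.log ρ) (Real.log r) ⊆ u '' S := by
    intro a ha
    have ht1 : ρ < Real.exp a := (Real.log_lt_iff_lt_exp hρ).1 ha.1
    have ht2 : Real.exp a < r := (Real.lt_log_iff_exp_lt (hρ.trans_le hρr)).1 ha.2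
    have hray : IsPreconnected ((fun s : ℝ => f x + s • θ) '' Set.Ici 0) :=
      isPreconnected_Ici.image _ hγ.continuousOn
    have hx0 : x ∈ Metric.ball x (Real.exp a) := Metric.mem_ball_self (Real.exp_pos a)
    obtain ⟨z, hz, s, hs, hzs⟩ := h.exists_mem_image_sphere (ht2.trans hr) hray
      ⟨f x, ⟨0, Set.self_mem_Ici, by simp⟩, x, hx0, rfl⟩ (by
        have hb : Bornology.IsBounded (f '' Metric.ball x (Real.exp a)) :=
          ((isCompact_closedBall x (Real.exp a)).image_of_continuousOn
              (h.contDiffOn.continuousOn.mono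
            (Metric.closedBall_subset_ball (ht2.trans hr)))).isBounded.subset
            (Set.image_mono Metric.ball_subset_closedBall)
        obtain ⟨M, hM⟩ := hb.subset_closedBall (f x)
        refine ⟨f x + (|M| + 1) • θ, ⟨|M| + 1, by simp only [Set.mem_Ici]; positivity, rfl⟩,
          fun hmem => ?_⟩
        have := mem_closedBall_iff_norm.1 (hM hmem)
        rw [add_sub_cancel_left, norm_smul, hθ, mul_one,
            Real.norm_of_nonneg (by positivity)] at this
        linarith [le_abs_self M])
    have hzR : z ∈ Metric.ball x R := (Metric.sphere_subset_closedBall.trans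
      (Metric.closedBall_subset_ball (ht2.trans hr))) hz
    have hzn : ‖z - x‖ = Real.exp a := mem_sphere_iff_norm.1 hz
    have hzs' : f x + s • θ = f z := hzs
    have hs0 : 0 < s := by
      refine lt_of_le_of_ne hs fun h0 => ?_
      rw [← h0, zero_smul, add_zero] at hzs'
      have := h.injOn (Metric.mem_ball_self (hρ.trans_le (hρr.trans hr.le))) hzR hzs'
      rw [← this, sub_self, norm_zero] at hzn
      exact (Real.exp_pos a).ne hzn
    refine ⟨s, ⟨hs0, z, ⟨by rw [hzn]; exact ht1, by rw [hzn]; exact ht2⟩, hzs'.symm⟩, ?_⟩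
    simp only [hu]
    rw [hzs', hψ, h.invFunOn_apply hzR, hzn, Real.log_pow, Real.log_exp]
    push_cast; ring
  have hvol := addHaar_image_le_lintegral_abs_det_fderiv (volume : Measure ℝ) hSo.measurableSet
    (f := u) (f' := fun s => ContinuousLinearMap.toSpanSingleton ℝ (d s))
    fun s hs => (hd s hs).hasFDerivAt.hasFDerivWithinAt
  calc ENNReal.ofReal (Real.log (r / ρ)) = volume (Set.Ioo (Real.log ρ) (Real.log r)) := by
        rw [Real.volume_Ioo, Real.log_div (hρ.trans_le hρr).ne' hρ.ne']
    _ ≤ volume (u '' S) := measure_mono himg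
    _ ≤ _ := hvol
    _ ≤ ∫⁻ s in S, ENNReal.ofReal (logDensity f x R (f x + s • θ)) := by
        refine setLIntegral_mono' hSo.measurableSet fun s hs => ENNReal.ofReal_le_ofReal ?_
        rw [ContinuousLinearMap.det_toSpanSingleton]
        exact hdle s hs
    _ = _ := by
        rw [← lintegral_indicator hSo.measurableSet, ← lintegral_indicator measurableSet_Ioi]
        refine lintegral_congr fun s => ?_
        by_cases hs : s ∈ Set.Ioi (0 : ℝ)
        · rw [Set.indicator_of_mem hs]
          by_cases hs' : f x + s • θ ∈ f '' A
          · rw [Set.indicator_of_mem (show s ∈ S from ⟨hs, hs'⟩), Set.indicator_of_mem hs']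
          · rw [Set.indicator_of_notMem (fun h : s ∈ S => hs' h.2), Set.indicator_of_notMem hs']
        · rw [Set.indicator_of_notMem hs, Set.indicator_of_notMem (fun h : s ∈ S => hs h.1)]

end IsConformalOnBall

/-! ### Images of balls nearly fill balls -/

/-- Young's inequality in the form that follows from Bernoulli's. -/
lemma Real.mul_pow_le_pow_add {a b : ℝ} (ha : 0 ≤ a) (hb : 0 < b) (n : ℕ) :
    (n + 1) * (a * b ^ n) ≤ a ^ (n + 1) + n * b ^ (n + 1) := by
  have h1 := one_add_mul_le_pow (a := a / b - 1) (by linarith [div_nonneg ha hb.le]) (n + 1)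
  rw [add_sub_cancel, div_pow, le_div_iff₀ (by positivity)] at h1
  have h2 : (1 + ((n + 1 : ℕ) : ℝ) * (a / b - 1)) * b ^ (n + 1) =
      (n + 1) * (a * b ^ n) - n * b ^ (n + 1) := by
    push_cast
    field_simp
    ring
  linarith

namespace IsConformalOnBall

variable {V : Type*} [NormedAddCommGroup V] [InnerProductSpace ℝ V] {f : V → V} {x : V} {R : ℝ}

lemma differentiableAt (h : IsConformalOnBall f x R) {z : V} (hz : z ∈ Metric.ball x R) :
    DifferentiableAt ℝ f z := (h.conformalAt z hz).differentiableAt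

lemma norm_image_sub_le (h : IsConformalOnBall f x R) {C : ℝ}
    (hC : ∀ z ∈ Metric.ball x R, ‖fderiv ℝ f z‖ ≤ C) {z : V} (hz : z ∈ Metric.ball x R) :
    ‖f z - f x‖ ≤ C * ‖z - x‖ :=
  (convex_ball x R).norm_image_sub_le_of_norm_fderiv_le (fun _ h' => h.differentiableAt h') hC
    (Metric.mem_ball_self ((norm_nonneg _).trans_lt (mem_ball_iff_norm.1 hz))) hz

variable [Nontrivial V]

lemma norm_fderiv_pos (h : IsConformalOnBall f x R) {z : V} (hz : z ∈ Metric.ball x R) :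
    0 < ‖fderiv ℝ f z‖ := (h.isConformalMap hz).norm_pos

variable [FiniteDimensional ℝ V]

lemma continuousOn_logDensity (h : IsConformalOnBall f x R) :
    ContinuousOn (logDensity f x R) (f '' (Metric.ball x R \ {x})) := by
  rintro _ ⟨z, hz, rfl⟩
  obtain ⟨e, -, he⟩ := h.hasFDerivAt_invFunOn hz.1
  have hinv := h.invFunOn_apply hz.1
  have h1 : ContinuousAt (fderiv ℝ f) (Function.invFunOn f (Metric.ball x R) (f z)) := by
    rw [hinv]
    exact (h.contDiffOn.continuousOn_fderiv_of_isOpen Metric.isOpen_ball le_rfl).continuousAt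
      (Metric.isOpen_ball.mem_nhds hz.1)
  refine ContinuousAt.continuousWithinAt (ContinuousAt.inv₀ ?_ ?_)
  · exact (h1.comp he.continuousAt).norm.mul (he.continuousAt.sub continuousAt_const).norm
  · rw [hinv]
    exact (mul_pos (h.norm_fderiv_pos hz.1) (norm_pos_iff.2 (sub_ne_zero.2 hz.2))).ne'

variable [MeasurableSpace V] [BorelSpace V]

/-- The length-area estimate: for the measure `dw / |w - f x| ^ q`, the image of an annulus has at
least the mass of the annulus. Young's inequality is applied to the product of `logDensity` and
`|w - f x| ^ (1 - q)`, whose integral is bounded below by integration of `log_le_lintegral_ray` over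
all rays; the conformality of `f` gives the integral of `logDensity ^ q`. -/
lemma le_lintegral_image_annulus (hq : 2 ≤ Module.finrank ℝ V) (h : IsConformalOnBall f x R)
    {ρ r : ℝ} (hρ : 0 < ρ) (hρr : ρ ≤ r) (hr : r < R) :
    (volume : Measure V).toSphere Set.univ * ENNReal.ofReal (Real.log (r / ρ)) ≤
      ∫⁻ w in f '' {z | ρ < ‖z - x‖ ∧ ‖z - x‖ < r},
        ENNReal.ofReal (‖w - f x‖⁻¹ ^ Module.finrank ℝ V) := by
  obtain ⟨n, hn⟩ : ∃ n, Module.finrank ℝ V = n + 1 := ⟨Module.finrank ℝ V - 1, by omega⟩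
  set A : Set V := {z | ρ < ‖z - x‖ ∧ ‖z - x‖ < r} with hA
  have hAR : A ⊆ Metric.ball x R := fun z hz => mem_ball_iff_norm.2 (hz.2.trans hr)
  have hAx : A ⊆ Metric.ball x R \ {x} := fun z hz => ⟨hAR hz, fun h0 => by
    rw [h0] at hz
    exact absurd hz.1 (by simp [hρ.le])⟩
  have hcn : Continuous fun z : V => ‖z - x‖ := by fun_prop
  have hAo : IsOpen A := by
    have : IsOpen ({z : V | ρ < ‖z - x‖} ∩ {z | ‖z - x‖ < r}) :=
      (isOpen_lt continuous_const hcn).inter (isOpen_lt hcn continuous_const)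
    exact this
  have hfA : IsOpen (f '' A) := h.isOpen_image hAo hAR
  set σ := (volume : Measure V).toSphere Set.univ with hσ
  set ℓ := ENNReal.ofReal (Real.log (r / ρ)) with hℓ
  have hσℓ : σ * ℓ ≠ ∞ := ENNReal.mul_ne_top (measure_ne_top _ _) ENNReal.ofReal_ne_top
  set g := logDensity f x R with hg
  have hg0 : ∀ w, 0 ≤ g w := fun w => inv_nonneg.2 (by positivity)
  have hgm : Measurable ((f '' A).indicator fun w => ENNReal.ofReal (g w)) := by
    classical
    have hc : ContinuousOn (fun w => ENNReal.ofReal (g w)) (f '' A) :=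
      ENNReal.continuous_ofReal.comp_continuousOn
        (h.continuousOn_logDensity.mono (Set.image_mono hAx))
    rw [← Set.piecewise_eq_indicator]
    exact hc.measurable_piecewise continuousOn_const hfA.measurableSet
  have hbm : Measurable fun w => ENNReal.ofReal (‖w - f x‖⁻¹ ^ n) := by fun_prop
  -- integration over all rays
  have h1 : σ * ℓ ≤ ∫⁻ w in f '' A, ENNReal.ofReal (g w) * ENNReal.ofReal (‖w - f x‖⁻¹ ^ n) := by
    calc σ * ℓ = ∫⁻ _ : Metric.sphere (0 : V) 1, ℓ ∂(volume : Measure V).toSphere := by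
          rw [lintegral_const, mul_comm]
      _ ≤ ∫⁻ θ : Metric.sphere (0 : V) 1, (∫⁻ s in Set.Ioi (0 : ℝ),
            (f '' A).indicator (fun w => ENNReal.ofReal (g w)) (f x + s • (θ : V)))
            ∂(volume : Measure V).toSphere :=
          lintegral_mono fun θ => h.log_le_lintegral_ray hρ hρr hr θ (by simp)
      _ = ∫⁻ θ : Metric.sphere (0 : V) 1, (∫⁻ s in Set.Ioi (0 : ℝ),
            ENNReal.ofReal (s ^ (Module.finrank ℝ V - 1)) *
            ((f '' A).indicator (fun w => ENNReal.ofReal (g w)) (f x + s • (θ : V)) *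
              ENNReal.ofReal (‖f x + s • (θ : V) - f x‖⁻¹ ^ n)))
            ∂(volume : Measure V).toSphere := by
          refine lintegral_congr fun θ => setLIntegral_congr_fun measurableSet_Ioi fun s hs => ?_
          have hs' : (0 : ℝ) < s := hs
          have hθ : ‖(θ : V)‖ = 1 := by simp
          rw [add_sub_cancel_left, norm_smul, hθ, mul_one, Real.norm_of_nonneg hs'.le, hn,
            Nat.add_sub_cancel, mul_left_comm, ← ENNReal.ofReal_mul (by positivity), ← mul_pow,
            mul_inv_cancel₀ hs'.ne', one_pow, ENNReal.ofReal_one, mul_one]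
      _ = ∫⁻ w, (f '' A).indicator (fun w => ENNReal.ofReal (g w)) w *
            ENNReal.ofReal (‖w - f x‖⁻¹ ^ n) := (lintegral_polar (f x) (hgm.mul hbm)).symm
      _ = _ := by
          rw [← lintegral_indicator hfA.measurableSet]
          refine lintegral_congr fun w => ?_
          by_cases hw : w ∈ f '' A
          · rw [Set.indicator_of_mem hw, Set.indicator_of_mem hw]
          · rw [Set.indicator_of_notMem hw, Set.indicator_of_notMem hw, zero_mul]
  -- conformal invariance
  have h2 : ∫⁻ w in f '' A, ENNReal.ofReal (g w ^ (n + 1)) = σ * ℓ := by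
    rw [lintegral_image_eq_lintegral_abs_det_fderiv_mul volume hAo.measurableSet
      (fun z hz => (h.differentiableAt (hAR hz)).hasFDerivAt.hasFDerivWithinAt)
      (h.injOn.mono hAR), hσ, hℓ, ← lintegral_annulus x hρ hρr]
    refine setLIntegral_congr_fun hAo.measurableSet fun z hz => ?_
    have hz0 := h.norm_fderiv_pos (hAR hz)
    rw [(h.isConformalMap (hAR hz)).abs_det, ← ENNReal.ofReal_mul (by positivity), hn, hg,
      h.logDensity_apply (hAR hz), ← mul_pow, mul_inv, ← mul_assoc, mul_inv_cancel₀ hz0.ne',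
      one_mul]
  set I := ∫⁻ w in f '' A, ENNReal.ofReal (‖w - f x‖⁻¹ ^ (n + 1)) with hI
  have h3 : ((n : ℝ≥0∞) + 1) * (σ * ℓ) ≤ σ * ℓ + n * I := by
    calc ((n : ℝ≥0∞) + 1) * (σ * ℓ)
        ≤ ((n : ℝ≥0∞) + 1) *
          ∫⁻ w in f '' A, ENNReal.ofReal (g w) * ENNReal.ofReal (‖w - f x‖⁻¹ ^ n) := by gcongr
      _ = ∫⁻ w in f '' A, ((n : ℝ≥0∞) + 1) *
            (ENNReal.ofReal (g w) * ENNReal.ofReal (‖w - f x‖⁻¹ ^ n)) :=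
          (lintegral_const_mul' _ _ (by simp)).symm
      _ ≤ ∫⁻ w in f '' A, (ENNReal.ofReal (g w ^ (n + 1)) +
            n * ENNReal.ofReal (‖w - f x‖⁻¹ ^ (n + 1))) := by
          refine setLIntegral_mono' hfA.measurableSet ?_
          rintro _ ⟨z, hz, rfl⟩
          have hne : 0 < ‖f z - f x‖ := norm_pos_iff.2 (sub_ne_zero.2 fun heq =>
            (hAx hz).2 (h.injOn (hAR hz) (Metric.mem_ball_self
              (hρ.trans_le (hρr.trans hr.le))) heq))
          have := ENNReal.ofReal_le_ofReal
            (Real.mul_pow_le_pow_add (hg0 (f z)) (inv_pos.2 hne) n)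
          rwa [ENNReal.ofReal_mul (by positivity), ENNReal.ofReal_mul (hg0 _),
            ENNReal.ofReal_add (pow_nonneg (hg0 _) _) (by positivity),
            ENNReal.ofReal_mul (by positivity), ENNReal.ofReal_add (by positivity) zero_le_one,
            ENNReal.ofReal_natCast, ENNReal.ofReal_one] at this
      _ = σ * ℓ + n * I := by
          rw [lintegral_add_right _ (by fun_prop), h2, lintegral_const_mul _ (by fun_prop)]
  rw [add_mul, one_mul, add_comm] at h3
  rw [hn]
  have h4 := (ENNReal.add_le_add_iff_left hσℓ).1 h3
  exact (ENNReal.mul_le_mul_iff_right (by simp; omega) (by simp)).1 h4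

/-- If `|f'| ≤ L |f' x|` on a ball with `L` close to `1`, then the image of a concentric ball of
radius `r` nearly fills the ball of center `f x` and radius `L |f' x| r`, which contains it. -/
lemma volume_ball_diff_image_le (hq : 2 ≤ Module.finrank ℝ V) (h : IsConformalOnBall f x R)
    {L M r : ℝ} (hLM : L < M) (hL : 1 ≤ L)
    (hb : ∀ z ∈ Metric.ball x R, ‖fderiv ℝ f z‖ ≤ L * ‖fderiv ℝ f x‖) (hr0 : 0 < r) (hr : r < R) :
    volume (Metric.ball (f x) (L * ‖fderiv ℝ f x‖ * r) \ f '' Metric.ball x r) ≤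
      ENNReal.ofReal (Module.finrank ℝ V * Real.log M) *
        volume (Metric.ball (f x) (L * ‖fderiv ℝ f x‖ * r)) := by
  have hx : x ∈ Metric.ball x R := Metric.mem_ball_self (hr0.trans hr)
  set c := ‖fderiv ℝ f x‖ with hc
  have hc0 : 0 < c := h.norm_fderiv_pos hx
  have hL0 : 0 < L := one_pos.trans_le hL
  have hM0 : 0 < M := hL0.trans hLM
  set b := L * c * r with hbdef
  have hb0 : 0 < b := by positivity
  have hk : 0 < 1 - L / M := sub_pos.2 ((div_lt_one hM0).2 hLM)
  -- the derivative at the center gives the inner radius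
  obtain ⟨ρ, hρ0, hρr, hρ⟩ : ∃ ρ, 0 < ρ ∧ ρ ≤ r ∧ ∀ z ∈ Metric.sphere x ρ,
      L / M * c * ρ < ‖f z - f x‖ := by
    have h1 := ((h.differentiableAt hx).hasFDerivAt.isLittleO.def
      (by positivity : 0 < (1 - L / M) * c / 2))
    obtain ⟨δ, hδ0, hδ⟩ := Metric.eventually_nhds_iff.1 h1
    refine ⟨min (δ / 2) r, by positivity, min_le_right _ _, fun z hz => ?_⟩
    have hzn : ‖z - x‖ = min (δ / 2) r := mem_sphere_iff_norm.1 hz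
    have hpos : 0 < ‖z - x‖ := by rw [hzn]; positivity
    have h2 := hδ (y := z) (by
      rw [dist_eq_norm, hzn]
      exact (min_le_left _ _).trans_lt (half_lt_self hδ0))
    have h3 := norm_sub_norm_le (fderiv ℝ f x (z - x)) (fderiv ℝ f x (z - x) - (f z - f x))
    rw [sub_sub_cancel, norm_sub_rev _ (f z - f x), (h.isConformalMap hx).norm_apply] at h3
    rw [← hzn]
    nlinarith [mul_pos (mul_pos hk hc0) hpos]
  set a := L / M * c * ρ with hadef
  have ha0 : 0 < a := by positivity
  have hab : a ≤ b := by
    have : L / M ≤ L := by rw [div_le_iff₀ hM0]; nlinarith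
    rw [hadef, hbdef]
    gcongr
  have hin : Metric.closedBall (f x) a ⊆ f '' Metric.ball x ρ := by
    by_contra hcon
    obtain ⟨w, hw, hw'⟩ := Set.not_subset.1 hcon
    obtain ⟨z, hz, hzb⟩ := h.exists_mem_image_sphere (hρr.trans_lt hr)
      (convex_closedBall (f x) a).isPreconnected
      ⟨f x, Metric.mem_closedBall_self ha0.le, x, Metric.mem_ball_self hρ0, rfl⟩ ⟨w, hw, hw'⟩
    exact absurd (mem_closedBall_iff_norm.1 hzb) (not_le.2 (hρ z hz))
  set A : Set V := {z | ρ < ‖z - x‖ ∧ ‖z - x‖ < r} with hA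
  set B : Set V := {w | a < ‖w - f x‖ ∧ ‖w - f x‖ < b} with hB
  have hcn : ∀ y : V, Continuous fun z : V => ‖z - y‖ := fun y => by fun_prop
  have hring : ∀ (y : V) (s t : ℝ), IsOpen {z : V | s < ‖z - y‖ ∧ ‖z - y‖ < t} := fun y s t => by
    have : IsOpen ({z : V | s < ‖z - y‖} ∩ {z | ‖z - y‖ < t}) :=
      (isOpen_lt continuous_const (hcn y)).inter (isOpen_lt (hcn y) continuous_const)
    exact this
  have hAR : A ⊆ Metric.ball x R := fun z hz => mem_ball_iff_norm.2 (hz.2.trans hr)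
  have hfA : MeasurableSet (f '' A) := (h.isOpen_image (hring _ _ _) hAR).measurableSet
  have hAB : f '' A ⊆ B := by
    rintro _ ⟨z, hz, rfl⟩
    refine ⟨not_le.1 fun hle => ?_, ?_⟩
    · obtain ⟨z', hz', heq⟩ := hin (mem_closedBall_iff_norm.2 hle)
      have := h.injOn (Metric.ball_subset_ball (hρr.trans hr.le) hz') (hAR hz) heq
      rw [this] at hz'
      exact absurd (mem_ball_iff_norm.1 hz') (not_lt.2 hz.1.le)
    · refine (h.norm_image_sub_le hb (hAR hz)).trans_lt ?_
      exact mul_lt_mul_of_pos_left hz.2 (by positivity)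
  have hsub : Metric.ball (f x) b \ f '' Metric.ball x r ⊆ B \ f '' A := by
    rintro w ⟨hw, hw'⟩
    refine ⟨⟨not_le.1 fun hle => hw' ?_, mem_ball_iff_norm.1 hw⟩, fun hwA => hw' ?_⟩
    · exact Set.image_mono (Metric.ball_subset_ball hρr) (hin (mem_closedBall_iff_norm.2 hle))
    · exact Set.image_mono (fun z hz => mem_ball_iff_norm.2 hz.2) hwA
  set q := Module.finrank ℝ V with hqdef
  set σ := (volume : Measure V).toSphere Set.univ with hσ
  have h1 : ∫⁻ w in B \ f '' A, ENNReal.ofReal (‖w - f x‖⁻¹ ^ q) ≤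
      σ * ENNReal.ofReal (Real.log M) := by
    have h2 := h.le_lintegral_image_annulus hq hρ0 hρr hr
    have h3 := lintegral_annulus (f x) ha0 hab
    have hlog : Real.log (b / a) = Real.log M + Real.log (r / ρ) := by
      rw [← Real.log_mul hM0.ne' (by positivity)]
      congr 1
      rw [hadef, hbdef]
      field_simp
    have hlog1 : 0 ≤ Real.log M := Real.log_nonneg (hL.trans hLM.le)
    have hlog2 : 0 ≤ Real.log (r / ρ) := Real.log_nonneg ((one_le_div hρ0).2 hρr)
    rw [hlog, ENNReal.ofReal_add hlog1 hlog2, mul_add] at h3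
    have h4 : (∫⁻ w in B \ f '' A, ENNReal.ofReal (‖w - f x‖⁻¹ ^ q)) +
        (∫⁻ w in f '' A, ENNReal.ofReal (‖w - f x‖⁻¹ ^ q)) =
        σ * ENNReal.ofReal (Real.log M) + σ * ENNReal.ofReal (Real.log (r / ρ)) := by
      rw [← h3, ← lintegral_inter_add_sdiff _ B hfA, add_comm,
          Set.inter_eq_self_of_subset_right hAB]
    have h5 : σ * ENNReal.ofReal (Real.log (r / ρ)) ≠ ∞ :=
      ENNReal.mul_ne_top (measure_ne_top _ _) ENNReal.ofReal_ne_top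
    refine (ENNReal.add_le_add_iff_right h5).1 (le_trans ?_ h4.le)
    gcongr
  have hbq : ENNReal.ofReal (b ^ q) ≠ 0 := by simpa using pow_pos hb0 q
  have h6 : volume (B \ f '' A) ≤ ENNReal.ofReal (b ^ q) * (σ * ENNReal.ofReal (Real.log M)) := by
    calc volume (B \ f '' A) = ∫⁻ w in B \ f '' A, 1 := by
          rw [lintegral_one, Measure.restrict_apply_univ]
      _ ≤ ∫⁻ w in B \ f '' A, ENNReal.ofReal (b ^ q) * ENNReal.ofReal (‖w - f x‖⁻¹ ^ q) := by
          refine setLIntegral_mono' ((hring _ _ _).measurableSet.diff hfA) fun w hw => ?_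
          have hw0 : 0 < ‖w - f x‖ := ha0.trans hw.1.1
          rw [← ENNReal.ofReal_mul (by positivity), ← mul_pow, ENNReal.one_le_ofReal]
          refine one_le_pow₀ ?_
          rw [← div_eq_mul_inv, one_le_div hw0]
          exact hw.1.2.le
      _ ≤ _ := by
          rw [lintegral_const_mul _ (by fun_prop)]
          gcongr
  calc volume (Metric.ball (f x) b \ f '' Metric.ball x r) ≤ volume (B \ f '' A) :=
      measure_mono hsub
    _ ≤ _ := h6
    _ = _ := by
        rw [hσ, Measure.toSphere_apply_univ, Measure.addHaar_ball_of_pos _ _ hb0,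
          ENNReal.ofReal_mul (by positivity), ENNReal.ofReal_natCast]
        ring

end IsConformalOnBall

/-! ### Lower bounds for the distance of two image points -/

/-- The images of two disjoint balls around `x` and `y`, with radii inversely proportional to
`|f' x|` and `|f' y|`, are disjoint and nearly fill two balls of equal radii around `f x` and `f y`.
So `f x` and `f y` are nearly as far apart as the sum of these radii. -/
lemma IsConformalOnBall.le_norm_image_sub {V : Type*} [NormedAddCommGroup V] [InnerProductSpace ℝ V]
    [FiniteDimensional ℝ V] [Nontrivial V] [MeasurableSpace V] [BorelSpace V] {f : V → V} {x y : V}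
    {R k L K d : ℝ} (hq : 2 ≤ Module.finrank ℝ V) (hx : IsConformalOnBall f x R)
    (hy : IsConformalOnBall f y R) (hinj : Set.InjOn f (Metric.ball x R ∪ Metric.ball y R))
    (hk0 : 0 < k) (hk1 : k < 1) (hL : 1 ≤ L)
    (hLk : 2 * Module.finrank ℝ V * Real.log L < k ^ Module.finrank ℝ V)
    (hbx : ∀ z ∈ Metric.ball x R, ‖fderiv ℝ f z‖ ≤ L * ‖fderiv ℝ f x‖)
    (hby : ∀ z ∈ Metric.ball y R, ‖fderiv ℝ f z‖ ≤ L * ‖fderiv ℝ f y‖)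
    (hK : ‖fderiv ℝ f x‖ ≤ K * ‖fderiv ℝ f y‖) (hd : 0 < d) (hdR : d ≤ R) (hdxy : d ≤ ‖x - y‖) :
    2 * (1 - k) / (1 + K) * ‖fderiv ℝ f x‖ * d ≤ ‖f x - f y‖ := by
  set q := Module.finrank ℝ V with hqdef
  have hq0 : (0 : ℝ) < q := by exact_mod_cast (by omega : 0 < q)
  have hcx : 0 < ‖fderiv ℝ f x‖ := hx.norm_fderiv_pos (Metric.mem_ball_self (hd.trans_le hdR))
  have hcy : 0 < ‖fderiv ℝ f y‖ := hy.norm_fderiv_pos (Metric.mem_ball_self (hd.trans_le hdR))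
  set a := ‖fderiv ℝ f x‖ with ha
  set b := ‖fderiv ℝ f y‖ with hb
  have hK0 : 0 < K := pos_of_mul_pos_left (hcx.trans_le hK) hcy.le
  set h := d * a * b / (a + b) with hh
  have hh0 : 0 < h := by positivity
  have hLh : 0 < L * h := by positivity
  have hlow : 1 / (1 + K) * a * d ≤ h := by
    rw [hh, div_mul_eq_mul_div, div_mul_eq_mul_div, div_le_div_iff₀ (by positivity) (by positivity)]
    nlinarith [mul_le_mul_of_nonneg_left hK (mul_pos hcx hd).le]
  suffices hmain : 2 * (1 - k) * h ≤ ‖f x - f y‖ by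
    refine le_trans ?_ hmain
    calc 2 * (1 - k) / (1 + K) * a * d = 2 * (1 - k) * (1 / (1 + K) * a * d) := by ring
      _ ≤ _ := mul_le_mul_of_nonneg_left hlow (by linarith)
  by_contra! hcon
  -- the two balls
  have hr1 : d * b / (a + b) < d := by rw [div_lt_iff₀ (by positivity)]; nlinarith
  have hr2 : d * a / (a + b) < d := by rw [div_lt_iff₀ (by positivity)]; nlinarith
  have hdisj : Disjoint (f '' Metric.ball x (d * b / (a + b)))
      (f '' Metric.ball y (d * a / (a + b))) := by
    rw [Set.disjoint_left]
    rintro _ ⟨z, hz, rfl⟩ ⟨z', hz', heq⟩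
    have hzz : z' = z := hinj (Or.inr (Metric.ball_subset_ball (hr2.le.trans hdR) hz'))
      (Or.inl (Metric.ball_subset_ball (hr1.le.trans hdR) hz)) heq
    rw [hzz] at hz'
    have h1 := norm_sub_le_norm_sub_add_norm_sub x z y
    rw [norm_sub_rev x z] at h1
    have h2 : d * b / (a + b) + d * a / (a + b) = d := by field_simp; ring
    linarith [mem_ball_iff_norm.1 hz, mem_ball_iff_norm.1 hz']
  obtain ⟨M, hLM, hM⟩ : ∃ M, L < M ∧ 2 * q * Real.log M < k ^ q := by
    refine ⟨Real.exp ((Real.log L + k ^ q / (2 * q)) / 2), ?_, ?_⟩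
    · have : Real.log L < k ^ q / (2 * q) := by
        rw [lt_div_iff₀ (by positivity)]; linarith
      rw [← Real.log_lt_iff_lt_exp (one_pos.trans_le hL)]
      linarith
    · rw [Real.log_exp]
      have : 2 * q * (k ^ q / (2 * q)) = k ^ q := by field_simp
      linarith
  have hM0 : 0 ≤ Real.log M := Real.log_nonneg (hL.trans hLM.le)
  have hv1 := hx.volume_ball_diff_image_le hq hLM hL hbx (by positivity) (hr1.trans_le hdR)
  have hv2 := hy.volume_ball_diff_image_le hq hLM hL hby (by positivity) (hr2.trans_le hdR)
  have e1 : L * a * (d * b / (a + b)) = L * h := by rw [hh]; ring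
  have e2 : L * b * (d * a / (a + b)) = L * h := by rw [hh]; ring
  rw [← ha, e1] at hv1
  rw [← hb, e2] at hv2
  set c := f y + (1 / 2 : ℝ) • (f x - f y) with hc
  have hcx' : ‖c - f x‖ < (1 - k) * h := by
    have : c - f x = (-(1 / 2) : ℝ) • (f x - f y) := by rw [hc]; module
    rw [this, norm_smul]
    norm_num
    linarith
  have hcy' : ‖c - f y‖ < (1 - k) * h := by
    have : c - f y = (1 / 2 : ℝ) • (f x - f y) := by rw [hc]; module
    rw [this, norm_smul]
    norm_num
    linarith
  have hLh1 : (1 - k) * h ≤ (1 - k) * (L * h) :=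
    mul_le_mul_of_nonneg_left (le_mul_of_one_le_left hh0.le hL) (by linarith)
  have hsub : Metric.ball c (k * (L * h)) ⊆
      (Metric.ball (f x) (L * h) \ f '' Metric.ball x (d * b / (a + b))) ∪
      (Metric.ball (f y) (L * h) \ f '' Metric.ball y (d * a / (a + b))) := by
    intro w hw
    have hw1 := mem_ball_iff_norm.1 hw
    have hw2 : w ∈ Metric.ball (f x) (L * h) := mem_ball_iff_norm.2 (by
      linarith [norm_sub_le_norm_sub_add_norm_sub w c (f x)])
    have hw3 : w ∈ Metric.ball (f y) (L * h) := mem_ball_iff_norm.2 (by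
      linarith [norm_sub_le_norm_sub_add_norm_sub w c (f y)])
    by_cases hU : w ∈ f '' Metric.ball x (d * b / (a + b))
    · exact Or.inr ⟨hw3, Set.disjoint_left.1 hdisj hU⟩
    · exact Or.inl ⟨hw2, hU⟩
  have hvol := (measure_mono hsub).trans ((measure_union_le _ _).trans (add_le_add hv1 hv2))
  rw [Measure.addHaar_ball_of_pos _ _ hLh, Measure.addHaar_ball_of_pos _ _ hLh,
    Measure.addHaar_ball_of_pos _ _ (by positivity), ← add_mul, ← ENNReal.ofReal_add (by positivity)
    (by positivity), ← mul_assoc (ENNReal.ofReal (_ + _)), ← ENNReal.ofReal_mul (by positivity),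
    ENNReal.mul_le_mul_iff_left (Metric.measure_ball_pos _ _ one_pos).ne' measure_ball_lt_top.ne,
    ENNReal.ofReal_le_ofReal_iff (by positivity), mul_pow] at hvol
  have := le_of_mul_le_mul_right hvol (pow_pos hLh q)
  linarith

/-- In dimension one, a connected set is convex. -/
lemma IsPreconnected.convex_euclideanSpace_fin_one {X : Set (EuclideanSpace ℝ (Fin 1))}
    (hX : IsPreconnected X) : Convex ℝ X := by
  have h1 : Convex ℝ ((fun x : EuclideanSpace ℝ (Fin 1) => x 0) '' X) :=
    (hX.image _ (by fun_prop)).ordConnected.convex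
  have h2 : X = (EuclideanSpace.proj (0 : Fin 1) : EuclideanSpace ℝ (Fin 1) →L[ℝ] ℝ).toLinearMap ⁻¹'
      ((fun x : EuclideanSpace ℝ (Fin 1) => x 0) '' X) := by
    ext x
    constructor
    · exact fun hx => ⟨x, hx, rfl⟩
    · rintro ⟨y, hy, hyx⟩
      have : y = x := by
        ext i
        rw [Subsingleton.elim i 0]
        exact hyx
      exact this ▸ hy
  rw [h2]
  exact h1.linear_preimage _

/-- A consequence of the mean value theorem in dimension one. -/
lemma norm_fderiv_mul_le_of_segment {f : EuclideanSpace ℝ (Fin 1) → EuclideanSpace ℝ (Fin 1)}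
    {x y : EuclideanSpace ℝ (Fin 1)} {c : ℝ} (hf : ∀ z ∈ segment ℝ x y, ConformalAt f z)
    (hc : ∀ z ∈ segment ℝ x y, c ≤ ‖fderiv ℝ f z‖) : c * ‖x - y‖ ≤ ‖f x - f y‖ := by
  have hnorm : ∀ v : EuclideanSpace ℝ (Fin 1), ‖v‖ = |v 0| := fun v => by
    simp [EuclideanSpace.norm_eq, Real.sqrt_sq_eq_abs]
  have hder : ∀ t ∈ Set.Icc (0 : ℝ) 1,
      HasDerivAt (fun t : ℝ => f (x + t • (y - x)) 0)
        (fderiv ℝ f (x + t • (y - x)) (y - x) 0) t := by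
    intro t ht
    have hz : x + t • (y - x) ∈ segment ℝ x y := by
      rw [segment_eq_image']
      exact ⟨t, ht, rfl⟩
    have h1 : HasDerivAt (fun t : ℝ => x + t • (y - x)) (y - x) t := by
      simpa using ((hasDerivAt_id t).smul_const (y - x)).const_add x
    have h2 := (hf _ hz).differentiableAt.hasFDerivAt.comp_hasDerivAt t h1
    exact ((EuclideanSpace.proj (0 : Fin 1) :
        EuclideanSpace ℝ (Fin 1) →L[ℝ] ℝ).hasFDerivAt.comp_hasDerivAt
      t h2)
  obtain ⟨t, ht, htd⟩ := exists_hasDerivAt_eq_slope (fun t : ℝ => f (x + t • (y - x)) 0) _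
    zero_lt_one (fun t ht => (hder t ht).continuousAt.continuousWithinAt)
    fun t ht => hder t ⟨ht.1.le, ht.2.le⟩
  have hz : x + t • (y - x) ∈ segment ℝ x y := by
    rw [segment_eq_image']
    exact ⟨t, ⟨ht.1.le, ht.2.le⟩, rfl⟩
  have hcm := conformalAt_iff_isConformalMap_fderiv.1 (hf _ hz)
  have h3 := hcm.norm_apply (y - x)
  rw [hnorm, htd] at h3
  simp only [one_smul, zero_smul, add_zero, add_sub_cancel, sub_zero, div_one] at h3
  have h4 : ‖f x - f y‖ = ‖fderiv ℝ f (x + t • (y - x))‖ * ‖x - y‖ := by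
    rw [norm_sub_rev, hnorm, norm_sub_rev x y, ← h3]
    rfl
  rw [h4]
  exact mul_le_mul_of_nonneg_right (hc _ hz) (norm_nonneg _)

/-! ### Uniform local geometry of the maps of the system -/

namespace RandomConformalIFS

variable {Λ : Type*} [MeasurableSpace Λ] {m : Measure Λ} {E : Type*} {q : ℕ}
  (S : RandomConformalIFS Λ m E q)

lemma isConformalMap_fderiv (e : E) (l : Λ) {x : EuclideanSpace ℝ (Fin q)} (hx : x ∈ S.W) :
    IsConformalMap (fderiv ℝ (S.φ e l) x) :=
  conformalAt_iff_isConformalMap_fderiv.1 (S.conformalAt_W e l x hx)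

lemma norm_fderiv_pos [NeZero q] (e : E) (l : Λ) {x : EuclideanSpace ℝ (Fin q)} (hx : x ∈ S.X) :
    0 < ‖fderiv ℝ (S.φ e l) x‖ :=
  (S.isConformalMap_fderiv e l (S.X_subset_W hx)).norm_pos

lemma exists_ball_subset_W [NeZero q] : ∃ D > 0, ∀ x ∈ S.X, D ≤ Metric.infDist x S.Wᶜ ∧
    Metric.ball x D ⊆ S.W := by
  have hne : S.Wᶜ.Nonempty := by
    rw [Set.nonempty_compl]
    intro h
    exact NormedSpace.unbounded_univ ℝ (EuclideanSpace ℝ (Fin q)) (h ▸ S.isBounded_W)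
  obtain ⟨x₀, hx₀, hmin⟩ := S.isCompact_X.exists_isMinOn S.isConnected_X.nonempty
    (Metric.continuous_infDist_pt S.Wᶜ).continuousOn
  refine ⟨Metric.infDist x₀ S.Wᶜ, ?_, fun x hx => ⟨hmin hx, fun y hy => ?_⟩⟩
  · exact (S.isOpen_W.isClosed_compl.notMem_iff_infDist_pos hne).1
      fun h => h (S.X_subset_W hx₀)
  · by_contra hyW
    have h1 : Metric.infDist x S.Wᶜ ≤ dist x y := Metric.infDist_le_dist_of_mem hyW
    have h2 : Metric.infDist x₀ S.Wᶜ ≤ Metric.infDist x S.Wᶜ := hmin hx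
    rw [Metric.mem_ball'] at hy
    linarith

/-- The distortion is uniformly close to `1` at small distances from points of `X`. -/
lemma exists_norm_fderiv_le [NeZero q] {L : ℝ} (hL : 1 < L) : ∃ δ > 0, ∀ x ∈ S.X,
    Metric.ball x δ ⊆ S.W ∧ ∀ e l, ∀ y ∈ Metric.closedBall x δ,
      ‖fderiv ℝ (S.φ e l) y‖ ≤ L * ‖fderiv ℝ (S.φ e l) x‖ := by
  obtain ⟨D, hD0, hD⟩ := S.exists_ball_subset_W
  obtain ⟨K, -, -, hK, hdist⟩ := S.bounded_distortion
  obtain ⟨t, htL, ht0, ht1⟩ := ((hK.eventually (gt_mem_nhds hL)).and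
    (Ioo_mem_nhdsGT one_pos)).exists
  refine ⟨t * D, by positivity, fun x hx => ⟨?_, fun e l y hy => ?_⟩⟩
  · exact (Metric.ball_subset_ball (by nlinarith)).trans (hD x hx).2
  · have h1 := hdist t ⟨ht0.le, ht1⟩ e l x hx y ((mem_closedBall_iff_norm.1 hy).trans
      (mul_le_mul_of_nonneg_left (hD x hx).1 ht0.le))
    rw [div_le_iff₀ (S.norm_fderiv_pos e l hx)] at h1
    exact h1.trans (mul_le_mul_of_nonneg_right htL.le (norm_nonneg _))

/-- The global distortion on `X` is bounded, by compactness and connectedness of `X`. -/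
lemma exists_global_distortion [NeZero q] : ∃ K, 0 < K ∧ ∀ x ∈ S.X, ∀ y ∈ S.X, ∀ e l,
    ‖fderiv ℝ (S.φ e l) x‖ ≤ K * ‖fderiv ℝ (S.φ e l) y‖ := by
  obtain ⟨δ, hδ0, hδ⟩ := S.exists_norm_fderiv_le one_lt_two
  let P : EuclideanSpace ℝ (Fin q) → EuclideanSpace ℝ (Fin q) → ℝ → Prop := fun x y K =>
    ∀ e l, ‖fderiv ℝ (S.φ e l) x‖ ≤ K * ‖fderiv ℝ (S.φ e l) y‖ ∧
      ‖fderiv ℝ (S.φ e l) y‖ ≤ K * ‖fderiv ℝ (S.φ e l) x‖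
  have hnear : ∀ x ∈ S.X, ∀ y ∈ S.X, dist x y ≤ δ → P x y 2 := fun x hx y hy hxy e l =>
    ⟨(hδ y hy).2 e l x hxy, (hδ x hx).2 e l y (Metric.mem_closedBall'.2 hxy)⟩
  have htrans : ∀ x y z K K', 0 < K → 0 < K' → P x y K → P y z K' → P x z (K * K') := by
    intro x y z K K' hK hK' h1 h2 e l
    obtain ⟨a1, a2⟩ := h1 e l
    obtain ⟨b1, b2⟩ := h2 e l
    constructor
    · nlinarith
    · nlinarith
  have hall : ∀ x ∈ S.X, ∀ y ∈ S.X, ∃ K, 0 < K ∧ P x y K := by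
    refine fun x hx y hy => S.isConnected_X.isPreconnected.induction₂
      (fun x y => ∃ K, 0 < K ∧ P x y K) ?_ ?_ ?_ hx hy
    · intro x hx
      filter_upwards [self_mem_nhdsWithin,
          mem_nhdsWithin_of_mem_nhds (Metric.closedBall_mem_nhds x hδ0)]
        with y hy hyx
      exact ⟨2, two_pos, hnear x hx y hy (Metric.mem_closedBall'.1 hyx)⟩
    · rintro x y z _ _ _ ⟨K, hK, h1⟩ ⟨K', hK', h2⟩
      exact ⟨K * K', by positivity, htrans x y z K K' hK hK' h1 h2⟩
    · rintro x y _ _ ⟨K, hK, h1⟩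
      exact ⟨K, hK, fun e l => (h1 e l).symm⟩
  obtain ⟨x₀, hx₀⟩ := S.isConnected_X.nonempty
  have hcpt : ∃ K, 0 < K ∧ ∀ y ∈ S.X, P x₀ y K := by
    have := S.isCompact_X.induction_on (p := fun s => ∃ K, 0 < K ∧ ∀ y ∈ s, y ∈ S.X → P x₀ y K)
      ⟨1, one_pos, by simp⟩ (fun s t hst ⟨K, hK, h⟩ => ⟨K, hK, fun y hy => h y (hst hy)⟩) ?_ ?_
    · obtain ⟨K, hK, h⟩ := this
      exact ⟨K, hK, fun y hy => h y hy hy⟩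
    · rintro s t ⟨K, hK, h⟩ ⟨K', hK', h'⟩
      refine ⟨max K K', by positivity, fun y hy hyX e l => ?_⟩
      rcases hy with hy | hy
      · obtain ⟨h1, h2⟩ := h y hy hyX e l
        exact ⟨h1.trans (mul_le_mul_of_nonneg_right (le_max_left _ _) (norm_nonneg _)),
          h2.trans (mul_le_mul_of_nonneg_right (le_max_left _ _) (norm_nonneg _))⟩
      · obtain ⟨h1, h2⟩ := h' y hy hyX e l
        exact ⟨h1.trans (mul_le_mul_of_nonneg_right (le_max_right _ _) (norm_nonneg _)),
          h2.trans (mul_le_mul_of_nonneg_right (le_max_right _ _) (norm_nonneg _))⟩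
    · intro x hx
      obtain ⟨K, hK, h⟩ := hall x₀ hx₀ x hx
      exact ⟨Metric.closedBall x δ, mem_nhdsWithin_of_mem_nhds (Metric.closedBall_mem_nhds x hδ0),
        K * 2, by positivity, fun y hy hyX =>
          htrans _ x _ K 2 hK two_pos h (hnear x hx y hyX (Metric.mem_closedBall'.1 hy))⟩
  obtain ⟨K, hK, h⟩ := hcpt
  refine ⟨K * K, by positivity, fun x hx y hy e l => ?_⟩
  have h1 := (h x hx e l).2
  have h2 := (h y hy e l).1
  nlinarith

/-- Lower bounds for distances of image points, in dimension one. -/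
lemma exists_le_norm_image_sub_one (S : RandomConformalIFS Λ m E 1) {ε : ℝ} (hε : 0 < ε) :
    ∃ δ > 0, ∃ c > 0, ∀ e l, ∀ x ∈ S.X, ∀ y ∈ S.X,
      (‖x - y‖ ≤ δ → Real.exp (-ε) * ‖fderiv ℝ (S.φ e l) x‖ * ‖x - y‖ ≤
        ‖S.φ e l x - S.φ e l y‖) ∧
      (δ < ‖x - y‖ → c * ‖fderiv ℝ (S.φ e l) x‖ ≤ ‖S.φ e l x - S.φ e l y‖) := by
  obtain ⟨δ, hδ0, hδ⟩ := S.exists_norm_fderiv_le (Real.one_lt_exp_iff.2 hε)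
  obtain ⟨K, hK0, hK⟩ := S.exists_global_distortion
  have hconv := S.isConnected_X.isPreconnected.convex_euclideanSpace_fin_one
  refine ⟨δ, hδ0, K⁻¹ * δ, by positivity, fun e l x hx y hy => ⟨fun hxy => ?_, fun hxy => ?_⟩⟩
  · refine norm_fderiv_mul_le_of_segment
      (fun z hz => S.conformalAt_W e l z (S.X_subset_W (hconv.segment_subset hx hy hz)))
      fun z hz => ?_
    have h1 : dist x z ≤ δ := by
      rw [dist_comm, dist_eq_norm]
      exact (norm_sub_le_of_mem_segment hz).trans (by rwa [norm_sub_rev])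
    have h2 := (hδ z (hconv.segment_subset hx hy hz)).2 e l x h1
    rw [Real.exp_neg, inv_mul_le_iff₀ (Real.exp_pos _)]
    exact h2
  · have h1 : K⁻¹ * ‖fderiv ℝ (S.φ e l) x‖ * ‖x - y‖ ≤ ‖S.φ e l x - S.φ e l y‖ :=
      norm_fderiv_mul_le_of_segment
        (fun z hz => S.conformalAt_W e l z (S.X_subset_W (hconv.segment_subset hx hy hz)))
        fun z hz => by
          rw [inv_mul_le_iff₀ hK0]
          exact hK x hx z (hconv.segment_subset hx hy hz) e l
    refine le_trans ?_ h1
    rw [mul_right_comm]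
    exact mul_le_mul_of_nonneg_left hxy.le (by positivity)

lemma isConformalOnBall (e : E) (l : Λ) {x : EuclideanSpace ℝ (Fin q)} {R : ℝ}
    (h : Metric.ball x R ⊆ S.W) : IsConformalOnBall (S.φ e l) x R :=
  ⟨(S.contDiffOn_W e l).mono h, fun z hz => S.conformalAt_W e l z (h hz), (S.injOn_W e l).mono h⟩

/-- Lower bounds for distances of image points, in dimension at least two. -/
lemma exists_le_norm_image_sub_of_two_le (hq : 2 ≤ q) {ε : ℝ} (hε : 0 < ε) :
    ∃ δ > 0, ∃ c > 0, ∀ e l, ∀ x ∈ S.X, ∀ y ∈ S.X,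
      (‖x - y‖ ≤ δ → Real.exp (-ε) * ‖fderiv ℝ (S.φ e l) x‖ * ‖x - y‖ ≤
        ‖S.φ e l x - S.φ e l y‖) ∧
      (δ < ‖x - y‖ → c * ‖fderiv ℝ (S.φ e l) x‖ ≤ ‖S.φ e l x - S.φ e l y‖) := by
  have : NeZero q := ⟨by omega⟩
  have hq0 : (0 : ℝ) < q := by exact_mod_cast (by omega : 0 < q)
  set k := 1 - Real.exp (-(ε / 2)) with hk
  have hk0 : 0 < k := sub_pos.2 (Real.exp_lt_one_iff.2 (by linarith))
  have hk1 : k < 1 := sub_lt_self _ (Real.exp_pos _)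
  set L := Real.exp (min (ε / 2) (k ^ q / (4 * q))) with hL
  have hL1 : 1 < L := Real.one_lt_exp_iff.2 (by positivity)
  have hLk : 2 * q * Real.log L < k ^ q := by
    rw [hL, Real.log_exp]
    have h1 : 2 * q * min (ε / 2) (k ^ q / (4 * q)) ≤ 2 * q * (k ^ q / (4 * q)) :=
      mul_le_mul_of_nonneg_left (min_le_right _ _) (by positivity)
    have h2 : 2 * q * (k ^ q / (4 * q)) = k ^ q / 2 := by field_simp; norm_num
    linarith [pow_pos hk0 q]
  have hLε : L ≤ Real.exp (ε / 2) := Real.exp_le_exp.2 (min_le_left _ _)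
  obtain ⟨δ, hδ0, hδ⟩ := S.exists_norm_fderiv_le hL1
  obtain ⟨K, hK0, hK⟩ := S.exists_global_distortion
  have key : ∀ e l, ∀ x ∈ S.X, ∀ y ∈ S.X, ∀ K d, ‖fderiv ℝ (S.φ e l) x‖ ≤
      K * ‖fderiv ℝ (S.φ e l) y‖ → 0 < d → d ≤ δ → d ≤ ‖x - y‖ →
      2 * (1 - k) / (1 + K) * ‖fderiv ℝ (S.φ e l) x‖ * d ≤ ‖S.φ e l x - S.φ e l y‖ := by
    intro e l x hx y hy K d hK hd hdδ hdxy
    refine (S.isConformalOnBall e l (hδ x hx).1).le_norm_image_sub (by simpa using hq)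
      (S.isConformalOnBall e l (hδ y hy).1)
      ((S.injOn_W e l).mono (Set.union_subset (hδ x hx).1 (hδ y hy).1)) hk0 hk1 hL1.le
      (by simpa using hLk) (fun z hz => (hδ x hx).2 e l z (Metric.ball_subset_closedBall hz))
      (fun z hz => (hδ y hy).2 e l z (Metric.ball_subset_closedBall hz)) hK hd hdδ hdxy
  refine ⟨δ, hδ0, 2 * (1 - k) / (1 + K) * δ, ?_,
    fun e l x hx y hy => ⟨fun hxy => ?_, fun hxy => ?_⟩⟩
  · have : 0 < 1 - k := sub_pos.2 hk1
    positivity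
  · rcases (norm_nonneg (x - y)).eq_or_lt with h0 | h0
    · rw [← h0, mul_zero]; exact norm_nonneg _
    have h1 := key e l x hx y hy L ‖x - y‖ ((hδ y hy).2 e l x (mem_closedBall_iff_norm.2 hxy)) h0
      hxy le_rfl
    refine le_trans ?_ h1
    have h2 : Real.exp (-ε) ≤ 2 * (1 - k) / (1 + L) := by
      rw [hk, sub_sub_cancel, le_div_iff₀ (by linarith)]
      have h3 : Real.exp (-ε) * Real.exp (ε / 2) = Real.exp (-(ε / 2)) := by
        rw [← Real.exp_add]; ring_nf
      nlinarith [Real.exp_pos (-ε)]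
    gcongr
  · have h1 := key e l x hx y hy K δ (hK x hx y hy e l) hδ0 le_rfl hxy.le
    linarith

/-- At small scales, all maps of the system are nearly similarities on `X`: the ratio of distances
is at most `e ^ ε |φ'|`, and, up to distances at which the geometry is no longer under control, at
least `e ^ (-ε) |φ'|`. -/
lemma exists_scale [NeZero q] {ε : ℝ} (hε : 0 < ε) : ∃ r₁ > 0, ∀ e l, ∀ x ∈ S.X, ∀ y ∈ S.X,
    (‖x - y‖ ≤ r₁ → ‖S.φ e l x - S.φ e l y‖ ≤
      Real.exp ε * ‖fderiv ℝ (S.φ e l) x‖ * ‖x - y‖) ∧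
    (∀ r ≤ r₁, ‖S.φ e l x - S.φ e l y‖ ≤ Real.exp (-ε) * ‖fderiv ℝ (S.φ e l) x‖ * r →
      ‖x - y‖ ≤ r) := by
  obtain ⟨δ, hδ0, c, hc0, hlow⟩ : ∃ δ > 0, ∃ c > 0, ∀ e l, ∀ x ∈ S.X, ∀ y ∈ S.X,
      (‖x - y‖ ≤ δ → Real.exp (-ε) * ‖fderiv ℝ (S.φ e l) x‖ * ‖x - y‖ ≤
        ‖S.φ e l x - S.φ e l y‖) ∧
      (δ < ‖x - y‖ → c * ‖fderiv ℝ (S.φ e l) x‖ ≤ ‖S.φ e l x - S.φ e l y‖) := by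
    rcases (NeZero.one_le : 1 ≤ q).eq_or_lt with h1 | h1
    · subst h1
      exact exists_le_norm_image_sub_one S hε
    · exact S.exists_le_norm_image_sub_of_two_le h1 hε
  obtain ⟨δ', hδ'0, hup⟩ := S.exists_norm_fderiv_le (Real.one_lt_exp_iff.2 hε)
  refine ⟨min (δ' / 2) (c / 2), by positivity,
    fun e l x hx y hy => ⟨fun hxy => ?_, fun r hr hxy => ?_⟩⟩
  · have hy' : y ∈ Metric.ball x δ' := by
      rw [mem_ball_iff_norm']
      exact (hxy.trans (min_le_left _ _)).trans_lt (half_lt_self hδ'0)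
    have h1 := (S.isConformalOnBall e l (hup x hx).1).norm_image_sub_le
      (fun z hz => (hup x hx).2 e l z (Metric.ball_subset_closedBall hz)) hy'
    rwa [norm_sub_rev, norm_sub_rev y x] at h1
  · have hD := S.norm_fderiv_pos e l hx
    by_cases hδxy : ‖x - y‖ ≤ δ
    · have h1 := ((hlow e l x hx y hy).1 hδxy).trans hxy
      exact le_of_mul_le_mul_left h1 (by positivity)
    · have h1 := ((hlow e l x hx y hy).2 (not_le.1 hδxy)).trans hxy
      have h2 : Real.exp (-ε) < 1 := Real.exp_lt_one_iff.2 (by linarith)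
      have h3 : c * ‖fderiv ℝ (S.φ e l) x‖ ≤
          Real.exp (-ε) * r * ‖fderiv ℝ (S.φ e l) x‖ := by linarith
      have h4 := le_of_mul_le_mul_right h3 hD
      have h5 : r ≤ c / 2 := hr.trans (min_le_right _ _)
      nlinarith [Real.exp_pos (-ε)]

end RandomConformalIFS

/-! ### The coding map and its measurability -/

lemma measurable_prod_of_continuous {Λ X β : Type*} [MeasurableSpace Λ] [TopologicalSpace X]
    [TopologicalSpace.MetrizableSpace X] [SecondCountableTopology X] [MeasurableSpace X]
    [OpensMeasurableSpace X] [TopologicalSpace β] [TopologicalSpace.PseudoMetrizableSpace β]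
    [MeasurableSpace β] [BorelSpace β] {g : Λ → X → β} (hc : ∀ l, Continuous (g l))
    (hm : ∀ x, Measurable fun l => g l x) : Measurable fun p : Λ × X => g p.1 p.2 :=
  (measurable_uncurry_of_continuous_of_measurable (u := fun x l => g l x) hc hm).comp
    measurable_swap

namespace RandomConformalIFS

variable {Λ : Type*} [MeasurableSpace Λ] {m : Measure Λ} {E : Type*} {q : ℕ}
  (S : RandomConformalIFS Λ m E q)

lemma proj_mem_image (l : Λ) (ω : ℕ → E) (n : ℕ) :
    S.proj l ω ∈ S.wordMap l ω (n + 1) '' S.X := by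
  have h : S.proj l ω ∈ ⋂ n : ℕ, S.wordMap l ω (n + 1) '' S.X := by
    rw [S.iInter_eq_singleton_proj]
    exact rfl
  exact Set.mem_iInter.1 h n

lemma proj_mem_X (l : Λ) (ω : ℕ → E) : S.proj l ω ∈ S.X :=
  (S.wordMap_mapsTo l ω 1).image_subset (S.proj_mem_image l ω 0)

lemma tendsto_wordMap (l : Λ) (ω : ℕ → E) {x : EuclideanSpace ℝ (Fin q)} (hx : x ∈ S.X) :
    Tendsto (fun n => S.wordMap l ω n x) atTop (𝓝 (S.proj l ω)) := by
  obtain ⟨s, -, hs1, hs⟩ := S.contracting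
  obtain ⟨C, hC⟩ := Metric.isBounded_iff.1 S.isCompact_X.isBounded
  rw [← tendsto_add_atTop_iff_nat 1, tendsto_iff_dist_tendsto_zero]
  have hlim : Tendsto (fun n : ℕ => (s : ℝ) ^ (n + 1) * C) atTop (𝓝 0) := by
    simpa using ((tendsto_pow_atTop_nhds_zero_of_lt_one s.2 (by exact_mod_cast hs1)).comp
      (tendsto_add_atTop_nat 1)).mul_const C
  refine squeeze_zero (fun _ => dist_nonneg) (fun n => ?_) hlim
  obtain ⟨y, hy, hyp⟩ := S.proj_mem_image l ω n
  rw [← hyp]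
  refine ((S.wordMap_lipschitz l ω hs (n + 1)).dist_le_mul x hx y hy).trans ?_
  push_cast
  exact mul_le_mul_of_nonneg_left (hC hx hy) (by positivity)

lemma wordMap_succ_eq (l : Λ) (ω : ℕ → E) (n : ℕ) :
    S.wordMap l ω (n + 1) = S.φ (ω 0) l ∘ S.wordMap (S.θ l) (seqShift ω) n := by
  induction n with
  | zero => rfl
  | succ n ih =>
    change S.wordMap l ω (n + 1) ∘ S.φ (ω (n + 1)) (S.θ^[n + 1] l) = _
    rw [ih]
    rfl

/-- The coding map intertwines the skew product with the maps of the system. -/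
lemma proj_eq (l : Λ) (ω : ℕ → E) :
    S.proj l ω = S.φ (ω 0) l (S.proj (S.θ l) (seqShift ω)) := by
  obtain ⟨x, hx⟩ := S.isConnected_X.nonempty
  have h1 := (S.tendsto_wordMap l ω hx).comp (tendsto_add_atTop_nat 1)
  have hc : ContinuousOn (S.φ (ω 0) l) S.W := (S.contDiffOn_W _ _).continuousOn
  have h2 := (hc.continuousAt (S.isOpen_W.mem_nhds (S.X_subset_W (S.proj_mem_X (S.θ l)
    (seqShift ω))))).tendsto.comp (S.tendsto_wordMap (S.θ l) (seqShift ω) hx)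
  refine tendsto_nhds_unique h1 (h2.congr fun n => ?_)
  simp only [Function.comp_apply, S.wordMap_succ_eq l ω n]

lemma measurable_φ_prod (e : E) : Measurable fun p : Λ × S.X => S.φ e p.1 p.2 :=
  measurable_prod_of_continuous (g := fun l (x : S.X) => S.φ e l x)
    (fun l => ((S.contDiffOn_W e l).continuousOn.mono S.X_subset_W).domRestrict)
    fun x => S.measurable_φ e x x.2

/-- At a point of `X`, the derivative depends measurably on the parameter. At interior points, its
norm is a limit of difference quotients along a unit vector. -/
lemma measurable_norm_fderiv [NeZero q] (e : E) {x : EuclideanSpace ℝ (Fin q)} (hx : x ∈ S.X) :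
    Measurable fun l => ‖fderiv ℝ (S.φ e l) x‖ := by
  have hint : ∀ x ∈ interior S.X, Measurable fun l => ‖fderiv ℝ (S.φ e l) x‖ := by
    intro x hx
    obtain ⟨v, hv⟩ := exists_norm_eq (EuclideanSpace ℝ (Fin q)) zero_le_one
    have hv0 : ∀ l, ‖fderiv ℝ (S.φ e l) x v‖ = ‖fderiv ℝ (S.φ e l) x‖ := fun l => by
      rw [(S.isConformalMap_fderiv e l (S.X_subset_W (interior_subset hx))).norm_apply, hv, mul_one]
    simp_rw [← hv0]
    refine Measurable.norm ?_
    have hev : ∀ᶠ n : ℕ in atTop, x + ((n : ℝ) + 1)⁻¹ • v ∈ S.X := by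
      have hlim : Tendsto (fun n : ℕ => x + ((n : ℝ) + 1)⁻¹ • v) atTop (𝓝 x) := by
        have := (tendsto_one_div_add_atTop_nhds_zero_nat (𝕜 := ℝ)).smul_const v
        simpa using this.const_add x
      exact hlim.eventually (mem_interior_iff_mem_nhds.1 hx)
    obtain ⟨n₀, hn₀⟩ := eventually_atTop.1 hev
    refine measurable_of_tendsto_metrizable (f := fun n l => (((n + n₀ : ℕ) : ℝ) + 1) •
      (S.φ e l (x + (((n + n₀ : ℕ) : ℝ) + 1)⁻¹ • v) - S.φ e l x)) (fun n => ?_) ?_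
    · exact ((S.measurable_φ e _ (hn₀ (n + n₀) (by omega))).sub
        (S.measurable_φ e x (interior_subset hx))).const_smul (((n + n₀ : ℕ) : ℝ) + 1)
    · refine tendsto_pi_nhds.2 fun l => ?_
      have hd := (S.conformalAt_W e l x
        (S.X_subset_W (interior_subset hx))).differentiableAt.hasFDerivAt
      have h1 : Tendsto (fun n : ℕ => ((n : ℝ) + 1) •
          (S.φ e l (x + ((n : ℝ) + 1)⁻¹ • v) - S.φ e l x)) atTop (𝓝 (fderiv ℝ (S.φ e l) x v)) := by
        refine hd.lim_real v |>.comp ?_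
        exact tendsto_atTop_add_const_right _ _ tendsto_natCast_atTop_atTop
      exact h1.comp (tendsto_add_atTop_nat n₀)
  have hx' := hx
  rw [S.closure_interior_X] at hx'
  obtain ⟨y, hy, hyx⟩ := mem_closure_iff_seq_limit.1 hx'
  refine measurable_of_tendsto_metrizable (fun n => hint (y n) (hy n))
    (tendsto_pi_nhds.2 fun l => ?_)
  exact (((S.contDiffOn_W e l).continuousOn_fderiv_of_isOpen S.isOpen_W le_rfl).continuousAt
    (S.isOpen_W.mem_nhds (S.X_subset_W hx))).norm.tendsto.comp hyx

lemma measurable_norm_fderiv_prod [NeZero q] (e : E) :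
    Measurable fun p : Λ × S.X => ‖fderiv ℝ (S.φ e p.1) (p.2 : EuclideanSpace ℝ (Fin q))‖ := by
  have hc : ∀ l, Continuous fun x : S.X => ‖fderiv ℝ (S.φ e l) x‖ := fun l =>
    continuousOn_iff_continuous_domRestrict.1 (((S.contDiffOn_W e l).continuousOn_fderiv_of_isOpen
      S.isOpen_W le_rfl).mono S.X_subset_W).norm
  exact measurable_prod_of_continuous (g := fun l (x : S.X) => ‖fderiv ℝ (S.φ e l) x‖) hc
    fun x => S.measurable_norm_fderiv e x.2

lemma norm_fderiv_le {s : ℝ≥0} (hs : ∀ e l, LipschitzOnWith s (S.φ e l) S.X) (e : E) (l : Λ)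
    {x : EuclideanSpace ℝ (Fin q)} (hx : x ∈ S.X) : ‖fderiv ℝ (S.φ e l) x‖ ≤ s := by
  have hint : ∀ x ∈ interior S.X, ‖fderiv ℝ (S.φ e l) x‖ ≤ s := fun x hx =>
    norm_fderiv_le_of_lipschitzOn ℝ (mem_interior_iff_mem_nhds.1 hx) (hs e l)
  have hx' := hx
  rw [S.closure_interior_X] at hx'
  obtain ⟨y, hy, hyx⟩ := mem_closure_iff_seq_limit.1 hx'
  exact le_of_tendsto' ((((S.contDiffOn_W e l).continuousOn_fderiv_of_isOpen S.isOpen_W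
    le_rfl).continuousAt (S.isOpen_W.mem_nhds (S.X_subset_W hx))).norm.tendsto.comp hyx)
    fun n => hint _ (hy n)

variable [MeasurableSpace E]

lemma measurable_seqShift : Measurable (seqShift : (ℕ → E) → ℕ → E) :=
  measurable_pi_lambda _ fun n => measurable_pi_apply (n + 1)

lemma measurable_skew : Measurable S.skew :=
  S.θ.measurable.prodMap measurable_seqShift

variable [Countable E] [DiscreteMeasurableSpace E]

lemma measurable_wordMap (n : ℕ) : Measurable fun p : (Λ × (ℕ → E)) × S.X =>
    S.wordMap p.1.1 p.1.2 n p.2 := by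
  induction n with
  | zero => exact measurable_subtype_coe.comp measurable_snd
  | succ n ih =>
    have h0 : Measurable fun p : E × (Λ × S.X) => S.φ p.1 p.2.1 p.2.2 :=
      measurable_from_prod_countable_right fun e => S.measurable_φ_prod e
    have h1 : Measurable fun p : (Λ × (ℕ → E)) × S.X => S.φ (p.1.2 n) (S.θ^[n] p.1.1) p.2 := by
      have hθ : Measurable (S.θ^[n] : Λ → Λ) := S.θ.measurable.iterate n
      have h3 : Measurable fun p : (Λ × (ℕ → E)) × S.X => p.1.2 n :=
        (measurable_pi_apply n).comp (measurable_snd.comp measurable_fst)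
      have h4 : Measurable fun p : (Λ × (ℕ → E)) × S.X => S.θ^[n] p.1.1 :=
        hθ.comp (measurable_fst.comp measurable_fst)
      exact h0.comp (h3.prodMk (h4.prodMk measurable_snd))
    have h2 : Measurable fun p : (Λ × (ℕ → E)) × S.X =>
        (⟨S.φ (p.1.2 n) (S.θ^[n] p.1.1) p.2, S.mapsTo_X _ _ p.2.2⟩ : S.X) := h1.subtype_mk
    exact ih.comp (measurable_fst.prodMk h2)

lemma measurable_jointProj : Measurable S.jointProj := by
  obtain ⟨x, hx⟩ := S.isConnected_X.nonempty
  refine measurable_of_tendsto_metrizable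
    (f := fun n (p : Λ × (ℕ → E)) => S.wordMap p.1 p.2 n x) (fun n => ?_)
    (tendsto_pi_nhds.2 fun p => S.tendsto_wordMap p.1 p.2 hx)
  exact (S.measurable_wordMap n).comp (measurable_id.prodMk measurable_const : Measurable
    fun p : Λ × (ℕ → E) => (p, (⟨x, hx⟩ : S.X)))

/-- The contraction rate `|(φ_{ω₁}^l)'(π_{θ l}(σ ω))|` at a point `(l, ω)`. -/
noncomputable def rate (p : Λ × (ℕ → E)) : ℝ :=
  ‖fderiv ℝ (S.φ (p.2 0) p.1) (S.proj (S.θ p.1) (seqShift p.2))‖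

lemma measurable_rate [NeZero q] : Measurable S.rate := by
  have h0 : Measurable fun p : E × (Λ × S.X) => ‖fderiv ℝ (S.φ p.1 p.2.1) p.2.2‖ :=
    measurable_from_prod_countable_right fun e => S.measurable_norm_fderiv_prod e
  have h1 : Measurable fun p : Λ × (ℕ → E) =>
      (⟨S.proj (S.θ p.1) (seqShift p.2), S.proj_mem_X _ _⟩ : S.X) :=
    (S.measurable_jointProj.comp S.measurable_skew).subtype_mk
  have h2 : Measurable fun p : Λ × (ℕ → E) => p.2 0 := (measurable_pi_apply 0).comp measurable_snd
  have h3 : Measurable fun p : Λ × (ℕ → E) =>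
      (p.2 0, (p.1, (⟨S.proj (S.θ p.1) (seqShift p.2), S.proj_mem_X _ _⟩ : S.X))) :=
    h2.prodMk (measurable_fst.prodMk h1)
  have h4 : S.rate = (fun p : E × (Λ × S.X) => ‖fderiv ℝ (S.φ p.1 p.2.1) p.2.2‖) ∘
      fun p : Λ × (ℕ → E) =>
        (p.2 0, (p.1, (⟨S.proj (S.θ p.1) (seqShift p.2), S.proj_mem_X _ _⟩ : S.X))) := rfl
  rw [h4]
  exact h0.comp h3

omit [MeasurableSpace E] [Countable E] [DiscreteMeasurableSpace E] in
lemma rate_pos [NeZero q] (p : Λ × (ℕ → E)) : 0 < S.rate p :=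
  S.norm_fderiv_pos _ _ (S.proj_mem_X _ _)

/-- The fiber measures are equivariant, as the base transformation is invertible. -/
lemma ae_map_seqShift [IsProbabilityMeasure m] (κ : Kernel Λ (ℕ → E)) [IsMarkovKernel κ]
    (hμ : MeasurePreserving S.skew (m ⊗ₘ κ) (m ⊗ₘ κ)) :
    ∀ᵐ l ∂m, κ (S.θ l) = (κ l).map seqShift := by
  have hmp : MeasurePreserving S.θ m m := S.ergodic_θ.toMeasurePreserving
  set η : Kernel Λ (ℕ → E) := (κ.comap S.θ.symm S.θ.symm.measurable).map seqShift with hη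
  have hηl : ∀ l, η l = (κ (S.θ.symm l)).map seqShift := fun l => by
    rw [hη, Kernel.map_apply _ measurable_seqShift, Kernel.comap_apply]
  have : IsMarkovKernel η := Kernel.IsMarkovKernel.map _ measurable_seqShift
  have h1 : m ⊗ₘ κ = m ⊗ₘ η := by
    ext s hs
    have hpre : MeasurableSet (S.skew ⁻¹' s) := S.measurable_skew hs
    rw [← hμ.map_eq, Measure.map_apply S.measurable_skew hs, Measure.compProd_apply hpre,
      Measure.compProd_apply hs,
      ← hmp.lintegral_comp_emb S.θ.measurableEmbedding fun l => η l (Prod.mk l ⁻¹' s)]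
    refine lintegral_congr fun l => ?_
    rw [hηl, S.θ.symm_apply_apply, Measure.map_apply measurable_seqShift
      (measurable_prodMk_left hs)]
    rfl
  have h2 := hmp.quasiMeasurePreserving.ae (Kernel.ae_eq_of_compProd_eq h1)
  filter_upwards [h2] with l hl
  rw [hl, hηl, S.θ.symm_apply_apply]

end RandomConformalIFS

/-! ### Birkhoff sums with varying functions -/

lemma tendsto_sub_div_atTop_zero {a : ℕ → ℝ} {L : ℝ}
    (ha : Tendsto (fun n : ℕ => a n / n) atTop (𝓝 L))
    (N : ℕ) : Tendsto (fun n : ℕ => (a n - a (n - N)) / n) atTop (𝓝 0) := by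
  have h1 : Tendsto (fun n : ℕ => a (n - N) / n) atTop (𝓝 L) := by
    rw [← tendsto_add_atTop_iff_nat N]
    have h2 : Tendsto (fun n : ℕ => a n / n * (n / (n + N))) atTop (𝓝 (L * 1)) := by
      refine ha.mul ?_
      exact tendsto_natCast_div_add_atTop (N : ℝ)
    rw [mul_one] at h2
    refine h2.congr' ?_
    filter_upwards [eventually_gt_atTop 0] with n hn
    have : (n : ℝ) ≠ 0 := by exact_mod_cast hn.ne'
    rw [Nat.add_sub_cancel]
    push_cast
    field_simp
  simpa [sub_div] using ha.sub h1

/-- Maker's generalization of the ergodic theorem: if `g j → f` with integrable majorants of the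
errors whose integrals tend to `0`, then the averages of `g (n - 1 - k) ∘ T^k`, `k < n`, tend to
`∫ f`. -/
theorem Ergodic.ae_tendsto_sum_div {Ω : Type*} [MeasurableSpace Ω] {μ : Measure Ω}
    [IsProbabilityMeasure μ] {T : Ω → Ω} (hT : Ergodic T μ) {f : Ω → ℝ} (hfm : Measurable f)
    (hf : Integrable f μ) {g : ℕ → Ω → ℝ} {G : ℕ → Ω → ℝ≥0∞} (hGm : ∀ N, Measurable (G N))
    (hG : ∀ N, ∫⁻ x, G N x ∂μ < ∞) (hG0 : Tendsto (fun N => ∫⁻ x, G N x ∂μ) atTop (𝓝 0))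
    (hgG : ∀ᵐ x ∂μ, ∀ N, ∀ j ≥ N, ENNReal.ofReal |g j x - f x| ≤ G N x) :
    ∀ᵐ x ∂μ, Tendsto (fun n : ℕ => (∑ k ∈ Finset.range n, g (n - 1 - k) (T^[k] x)) / n) atTop
      (𝓝 (∫ x, f x ∂μ)) := by
  have hfin : ∀ᵐ x ∂μ, ∀ N, G N x < ∞ :=
    ae_all_iff.2 fun N => ae_lt_top (hGm N) (hG N).ne
  have hGi : ∀ N, Integrable (fun x => (G N x).toReal) μ := fun N =>
    integrable_toReal_of_lintegral_ne_top (hGm N).aemeasurable (hG N).ne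
  have hGint : Tendsto (fun N => ∫ x, (G N x).toReal ∂μ) atTop (𝓝 0) := by
    have h1 : ∀ N, ∫ x, (G N x).toReal ∂μ = (∫⁻ x, G N x ∂μ).toReal := fun N =>
      integral_toReal (hGm N).aemeasurable (ae_lt_top (hGm N) (hG N).ne)
    simp_rw [h1]
    have h2 := (ENNReal.tendsto_toReal ENNReal.zero_ne_top).comp hG0
    rw [ENNReal.toReal_zero] at h2
    exact h2
  have horb : ∀ᵐ x ∂μ, ∀ k, (∀ N, ∀ j ≥ N, |g j (T^[k] x) - f (T^[k] x)| ≤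
      (G N (T^[k] x)).toReal) := by
    have h1 : ∀ᵐ x ∂μ, ∀ N, ∀ j ≥ N, |g j x - f x| ≤ (G N x).toReal := by
      filter_upwards [hgG, hfin] with x hx hx' N j hj
      exact (ENNReal.ofReal_le_iff_le_toReal (hx' N).ne).1 (hx N j hj)
    exact ae_all_iff.2 fun k => (hT.toMeasurePreserving.iterate k).quasiMeasurePreserving.ae h1
  have hB : ∀ᵐ x ∂μ, ∀ N, Tendsto (fun n => birkhoffAverage ℝ T (fun x => (G N x).toReal) n x) atTop
      (𝓝 (∫ x, (G N x).toReal ∂μ)) := ae_all_iff.2 fun N =>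
    hT.ae_tendsto_birkhoffAverage (hGm N).ennreal_toReal (hGi N)
  filter_upwards [hT.ae_tendsto_birkhoffAverage hfm hf, hB, horb] with x hxf hxG hx
  have havg : ∀ (u : Ω → ℝ) n, birkhoffAverage ℝ T u n x =
      (∑ k ∈ Finset.range n, u (T^[k] x)) / n :=
    fun u n => by rw [birkhoffAverage, birkhoffSum, smul_eq_mul, inv_mul_eq_div]
  simp_rw [havg] at hxf hxG
  suffices hdiff : Tendsto (fun n : ℕ => (∑ k ∈ Finset.range n, g (n - 1 - k) (T^[k] x)) / n -
      (∑ k ∈ Finset.range n, f (T^[k] x)) / n) atTop (𝓝 0) by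
    simpa using hdiff.add hxf
  rw [Metric.tendsto_atTop']
  intro η hη
  obtain ⟨N, hN⟩ := (hGint.eventually (gt_mem_nhds hη)).exists
  set S : ℕ → ℝ := fun n => ∑ k ∈ Finset.range n, (G 0 (T^[k] x)).toReal with hS
  have hlim := (hxG N).add (tendsto_sub_div_atTop_zero (hxG 0) N)
  rw [add_zero] at hlim
  obtain ⟨n₀, hn₀⟩ := eventually_atTop.1 (hlim.eventually (gt_mem_nhds hN))
  refine ⟨n₀, fun n hn => ?_⟩
  refine lt_of_le_of_lt ?_ (hn₀ n hn.le)
  rw [Real.dist_eq, sub_zero, ← sub_div, ← add_div, abs_div, Nat.abs_cast]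
  refine div_le_div_of_nonneg_right ?_ (Nat.cast_nonneg n)
  rw [← Finset.sum_sub_distrib]
  -- the last `N` terms are bounded by means of `G 0`
  calc |∑ k ∈ Finset.range n, (g (n - 1 - k) (T^[k] x) - f (T^[k] x))|
      ≤ ∑ k ∈ Finset.range n, |g (n - 1 - k) (T^[k] x) - f (T^[k] x)| :=
          Finset.abs_sum_le_sum_abs _ _
    _ ≤ ∑ k ∈ Finset.range n, ((G N (T^[k] x)).toReal +
          if k < n - N then 0 else (G 0 (T^[k] x)).toReal) := by
        refine Finset.sum_le_sum fun k hk => ?_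
        split_ifs with hkN
        · rw [add_zero]
          exact hx k N _ (by omega)
        · exact (hx k 0 _ (Nat.zero_le _)).trans (le_add_of_nonneg_left ENNReal.toReal_nonneg)
    _ = _ := by
        rw [Finset.sum_add_distrib]
        congr 1
        have h1 : ∑ k ∈ Finset.range n, (G 0 (T^[k] x)).toReal =
            ∑ k ∈ Finset.range n, (if k < n - N then (G 0 (T^[k] x)).toReal else 0) +
            ∑ k ∈ Finset.range n, (if k < n - N then 0 else (G 0 (T^[k] x)).toReal) := by
          rw [← Finset.sum_add_distrib]
          refine Finset.sum_congr rfl fun k _ => ?_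
          split_ifs <;> simp
        have h2 : ∑ k ∈ Finset.range n, (if k < n - N then (G 0 (T^[k] x)).toReal else 0) =
            ∑ k ∈ Finset.range (n - N), (G 0 (T^[k] x)).toReal := by
          rw [← Finset.sum_filter]
          refine Finset.sum_congr ?_ fun _ _ => rfl
          ext k
          simp only [Finset.mem_filter, Finset.mem_range]
          omega
        rw [h1, h2, add_sub_cancel_left]

/-! ### Interpolation between scales -/

lemma eventually_exists_scale {τ : ℕ → ℝ} (hτ : Tendsto τ atTop atTop) (n₀ : ℕ) :
    ∀ᶠ r in 𝓝[>] (0 : ℝ), ∃ n ≥ n₀, Real.exp (-τ (n + 1)) ≤ r ∧ r < Real.exp (-τ n) := by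
  have h1 : ∀ᶠ r in 𝓝[>] (0 : ℝ), ∀ j ∈ Finset.range (n₀ + 1), r < Real.exp (-τ j) :=
    (Finset.eventually_all _).2 fun j _ =>
        mem_nhdsWithin_of_mem_nhds (Iio_mem_nhds (Real.exp_pos _))
  filter_upwards [h1, self_mem_nhdsWithin] with r hr hr0
  have hr0' : (0 : ℝ) < r := hr0
  have hex : ∃ k, Real.exp (-τ k) ≤ r := by
    obtain ⟨k, hk⟩ := (hτ.eventually_ge_atTop (-Real.log r)).exists
    exact ⟨k, by rw [← Real.le_log_iff_exp_le hr0']; linarith⟩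
  classical
  have hfind := Nat.find_spec hex
  have hlt : n₀ < Nat.find hex := by
    by_contra! hle
    exact absurd hfind (not_le.2 (hr _ (Finset.mem_range.2 (by omega))))
  refine ⟨Nat.find hex - 1, by omega, ?_, ?_⟩
  · rwa [Nat.sub_add_cancel (by omega)]
  · exact not_le.1 (Nat.find_min hex (by omega))

lemma tendsto_atTop_of_mul_le {τ : ℕ → ℝ} {a : ℝ} (ha : 0 < a)
    (hτ : ∀ᶠ n : ℕ in atTop, a * n ≤ τ n) :
    Tendsto τ atTop atTop :=
  tendsto_atTop_mono' atTop hτ (tendsto_natCast_atTop_atTop.const_mul_atTop ha)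

lemma eventually_rpow_le {N : ℝ → ℝ} (hN : Monotone N) {τ : ℕ → ℝ} {a b D : ℝ} (ha : 0 < a)
    (hτ : ∀ᶠ n : ℕ in atTop, a * n ≤ τ n) (hD : 0 ≤ D) (hb : b < D * a)
    (h : ∀ᶠ n : ℕ in atTop, Real.exp (-(b * n)) ≤ N (Real.exp (-τ n))) :
    ∀ᶠ r in 𝓝[>] (0 : ℝ), r ^ D ≤ N r := by
  have h2 : ∀ᶠ n : ℕ in atTop, b * (n + 1) ≤ D * (a * n) := by
    filter_upwards [(tendsto_natCast_atTop_atTop (R := ℝ)).eventually_ge_atTop (b / (D * a - b))]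
      with n hn
    rw [div_le_iff₀ (sub_pos.2 hb)] at hn
    linarith
  obtain ⟨n₀, hn₀⟩ := eventually_atTop.1 (hτ.and (h2.and ((tendsto_add_atTop_nat 1).eventually h)))
  filter_upwards [eventually_exists_scale (tendsto_atTop_of_mul_le ha hτ) n₀, self_mem_nhdsWithin]
    with r ⟨n, hn, hn1, hn2⟩ hr0
  have hr0' : (0 : ℝ) < r := hr0
  obtain ⟨e1, e2, e3⟩ := hn₀ n hn
  calc r ^ D ≤ Real.exp (-τ n) ^ D := Real.rpow_le_rpow hr0'.le hn2.le hD
    _ = Real.exp (-(D * τ n)) := by rw [← Real.exp_mul]; ring_nf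
    _ ≤ Real.exp (-(b * (n + 1 : ℕ))) := by
        rw [Real.exp_le_exp]
        push_cast
        nlinarith [mul_le_mul_of_nonneg_left e1 hD]
    _ ≤ N (Real.exp (-τ (n + 1))) := e3
    _ ≤ N r := hN hn1

lemma eventually_le_rpow {N : ℝ → ℝ} (hN : Monotone N) {τ : ℕ → ℝ} {a b D : ℝ}
    (hτ : Tendsto τ atTop atTop) (hτa : ∀ᶠ n : ℕ in atTop, τ n ≤ a * n) (hD : 0 ≤ D)
    (hb : D * a < b)
    (h : ∀ᶠ n : ℕ in atTop, N (Real.exp (-τ n)) ≤ Real.exp (-(b * n))) :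
    ∀ᶠ r in 𝓝[>] (0 : ℝ), N r ≤ r ^ D := by
  have h2 : ∀ᶠ n : ℕ in atTop, D * (a * (n + 1)) ≤ b * n := by
    filter_upwards [(tendsto_natCast_atTop_atTop (R := ℝ)).eventually_ge_atTop
      (D * a / (b - D * a))] with n hn
    rw [div_le_iff₀ (sub_pos.2 hb)] at hn
    linarith
  obtain ⟨n₀, hn₀⟩ := eventually_atTop.1 (((tendsto_add_atTop_nat 1).eventually hτa).and (h2.and h))
  filter_upwards [eventually_exists_scale hτ n₀, self_mem_nhdsWithin] with r ⟨n, hn, hn1, hn2⟩ hr0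
  obtain ⟨e1, e2, e3⟩ := hn₀ n hn
  calc N r ≤ N (Real.exp (-τ n)) := hN hn2.le
    _ ≤ Real.exp (-(b * n)) := e3
    _ ≤ Real.exp (-(D * τ (n + 1))) := by
        rw [Real.exp_le_exp]
        push_cast at e1
        nlinarith [mul_le_mul_of_nonneg_left e1 hD]
    _ = Real.exp (-τ (n + 1)) ^ D := by rw [← Real.exp_mul]; ring_nf
    _ ≤ r ^ D := Real.rpow_le_rpow (Real.exp_pos _).le hn1 hD

/-! ### Masses of balls along an orbit -/

/-- The mass of the ball of center `p x` and radius `r` for the image under `p` of the measure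
carried by the fibre of `x`. -/
noncomputable def ballMass {Λ Ω V : Type*} [MeasurableSpace Λ] [MeasurableSpace Ω]
    [PseudoMetricSpace V] (κ : Kernel Λ Ω) (p : Λ × Ω → V) (x : Λ × Ω) (r : ℝ) : ℝ :=
  (κ x.1).real {ω | dist (p (x.1, ω)) (p x) ≤ r}

lemma ballMass_mono {Λ Ω V : Type*} [MeasurableSpace Λ] [MeasurableSpace Ω]
    [PseudoMetricSpace V] (κ : Kernel Λ Ω) [IsFiniteKernel κ] (p : Λ × Ω → V) (x : Λ × Ω) :
    Monotone (ballMass κ p x) := fun _ _ h =>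
  measureReal_mono fun _ hω => le_trans hω h

/-- Along almost every orbit, the masses of balls of a fixed radius `r` decay subexponentially. The
set `X` is covered by finitely many balls of radius `r / 2`; the points that lie in one of these
whose mass in their fibre is at most `η` form a set of measure at most a multiple of `η`, and the
Borel-Cantelli lemma applies. -/
lemma ae_eventually_exp_le_ballMass {Λ Ω V : Type*} [MeasurableSpace Λ] [MeasurableSpace Ω]
    [PseudoMetricSpace V] [MeasurableSpace V] [OpensMeasurableSpace V]
    {m : Measure Λ} [IsProbabilityMeasure m]
    {κ : Kernel Λ Ω} [IsMarkovKernel κ] {p : Λ × Ω → V} (hp : Measurable p) {X : Set V}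
    (hX : TotallyBounded X) (hpX : ∀ x, p x ∈ X) {T : Λ × Ω → Λ × Ω}
    (hT : MeasurePreserving T (m ⊗ₘ κ) (m ⊗ₘ κ)) {r ε : ℝ} (hr : 0 < r) (hε : 0 < ε) :
    ∀ᵐ x ∂(m ⊗ₘ κ), ∀ᶠ n : ℕ in atTop, Real.exp (-(ε * n)) ≤ ballMass κ p (T^[n] x) r := by
  obtain ⟨t, ht, hXt⟩ := Metric.totallyBounded_iff.1 hX (r / 2) (half_pos hr)
  let c : Λ → V → ℝ≥0∞ := fun l v => κ l {ω | p (l, ω) ∈ Metric.ball v (r / 2)}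
  have hBm : ∀ v, MeasurableSet (p ⁻¹' Metric.ball v (r / 2)) := fun v => hp measurableSet_ball
  have hcm : ∀ v, Measurable fun l => c l v := fun v =>
    Kernel.measurable_kernel_prodMk_left (hBm v)
  let A : ℝ≥0∞ → V → Set (Λ × Ω) := fun η v => {x | p x ∈ Metric.ball v (r / 2) ∧ c x.1 v ≤ η}
  have hAm : ∀ η v, MeasurableSet (A η v) := fun η v =>
    (hBm v).inter (measurableSet_le ((hcm v).comp measurable_fst) measurable_const)
  have hA : ∀ η v, (m ⊗ₘ κ) (A η v) ≤ η := by
    intro η v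
    rw [Measure.compProd_apply (hAm η v)]
    calc ∫⁻ l, κ l (Prod.mk l ⁻¹' A η v) ∂m ≤ ∫⁻ _, η ∂m := by
          refine lintegral_mono fun l => ?_
          by_cases h : c l v ≤ η
          · exact (measure_mono fun ω hω => hω.1).trans h
          · have : Prod.mk l ⁻¹' A η v = ∅ := Set.eq_empty_of_forall_notMem fun ω hω => h hω.2
            rw [this, measure_empty]
            exact bot_le
      _ = η := by simp
  have hsmall : ∀ η : ℝ, 0 < η → {x | ¬ η ≤ ballMass κ p x r} ⊆
      ⋃ v ∈ t, A (ENNReal.ofReal η) v := by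
    intro η hη x hx
    obtain ⟨v, hv, hxv⟩ := Set.mem_iUnion₂.1 (hXt (hpX x))
    refine Set.mem_iUnion₂.2 ⟨v, hv, hxv, ?_⟩
    have h1 : c x.1 v ≤ κ x.1 {ω | dist (p (x.1, ω)) (p x) ≤ r} := by
      refine measure_mono fun ω hω => ?_
      have h2 := dist_triangle_right (p (x.1, ω)) (p x) v
      have h3 : dist (p (x.1, ω)) v < r / 2 := hω
      have h4 : dist (p x) v < r / 2 := hxv
      exact (by linarith : dist (p (x.1, ω)) (p x) ≤ r)
    refine h1.trans ?_
    rw [← ofReal_measureReal]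
    exact ENNReal.ofReal_le_ofReal (not_le.1 hx).le
  have hsum : ∑' n : ℕ, (m ⊗ₘ κ) {x | ¬ Real.exp (-(ε * n)) ≤ ballMass κ p (T^[n] x) r} ≠ ∞ := by
    have hle : ∀ n : ℕ, (m ⊗ₘ κ) {x | ¬ Real.exp (-(ε * n)) ≤ ballMass κ p (T^[n] x) r} ≤
        ht.toFinset.card * ENNReal.ofReal (Real.exp (-ε)) ^ n := by
      intro n
      have hUm : MeasurableSet (⋃ v ∈ t, A (ENNReal.ofReal (Real.exp (-(ε * n)))) v) :=
        ht.measurableSet_biUnion fun v _ => hAm _ v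
      calc (m ⊗ₘ κ) {x | ¬ Real.exp (-(ε * n)) ≤ ballMass κ p (T^[n] x) r}
          ≤ (m ⊗ₘ κ) (T^[n] ⁻¹' ⋃ v ∈ t, A (ENNReal.ofReal (Real.exp (-(ε * n)))) v) :=
            measure_mono fun x hx => hsmall _ (Real.exp_pos _) hx
        _ = (m ⊗ₘ κ) (⋃ v ∈ t, A (ENNReal.ofReal (Real.exp (-(ε * n)))) v) :=
            (hT.iterate n).measure_preimage hUm.nullMeasurableSet
        _ ≤ ∑ v ∈ ht.toFinset, (m ⊗ₘ κ) (A (ENNReal.ofReal (Real.exp (-(ε * n)))) v) := by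
            have : (⋃ v ∈ t, A (ENNReal.ofReal (Real.exp (-(ε * n)))) v) =
                ⋃ v ∈ ht.toFinset, A (ENNReal.ofReal (Real.exp (-(ε * n)))) v := by simp
            rw [this]
            exact measure_biUnion_finset_le _ _
        _ ≤ ∑ _v ∈ ht.toFinset, ENNReal.ofReal (Real.exp (-(ε * n))) :=
            Finset.sum_le_sum fun v _ => hA _ v
        _ = _ := by
            rw [Finset.sum_const, nsmul_eq_mul, ← ENNReal.ofReal_pow (Real.exp_pos _).le,
              ← Real.exp_nat_mul]
            ring_nf
    refine ne_top_of_le_ne_top ?_ (ENNReal.tsum_le_tsum hle)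
    rw [ENNReal.tsum_mul_left, ENNReal.tsum_geometric]
    refine ENNReal.mul_ne_top (ENNReal.natCast_ne_top _) (ENNReal.inv_ne_top.2 ?_)
    exact (tsub_pos_of_lt (ENNReal.ofReal_lt_one.2 (Real.exp_lt_one_iff.2 (by linarith)))).ne'
  filter_upwards [ae_eventually_notMem hsum] with x hx
  filter_upwards [hx] with n hn
  exact not_not.1 hn

/-- Summation along an orbit of an inequality between `F (n + 1)` and `F n ∘ T`. -/
lemma sum_add_le_of_forall_add_le {X : Type*} {T : X → X} {g F : ℕ → X → ℝ} {x : X}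
    (h : ∀ k n, g n (T^[k] x) + F n (T^[k + 1] x) ≤ F (n + 1) (T^[k] x)) (n : ℕ) :
    ∑ k ∈ Finset.range n, g (n - 1 - k) (T^[k] x) + F 0 (T^[n] x) ≤ F n x := by
  induction n generalizing x with
  | zero => simp
  | succ n ih =>
    have h1 := ih (x := T x) fun k n => h (k + 1) n
    have h2 := h 0 n
    rw [Finset.sum_range_succ']
    have h3 : ∑ k ∈ Finset.range n, g (n + 1 - 1 - (k + 1)) (T^[k + 1] x) =
        ∑ k ∈ Finset.range n, g (n - 1 - k) (T^[k] (T x)) :=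
      Finset.sum_congr rfl fun k _ => by
        rw [Function.iterate_succ_apply]
        congr 1
        omega
    rw [h3]
    simp only [Function.iterate_succ_apply, Function.iterate_zero, id_eq, Nat.add_sub_cancel,
      Nat.sub_zero, zero_add] at h1 h2 ⊢
    linarith

namespace RandomConformalIFS

variable {Λ : Type*} [MeasurableSpace Λ] {m : Measure Λ} {E : Type*} {q : ℕ}
  (S : RandomConformalIFS Λ m E q)

/-- The radius `r₀ ∏_{k < n} (e ^ η |φ'|) ∘ T^k`, where `T` is the skew product: up to the
distortion `e ^ (n η)`, the size of the image of a ball of radius `r₀` under a composition of `n`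
maps. -/
noncomputable def radius (η r₀ : ℝ) : ℕ → Λ × (ℕ → E) → ℝ
  | 0, _ => r₀
  | n + 1, x => Real.exp η * S.rate x * radius η r₀ n (S.skew x)

lemma radius_pos [NeZero q] {η r₀ : ℝ} (hr : 0 < r₀) (n : ℕ) (x : Λ × (ℕ → E)) :
    0 < S.radius η r₀ n x := by
  induction n generalizing x with
  | zero => exact hr
  | succ n ih => exact mul_pos (mul_pos (Real.exp_pos _) (S.rate_pos x)) (ih _)

lemma rate_le {s : ℝ≥0} (hs : ∀ e l, LipschitzOnWith s (S.φ e l) S.X) (x : Λ × (ℕ → E)) :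
    S.rate x ≤ s := S.norm_fderiv_le hs _ _ (S.proj_mem_X _ _)

lemma radius_le [NeZero q] {s : ℝ≥0} (hs : ∀ e l, LipschitzOnWith s (S.φ e l) S.X) {η r₀ : ℝ}
    (hr : 0 < r₀) (n : ℕ) (x : Λ × (ℕ → E)) : S.radius η r₀ n x ≤ r₀ * (Real.exp η * s) ^ n := by
  induction n generalizing x with
  | zero => simp [radius]
  | succ n ih =>
    calc S.radius η r₀ (n + 1) x = Real.exp η * S.rate x * S.radius η r₀ n (S.skew x) := rfl
      _ ≤ Real.exp η * s * (r₀ * (Real.exp η * s) ^ n) := by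
          refine mul_le_mul ?_ (ih _) (S.radius_pos hr n _).le (by positivity)
          exact mul_le_mul_of_nonneg_left (S.rate_le hs x) (Real.exp_pos _).le
      _ = _ := by ring

lemma neg_log_radius [NeZero q] {η r₀ : ℝ} (hr : 0 < r₀) (n : ℕ) (x : Λ × (ℕ → E)) :
    -Real.log (S.radius η r₀ n x) =
      -Real.log r₀ + birkhoffSum S.skew (fun y => -Real.log (S.rate y)) n x - η * n := by
  induction n generalizing x with
  | zero => simp [radius]
  | succ n ih =>
    have h1 : S.radius η r₀ (n + 1) x = Real.exp η * S.rate x * S.radius η r₀ n (S.skew x) := rfl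
    have h2 := ih (S.skew x)
    rw [h1, Real.log_mul (mul_pos (Real.exp_pos _) (S.rate_pos x)).ne' (S.radius_pos hr n _).ne',
      Real.log_mul (Real.exp_pos _).ne' (S.rate_pos x).ne', Real.log_exp, birkhoffSum_succ']
    push_cast
    linarith

variable [MeasurableSpace E] {κ : Kernel Λ (ℕ → E)} [IsMarkovKernel κ]

/-- The points at which the fibre measures are equivariant and charge all balls. -/
structure IsRegularPoint (κ : Kernel Λ (ℕ → E)) (x : Λ × (ℕ → E)) : Prop where
  map_seqShift : κ (S.θ x.1) = (κ x.1).map seqShift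
  pos₁ : ∀ r > 0, 0 < κ x.1 {ω | ω 0 = x.2 0 ∧ dist (S.jointProj (x.1, ω)) (S.jointProj x) ≤ r}
  pos₂ : ∀ r > 0, 0 < κ x.1 {ω | ω 0 = x.2 0 ∧
    dist ((S.jointProj ∘ S.skew) (x.1, ω)) ((S.jointProj ∘ S.skew) x) ≤ r}

/-- The difference, at a point `x`, of the values of `log letterRatio` for the coding map of the
shifted sequence and for the coding map, at corresponding radii. Its limit is the difference of the
information functions of the first letter given the value of the coding map and given that of the
coding map of the shifted sequence. -/
noncomputable def gain (κ : Kernel Λ (ℕ → E)) (η r₀ : ℝ) (n : ℕ) (x : Λ × (ℕ → E)) : ℝ :=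
  Real.log (letterRatio κ (fun ω => ω 0) (S.jointProj ∘ S.skew) x (S.radius η r₀ n (S.skew x))) -
    Real.log (letterRatio κ (fun ω => ω 0) S.jointProj x (S.radius η r₀ (n + 1) x))

lemma log_letterRatio {p : Λ × (ℕ → E) → EuclideanSpace ℝ (Fin q)} {x : Λ × (ℕ → E)} {r : ℝ}
    (h : 0 < κ x.1 {ω | ω 0 = x.2 0 ∧ dist (p (x.1, ω)) (p x) ≤ r}) :
    Real.log (letterRatio κ (fun ω => ω 0) p x r) =
      Real.log ((κ x.1).real {ω | ω 0 = x.2 0 ∧ dist (p (x.1, ω)) (p x) ≤ r}) -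
      Real.log (ballMass κ p x r) := by
  have h1 := ENNReal.toReal_pos h.ne' (measure_ne_top _ _)
  have h2 := ENNReal.toReal_pos (h.trans_le (measure_mono fun _ h => h.2)).ne' (measure_ne_top _ _)
  exact Real.log_div h1.ne' h2.ne'

variable [Countable E] [DiscreteMeasurableSpace E]

variable {S} in
omit [IsMarkovKernel κ] in
lemma IsRegularPoint.ballMass_eq {x : Λ × (ℕ → E)} (hx : S.IsRegularPoint κ x) (r : ℝ) :
    ballMass κ (S.jointProj ∘ S.skew) x r = ballMass κ S.jointProj (S.skew x) r := by
  have hm : MeasurableSet {ω | dist (S.jointProj (S.θ x.1, ω)) (S.jointProj (S.skew x)) ≤ r} :=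
    measurableSet_le ((S.measurable_jointProj.comp measurable_prodMk_left).dist measurable_const)
      measurable_const
  have h1 : ballMass κ S.jointProj (S.skew x) r =
      (κ (S.θ x.1)).real {ω | dist (S.jointProj (S.θ x.1, ω)) (S.jointProj (S.skew x)) ≤ r} := rfl
  rw [h1, hx.map_seqShift, map_measureReal_apply measurable_seqShift hm]
  rfl

omit [MeasurableSpace E] [Countable E] [DiscreteMeasurableSpace E] in
lemma jointProj_eq (x : Λ × (ℕ → E)) :
    S.jointProj x = S.φ (x.2 0) x.1 ((S.jointProj ∘ S.skew) x) := S.proj_eq x.1 x.2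

/-- On the cylinder of the first letter, the preimage under the shift of the ball of radius `r`
around the shifted point is contained in the ball of radius `e ^ ε |φ'| r`. -/
lemma gain_add_log_ballMass_le [NeZero q] {ε r₀ r₁ : ℝ}
    (hr₁ : ∀ e l, ∀ x ∈ S.X, ∀ y ∈ S.X, ‖x - y‖ ≤ r₁ → ‖S.φ e l x - S.φ e l y‖ ≤
      Real.exp ε * ‖fderiv ℝ (S.φ e l) x‖ * ‖x - y‖) {x : Λ × (ℕ → E)}
    (hx : S.IsRegularPoint κ x) (hr₀ : 0 < r₀) {n : ℕ} (hr : S.radius ε r₀ n (S.skew x) ≤ r₁) :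
    S.gain κ ε r₀ n x + Real.log (ballMass κ S.jointProj (S.skew x) (S.radius ε r₀ n (S.skew x))) ≤
      Real.log (ballMass κ S.jointProj x (S.radius ε r₀ (n + 1) x)) := by
  have h2 := hx.pos₂ _ (S.radius_pos (η := ε) hr₀ n (S.skew x))
  rw [gain, log_letterRatio (hx.pos₁ _ (S.radius_pos (η := ε) hr₀ (n + 1) x)), log_letterRatio h2,
    hx.ballMass_eq]
  have hsub : {ω | ω 0 = x.2 0 ∧ dist ((S.jointProj ∘ S.skew) (x.1, ω)) ((S.jointProj ∘ S.skew) x) ≤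
      S.radius ε r₀ n (S.skew x)} ⊆
      {ω | ω 0 = x.2 0 ∧ dist (S.jointProj (x.1, ω)) (S.jointProj x) ≤
          S.radius ε r₀ (n + 1) x} := by
    rintro ω ⟨h0, hd⟩
    refine ⟨h0, ?_⟩
    rw [S.jointProj_eq x, S.jointProj_eq (x.1, ω), dist_comm, dist_eq_norm]
    rw [dist_comm, dist_eq_norm] at hd
    simp only [h0]
    have h3 := hr₁ (x.2 0) x.1 _ (S.proj_mem_X (S.skew x).1 (S.skew x).2) _
      (S.proj_mem_X (S.skew (x.1, ω)).1 (S.skew (x.1, ω)).2) (hd.trans hr)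
    refine h3.trans ?_
    exact mul_le_mul_of_nonneg_left hd (by positivity)
  have hpos : 0 < (κ x.1).real _ := ENNReal.toReal_pos h2.ne' (measure_ne_top _ _)
  have hlog := Real.log_le_log hpos (measureReal_mono hsub)
  linarith

/-- On the cylinder of the first letter, the ball of radius `e ^ ε |φ'| r` is contained in the
preimage under the shift of the ball of radius `r` around the shifted point. Here `ε` is typically
negative. -/
lemma log_ballMass_le_gain_add [NeZero q] {ε r₀ r₁ : ℝ}
    (hr₁ : ∀ e l, ∀ x ∈ S.X, ∀ y ∈ S.X, ∀ r ≤ r₁, ‖S.φ e l x - S.φ e l y‖ ≤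
      Real.exp ε * ‖fderiv ℝ (S.φ e l) x‖ * r → ‖x - y‖ ≤ r) {x : Λ × (ℕ → E)}
    (hx : S.IsRegularPoint κ x) (hr₀ : 0 < r₀) {n : ℕ} (hr : S.radius ε r₀ n (S.skew x) ≤ r₁) :
    Real.log (ballMass κ S.jointProj x (S.radius ε r₀ (n + 1) x)) ≤ S.gain κ ε r₀ n x +
      Real.log (ballMass κ S.jointProj (S.skew x) (S.radius ε r₀ n (S.skew x))) := by
  have h1 := hx.pos₁ _ (S.radius_pos (η := ε) hr₀ (n + 1) x)
  rw [gain, log_letterRatio h1,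
    log_letterRatio (hx.pos₂ _ (S.radius_pos (η := ε) hr₀ n (S.skew x))),
    hx.ballMass_eq]
  have hsub : {ω | ω 0 = x.2 0 ∧ dist (S.jointProj (x.1, ω)) (S.jointProj x) ≤
      S.radius ε r₀ (n + 1) x} ⊆ {ω | ω 0 = x.2 0 ∧
        dist ((S.jointProj ∘ S.skew) (x.1, ω)) ((S.jointProj ∘ S.skew) x) ≤
          S.radius ε r₀ n (S.skew x)} := by
    rintro ω ⟨h0, hd⟩
    refine ⟨h0, ?_⟩
    rw [S.jointProj_eq x, S.jointProj_eq (x.1, ω), dist_comm, dist_eq_norm] at hd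
    rw [dist_comm, dist_eq_norm]
    simp only [h0] at hd
    exact hr₁ (x.2 0) x.1 _ (S.proj_mem_X (S.skew x).1 (S.skew x).2) _
      (S.proj_mem_X (S.skew (x.1, ω)).1 (S.skew (x.1, ω)).2) _ hr hd
  have hpos : 0 < (κ x.1).real _ := ENNReal.toReal_pos h1.ne' (measure_ne_top _ _)
  have hlog := Real.log_le_log hpos (measureReal_mono hsub)
  linarith

end RandomConformalIFS

/-! ### Dimensions of an image measure -/

/-- A version of `hasDim_of_local_dim` for an image measure, in terms of almost every point of the
domain. Radii are first restricted to a sequence, so that the condition on points is measurable. -/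
lemma hasDim_map_of_ae {Ω V : Type*} [MeasurableSpace Ω] [MetricSpace V] [MeasurableSpace V]
    [BorelSpace V] [SecondCountableTopology V] {P : Measure Ω} [IsProbabilityMeasure P] {f : Ω → V}
    (hf : Measurable f) {d : ℝ} (hd : 0 ≤ d)
    (h : ∀ᵐ ω ∂P, ∀ η > 0, ∀ᶠ r in 𝓝[>] (0 : ℝ),
      r ^ (d + η) ≤ P.real {ω' | dist (f ω') (f ω) ≤ r} ∧
        P.real {ω' | dist (f ω') (f ω) ≤ r} ≤ r ^ (d - η)) :
    HasHausdorffDim (P.map f) (d : EReal) ∧ HasPackingDim (P.map f) (d : EReal) := by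
  have : IsProbabilityMeasure (P.map f) := Measure.isProbabilityMeasure_map hf.aemeasurable
  set N : V → ℝ → ℝ := fun y r => (P.map f).real (Metric.closedBall y r) with hN
  have hNf : ∀ ω r, N (f ω) r = P.real {ω' | dist (f ω') (f ω) ≤ r} := fun ω r => by
    simp only [hN]
    rw [map_measureReal_apply hf measurableSet_closedBall]
    rfl
  have hNmono : ∀ y, Monotone (N y) := fun y r s hrs =>
    measureReal_mono (Metric.closedBall_subset_closedBall hrs)
  have hNm : ∀ r, Measurable fun y => N y r := fun r => by
    have : MeasurableSet {z : V × V | dist z.2 z.1 ≤ r} :=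
      measurableSet_le (measurable_snd.dist measurable_fst) measurable_const
    exact (measurable_measure_prodMk_left this).ennreal_toReal
  set ε : ℕ → ℝ := fun j => 1 / ((j : ℝ) + 1) with hε
  have hε0 : ∀ j, 0 < ε j := fun j => Nat.one_div_pos_of_nat
  set Q : V → Prop := fun y => ∀ j : ℕ, ∀ᶠ n : ℕ in atTop,
    Real.exp (-((d + ε j) * n)) ≤ N y (Real.exp (-(n : ℝ))) ∧
      N y (Real.exp (-(n : ℝ))) ≤ Real.exp (-((d - ε j) * n)) with hQ
  have hQm : MeasurableSet {y | Q y} := by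
    have hQeq : {y | Q y} = ⋂ j : ℕ, ⋃ n₀ : ℕ, ⋂ n : ℕ, ⋂ _ : n ≥ n₀,
        {y | Real.exp (-((d + ε j) * n)) ≤ N y (Real.exp (-(n : ℝ)))} ∩
          {y | N y (Real.exp (-(n : ℝ))) ≤ Real.exp (-((d - ε j) * n))} := by
      ext y
      simp only [hQ, eventually_atTop, Set.mem_iInter, Set.mem_iUnion, Set.mem_inter_iff]
      rfl
    rw [hQeq]
    refine MeasurableSet.iInter fun j => MeasurableSet.iUnion fun n₀ =>
        MeasurableSet.iInter fun n =>
      MeasurableSet.iInter fun _ => ?_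
    exact (measurableSet_le measurable_const (hNm _)).inter
      (measurableSet_le (hNm _) measurable_const)
  have hexp : Tendsto (fun n : ℕ => Real.exp (-(n : ℝ))) atTop (𝓝[>] 0) :=
    tendsto_nhdsWithin_iff.2 ⟨Real.tendsto_exp_neg_atTop_nhds_zero.comp tendsto_natCast_atTop_atTop,
      Eventually.of_forall fun n => Real.exp_pos _⟩
  have hQae : ∀ᵐ y ∂P.map f, Q y := by
    rw [ae_map_iff hf.aemeasurable hQm]
    filter_upwards [h] with ω hω j
    filter_upwards [hexp.eventually (hω (ε j) (hε0 j))] with n hn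
    rw [hNf]
    rw [← Real.exp_mul, ← Real.exp_mul] at hn
    convert hn using 3 <;> ring
  refine hasDim_of_local_dim ?_
  filter_upwards [hQae] with y hy η hη
  obtain ⟨j, hj⟩ := exists_nat_one_div_lt hη
  have hid : ∀ᶠ n : ℕ in atTop, (1 : ℝ) * n ≤ n := Eventually.of_forall fun n => by rw [one_mul]
  have hid' : ∀ᶠ n : ℕ in atTop, (n : ℝ) ≤ 1 * n := Eventually.of_forall fun n => by rw [one_mul]
  have h1 : ∀ᶠ r in 𝓝[>] (0 : ℝ), r ^ (d + η) ≤ N y r :=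
    eventually_rpow_le (hNmono y) one_pos hid (by linarith) (b := d + ε j) (by linarith)
      ((hy j).mono fun n hn => hn.1)
  have h2 : ∀ᶠ r in 𝓝[>] (0 : ℝ), N y r ≤ r ^ (d - η) := by
    rcases le_or_gt 0 (d - η) with h0 | h0
    · exact eventually_le_rpow (hNmono y) tendsto_natCast_atTop_atTop hid' h0 (b := d - ε j)
        (by linarith) ((hy j).mono fun n hn => hn.2)
    · filter_upwards [Ioo_mem_nhdsGT one_pos] with r hr
      exact measureReal_le_one.trans
        (Real.one_le_rpow_of_pos_of_le_one_of_nonpos hr.1 hr.2.le h0.le)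
  filter_upwards [h1, h2, self_mem_nhdsWithin] with r hr1 hr2 hr0
  have hr0' : (0 : ℝ) < r := hr0
  rw [ENNReal.ofReal_rpow_of_pos hr0', ENNReal.ofReal_rpow_of_pos hr0',
    ← ofReal_measureReal (μ := P.map f)]
  exact ⟨ENNReal.ofReal_le_ofReal hr1, ENNReal.ofReal_le_ofReal hr2⟩

/-! ### Masses of balls along a typical orbit -/

/-- The conditional entropy of the first letter given the base point and the value of `p`. -/
noncomputable def letterEntropy {Λ E V : Type*} [MeasurableSpace Λ] [MeasurableSpace E]
    [MeasurableSpace V] (m : Measure Λ) (κ : Kernel Λ (ℕ → E)) (p : Λ × (ℕ → E) → V) : ℝ≥0∞ :=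
  condEntropy (m ⊗ₘ κ) (firstLetterPartition Λ E)
    (baseSigmaAlgebra Λ E ⊔ MeasurableSpace.comap p inferInstance)

lemma letterEntropy_lt_top {Λ E V : Type*} [MeasurableSpace Λ] [Countable E] [MeasurableSpace E]
    [DiscreteMeasurableSpace E] [MetricSpace V] [MeasurableSpace V] [BorelSpace V]
    [SecondCountableTopology V] [HasBesicovitchCovering V] {m : Measure Λ} [IsProbabilityMeasure m]
    {κ : Kernel Λ (ℕ → E)} [IsMarkovKernel κ]
    (hent : condEntropy (m ⊗ₘ κ) (firstLetterPartition Λ E) (baseSigmaAlgebra Λ E) < ∞)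
    {p : Λ × (ℕ → E) → V} (hp : Measurable p) : letterEntropy m κ p < ∞ :=
  (exists_info_limit (m := m) (κ := κ) (a := fun ω : ℕ → E => ω 0) (measurable_pi_apply 0) hp hent
    (δ := fun _ => 0) (fun _ => zero_le_one) tendsto_const_nhds).1

namespace RandomConformalIFS

variable {Λ : Type*} [MeasurableSpace Λ] {m : Measure Λ} [IsProbabilityMeasure m] {E : Type*}
  [Countable E] [MeasurableSpace E] [DiscreteMeasurableSpace E] {q : ℕ} [NeZero q]
  (S : RandomConformalIFS Λ m E q) {κ : Kernel Λ (ℕ → E)} [IsMarkovKernel κ]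

omit [NeZero q] in
lemma ae_isRegularPoint (hμ : MeasurePreserving S.skew (m ⊗ₘ κ) (m ⊗ₘ κ)) :
    ∀ᵐ x ∂(m ⊗ₘ κ), ∀ k, S.IsRegularPoint κ (S.skew^[k] x) := by
  have h1 : ∀ᵐ x ∂(m ⊗ₘ κ), κ (S.θ x.1) = (κ x.1).map seqShift := by
    have h2 : MeasurePreserving Prod.fst (m ⊗ₘ κ) m := ⟨measurable_fst, Measure.fst_compProd m κ⟩
    exact h2.quasiMeasurePreserving.ae (S.ae_map_seqShift κ hμ)
  have h3 : ∀ᵐ x ∂(m ⊗ₘ κ), S.IsRegularPoint κ x := by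
    filter_upwards [h1, ae_compProd_letter_pos (m := m) (κ := κ) (a := fun ω : ℕ → E => ω 0)
      (measurable_pi_apply 0) S.measurable_jointProj,
      ae_compProd_letter_pos (m := m) (κ := κ) (a := fun ω : ℕ → E => ω 0)
      (measurable_pi_apply 0) (S.measurable_jointProj.comp S.measurable_skew)] with x e1 e2 e3
    exact ⟨e1, e2, e3⟩
  exact ae_all_iff.2 fun k => (hμ.iterate k).quasiMeasurePreserving.ae h3

variable (hμ : Ergodic S.skew (m ⊗ₘ κ))
  (hent : condEntropy (m ⊗ₘ κ) (firstLetterPartition Λ E) (baseSigmaAlgebra Λ E) < ∞)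

include hμ hent in
lemma ae_tendsto_sum_gain {s : ℝ≥0} (hs0 : 0 < s) (hs : ∀ e l, LipschitzOnWith s (S.φ e l) S.X)
    {η r₀ : ℝ} (hr : 0 < r₀) (hr1 : r₀ ≤ 1 / 2) (hη : Real.exp η * s < 1) :
    ∀ᵐ x ∂(m ⊗ₘ κ), Tendsto (fun n : ℕ =>
      (∑ k ∈ Finset.range n, S.gain κ η r₀ (n - 1 - k) (S.skew^[k] x)) / n) atTop
      (𝓝 ((letterEntropy m κ S.jointProj).toReal -
        (letterEntropy m κ (S.jointProj ∘ S.skew)).toReal)) := by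
  set c := Real.exp η * s with hc
  have hc0 : 0 < c := mul_pos (Real.exp_pos _) (by exact_mod_cast hs0)
  set δ : ℕ → ℝ := fun n => 2 * r₀ * c ^ n with hδ
  have hδ1 : ∀ n, δ n ≤ 1 := fun n => by
    have := pow_le_one₀ (n := n) hc0.le hη.le
    simp only [hδ]
    nlinarith
  have hδ0 : Tendsto δ atTop (𝓝 0) := by
    simpa using (tendsto_pow_atTop_nhds_zero_of_lt_one hc0.le hη).const_mul (2 * r₀)
  obtain ⟨-, I₁, hI₁m, hI₁, hI₁int, G₁, hG₁m, hG₁, hG₁0, hb₁⟩ := exists_info_limit (m := m) (κ := κ)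
    (a := fun ω : ℕ → E => ω 0) (measurable_pi_apply 0) S.measurable_jointProj hent hδ1 hδ0
  obtain ⟨-, I₂, hI₂m, hI₂, hI₂int, G₂, hG₂m, hG₂, hG₂0, hb₂⟩ := exists_info_limit (m := m) (κ := κ)
    (a := fun ω : ℕ → E => ω 0) (measurable_pi_apply 0)
    (S.measurable_jointProj.comp S.measurable_skew) hent hδ1 hδ0
  have hint : ∫ x, (I₁ x - I₂ x) ∂(m ⊗ₘ κ) = (letterEntropy m κ S.jointProj).toReal -
      (letterEntropy m κ (S.jointProj ∘ S.skew)).toReal := by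
    rw [integral_sub hI₁ hI₂, hI₁int, hI₂int]
    rfl
  rw [← hint]
  have hadd : ∀ n, ∫⁻ x, (G₁ n x + G₂ n x) ∂(m ⊗ₘ κ) =
      ∫⁻ x, G₁ n x ∂(m ⊗ₘ κ) + ∫⁻ x, G₂ n x ∂(m ⊗ₘ κ) := fun n => lintegral_add_left (hG₁m n) _
  refine hμ.ae_tendsto_sum_div (hI₁m.sub hI₂m) (hI₁.sub hI₂) (G := fun n x => G₁ n x + G₂ n x)
    (fun n => (hG₁m n).add (hG₂m n)) (fun n => ?_) ?_ ?_
  · rw [hadd]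
    exact ENNReal.add_lt_top.2 ⟨hG₁ n, hG₂ n⟩
  · simp_rw [hadd]
    simpa using hG₁0.add hG₂0
  · filter_upwards [hb₁, hb₂] with x h₁ h₂ N j hj
    have hrad : ∀ i ≥ N, ∀ y, S.radius η r₀ i y ∈ Set.Ioo 0 (δ N) := fun i hi y => by
      refine ⟨S.radius_pos hr i y, (S.radius_le hs hr i y).trans_lt ?_⟩
      have h3 : c ^ i ≤ c ^ N := pow_le_pow_of_le_one hc0.le hη.le hi
      have h4 : 0 < c ^ N := pow_pos hc0 N
      simp only [hδ]
      nlinarith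
    have h3 := h₁ N _ (hrad (j + 1) (by omega) x)
    have h4 := h₂ N _ (hrad j hj (S.skew x))
    refine le_trans ?_ (add_le_add h3 h4)
    rw [← ENNReal.ofReal_add (abs_nonneg _) (abs_nonneg _)]
    refine ENNReal.ofReal_le_ofReal ?_
    rw [gain]
    refine le_trans (le_of_eq ?_) (abs_sub _ _)
    congr 1
    rw [Pi.sub_apply]
    ring

include hμ hent in
/-- The lower bound for the mass of the balls along an orbit. -/
lemma ae_eventually_exp_le_ballMass_radius {s : ℝ≥0} (hs0 : 0 < s)
    (hs : ∀ e l, LipschitzOnWith s (S.φ e l) S.X) {ε : ℝ} (hε : 0 < ε) (hεs : Real.exp ε * s < 1) :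
    ∃ r₀, 0 < r₀ ∧ r₀ ≤ 1 ∧ ∀ᵐ x ∂(m ⊗ₘ κ), ∀ᶠ n : ℕ in atTop,
      Real.exp (-(((letterEntropy m κ (S.jointProj ∘ S.skew)).toReal -
        (letterEntropy m κ S.jointProj).toReal + 2 * ε) * n)) ≤
        ballMass κ S.jointProj x (S.radius ε r₀ n x) := by
  obtain ⟨r₁, hr₁0, hr₁⟩ := S.exists_scale hε
  set r₀ := min r₁ (1 / 2) with hr₀
  have hr₀0 : 0 < r₀ := lt_min hr₁0 (by norm_num)
  refine ⟨r₀, hr₀0, (min_le_right _ _).trans (by norm_num), ?_⟩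
  have hle : ∀ n x, S.radius ε r₀ n x ≤ r₁ := fun n x => by
    refine (S.radius_le hs hr₀0 n x).trans ((mul_le_of_le_one_right hr₀0.le
      (pow_le_one₀ (by positivity) hεs.le)).trans (min_le_left _ _))
  filter_upwards [S.ae_tendsto_sum_gain hμ hent hs0 hs hr₀0 (min_le_right _ _) hεs,
    S.ae_isRegularPoint hμ.toMeasurePreserving,
    ae_eventually_exp_le_ballMass S.measurable_jointProj S.isCompact_X.totallyBounded
      (fun x => S.proj_mem_X x.1 x.2) hμ.toMeasurePreserving hr₀0 hε] with x h1 h2 h3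
  filter_upwards [h1.eventually (lt_mem_nhds (sub_lt_self _ hε)), h3, eventually_gt_atTop 0]
    with n hn1 hn2 hn0
  have hn0' : (0 : ℝ) < n := by exact_mod_cast hn0
  rw [lt_div_iff₀ hn0'] at hn1
  have h4 := sum_add_le_of_forall_add_le (T := S.skew) (g := S.gain κ ε r₀)
    (F := fun n x => Real.log (ballMass κ S.jointProj x (S.radius ε r₀ n x)))
    (x := x) (fun k n => by
      rw [Function.iterate_succ_apply']
      exact S.gain_add_log_ballMass_le (fun e l x hx y hy => (hr₁ e l x hx y hy).1) (h2 k) hr₀0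
        (hle _ _)) n
  have h5 : -(ε * n) ≤ Real.log (ballMass κ S.jointProj (S.skew^[n] x) r₀) :=
    (Real.le_log_iff_exp_le ((Real.exp_pos _).trans_le hn2)).2 hn2
  have hpos : 0 < ballMass κ S.jointProj x (S.radius ε r₀ n x) :=
    ENNReal.toReal_pos (((h2 0).pos₁ _ (S.radius_pos hr₀0 n x)).trans_le
      (measure_mono fun _ h => h.2)).ne' (measure_ne_top _ _)
  rw [← Real.le_log_iff_exp_le hpos]
  refine le_trans ?_ h4
  have h6 : S.radius ε r₀ 0 (S.skew^[n] x) = r₀ := rfl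
  simp only [h6]
  linarith

include hμ hent in
/-- The upper bound for the mass of the balls along an orbit. -/
lemma ae_eventually_ballMass_radius_le {s : ℝ≥0} (hs0 : 0 < s) (hs1 : s < 1)
    (hs : ∀ e l, LipschitzOnWith s (S.φ e l) S.X) {ε : ℝ} (hε : 0 < ε) :
    ∃ r₀, 0 < r₀ ∧ r₀ ≤ 1 ∧ ∀ᵐ x ∂(m ⊗ₘ κ), ∀ᶠ n : ℕ in atTop,
      ballMass κ S.jointProj x (S.radius (-ε) r₀ n x) ≤
      Real.exp (-(((letterEntropy m κ (S.jointProj ∘ S.skew)).toReal -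
        (letterEntropy m κ S.jointProj).toReal - ε) * n)) := by
  have hεs : Real.exp (-ε) * s < 1 := by
    have h1 : Real.exp (-ε) < 1 := Real.exp_lt_one_iff.2 (by linarith)
    have h2 : (s : ℝ) < 1 := by exact_mod_cast hs1
    nlinarith [Real.exp_pos (-ε), s.2]
  obtain ⟨r₁, hr₁0, hr₁⟩ := S.exists_scale hε
  set r₀ := min r₁ (1 / 2) with hr₀
  have hr₀0 : 0 < r₀ := lt_min hr₁0 (by norm_num)
  refine ⟨r₀, hr₀0, (min_le_right _ _).trans (by norm_num), ?_⟩
  have hle : ∀ n x, S.radius (-ε) r₀ n x ≤ r₁ := fun n x => by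
    refine (S.radius_le hs hr₀0 n x).trans ((mul_le_of_le_one_right hr₀0.le
      (pow_le_one₀ (by positivity) hεs.le)).trans (min_le_left _ _))
  filter_upwards [S.ae_tendsto_sum_gain hμ hent hs0 hs hr₀0 (min_le_right _ _) hεs,
    S.ae_isRegularPoint hμ.toMeasurePreserving] with x h1 h2
  filter_upwards [h1.eventually (gt_mem_nhds (lt_add_of_pos_right _ hε)), eventually_gt_atTop 0]
    with n hn1 hn0
  have hn0' : (0 : ℝ) < n := by exact_mod_cast hn0
  rw [div_lt_iff₀ hn0'] at hn1
  have h4 := sum_add_le_of_forall_add_le (T := S.skew) (g := fun n x => -S.gain κ (-ε) r₀ n x)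
    (F := fun n x => -Real.log (ballMass κ S.jointProj x (S.radius (-ε) r₀ n x))) (x := x)
    (fun k n => by
      rw [Function.iterate_succ_apply']
      have := S.log_ballMass_le_gain_add (fun e l x hx y hy => (hr₁ e l x hx y hy).2) (h2 k) hr₀0
        (hle n _)
      linarith) n
  rw [Finset.sum_neg_distrib] at h4
  have h5 : Real.log (ballMass κ S.jointProj (S.skew^[n] x)
      (S.radius (-ε) r₀ 0 (S.skew^[n] x))) ≤ 0 :=
    Real.log_nonpos measureReal_nonneg measureReal_le_one
  have hpos : 0 < ballMass κ S.jointProj x (S.radius (-ε) r₀ n x) :=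
    ENNReal.toReal_pos (((h2 0).pos₁ _ (S.radius_pos hr₀0 n x)).trans_le
      (measure_mono fun _ h => h.2)).ne' (measure_ne_top _ _)
  rw [← Real.log_le_iff_le_exp hpos]
  linarith

end RandomConformalIFS

/-! ### The pointwise dimension is entropy divided by exponent -/

namespace RandomConformalIFS

variable {Λ : Type*} [MeasurableSpace Λ] {m : Measure Λ} [IsProbabilityMeasure m] {E : Type*}
  [Countable E] [MeasurableSpace E] [DiscreteMeasurableSpace E] {q : ℕ} [NeZero q]
  (S : RandomConformalIFS Λ m E q) {κ : Kernel Λ (ℕ → E)} [IsMarkovKernel κ]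

omit [IsProbabilityMeasure m] [Countable E] [MeasurableSpace E] [DiscreteMeasurableSpace E] in
lemma neg_log_rate_pos (x : Λ × (ℕ → E)) : 0 < -Real.log (S.rate x) := by
  obtain ⟨s, -, hs1, hs⟩ := S.contracting
  exact neg_pos.2 (Real.log_neg (S.rate_pos x) ((S.rate_le hs x).trans_lt (by exact_mod_cast hs1)))

omit [IsProbabilityMeasure m] in
lemma lyapunovExponent_pos (μ : Measure (Λ × (ℕ → E))) [IsProbabilityMeasure μ] :
    0 < S.lyapunovExponent μ := by
  have h1 : S.lyapunovExponent μ = ∫⁻ x, ENNReal.ofReal (-Real.log (S.rate x)) ∂μ := rfl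
  have hm : Measurable fun x => ENNReal.ofReal (-Real.log (S.rate x)) :=
    S.measurable_rate.log.neg.ennreal_ofReal
  rw [h1, lintegral_pos_iff_support hm]
  have h2 : Function.support (fun x => ENNReal.ofReal (-Real.log (S.rate x))) = Set.univ :=
    Set.eq_univ_of_forall fun x => by
      simpa using S.neg_log_rate_pos x
  rw [h2, measure_univ]
  exact one_pos

variable (hμ : Ergodic S.skew (m ⊗ₘ κ))

include hμ in
lemma ae_eventually_le_birkhoffSum {a : ℝ} (ha : ENNReal.ofReal a < S.lyapunovExponent (m ⊗ₘ κ)) :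
    ∀ᵐ x ∂(m ⊗ₘ κ), ∀ᶠ n : ℕ in atTop,
      a * n ≤ birkhoffSum S.skew (fun y => -Real.log (S.rate y)) n x := by
  have h1 : S.lyapunovExponent (m ⊗ₘ κ) =
      ∫⁻ x, ENNReal.ofReal (-Real.log (S.rate x)) ∂(m ⊗ₘ κ) := rfl
  have hm : Measurable fun x => -Real.log (S.rate x) := S.measurable_rate.log.neg
  have h0 : ∀ x, 0 ≤ -Real.log (S.rate x) := fun x => (S.neg_log_rate_pos x).le
  have key : ∀ᵐ x ∂(m ⊗ₘ κ), ∀ᶠ n : ℕ in atTop,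
      a < birkhoffAverage ℝ S.skew (fun y => -Real.log (S.rate y)) n x := by
    by_cases htop : S.lyapunovExponent (m ⊗ₘ κ) = ∞
    · filter_upwards [hμ.ae_tendsto_birkhoffAverage_atTop hm h0 (h1 ▸ htop)] with x hx
      exact hx.eventually_gt_atTop a
    · have hi : Integrable (fun x => -Real.log (S.rate x)) (m ⊗ₘ κ) :=
        (lintegral_ofReal_ne_top_iff_integrable hm.aestronglyMeasurable
          (Eventually.of_forall h0)).1 (h1 ▸ htop)
      have h2 : a < ∫ x, -Real.log (S.rate x) ∂(m ⊗ₘ κ) := by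
        rw [integral_eq_lintegral_of_nonneg_ae (Eventually.of_forall h0) hm.aestronglyMeasurable,
          ← h1]
        rcases lt_or_ge a 0 with h | h
        · exact h.trans_le ENNReal.toReal_nonneg
        · exact (ENNReal.ofReal_lt_iff_lt_toReal h htop).1 ha
      filter_upwards [hμ.ae_tendsto_birkhoffAverage hm hi] with x hx
      exact hx.eventually (lt_mem_nhds h2)
  filter_upwards [key] with x hx
  filter_upwards [hx, eventually_gt_atTop 0] with n hn hn0
  have hn0' : (0 : ℝ) < n := by exact_mod_cast hn0
  rw [birkhoffAverage, smul_eq_mul, inv_mul_eq_div, lt_div_iff₀ hn0'] at hn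
  exact hn.le

include hμ in
lemma ae_eventually_birkhoffSum_le {a : ℝ} (ha : S.lyapunovExponent (m ⊗ₘ κ) < ENNReal.ofReal a) :
    ∀ᵐ x ∂(m ⊗ₘ κ), ∀ᶠ n : ℕ in atTop,
      birkhoffSum S.skew (fun y => -Real.log (S.rate y)) n x ≤ a * n := by
  have h1 : S.lyapunovExponent (m ⊗ₘ κ) =
      ∫⁻ x, ENNReal.ofReal (-Real.log (S.rate x)) ∂(m ⊗ₘ κ) := rfl
  have hm : Measurable fun x => -Real.log (S.rate x) := S.measurable_rate.log.neg
  have h0 : ∀ x, 0 ≤ -Real.log (S.rate x) := fun x => (S.neg_log_rate_pos x).le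
  have htop : S.lyapunovExponent (m ⊗ₘ κ) ≠ ∞ := ha.ne_top
  have hi : Integrable (fun x => -Real.log (S.rate x)) (m ⊗ₘ κ) :=
    (lintegral_ofReal_ne_top_iff_integrable hm.aestronglyMeasurable
      (Eventually.of_forall h0)).1 (h1 ▸ htop)
  have h2 : ∫ x, -Real.log (S.rate x) ∂(m ⊗ₘ κ) < a := by
    rw [integral_eq_lintegral_of_nonneg_ae (Eventually.of_forall h0) hm.aestronglyMeasurable, ← h1]
    exact (ENNReal.lt_ofReal_iff_toReal_lt htop).1 ha
  filter_upwards [hμ.ae_tendsto_birkhoffAverage hm hi] with x hx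
  filter_upwards [hx.eventually (gt_mem_nhds h2), eventually_gt_atTop 0] with n hn hn0
  have hn0' : (0 : ℝ) < n := by exact_mod_cast hn0
  rw [birkhoffAverage, smul_eq_mul, inv_mul_eq_div, div_lt_iff₀ hn0'] at hn
  exact hn.le

lemma eventually_exp_mul_lt_one {s : ℝ≥0} (hs1 : s < 1) :
    ∀ᶠ ε in 𝓝[>] (0 : ℝ), Real.exp ε * s < 1 := by
  have h : Continuous fun ε : ℝ => Real.exp ε * s := by fun_prop
  refine (h.continuousWithinAt (s := Set.Ioi 0) (x := 0)).eventually (gt_mem_nhds ?_)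
  simpa using hs1

variable (hent : condEntropy (m ⊗ₘ κ) (firstLetterPartition Λ E) (baseSigmaAlgebra Λ E) < ∞)

/-- The difference of the two conditional entropies, as a real number. -/
noncomputable def realEntropy (κ : Kernel Λ (ℕ → E)) : ℝ :=
  (letterEntropy m κ (S.jointProj ∘ S.skew)).toReal - (letterEntropy m κ S.jointProj).toReal

include hμ hent in
lemma realEntropy_nonneg : 0 ≤ S.realEntropy κ := by
  obtain ⟨s, hs0, hs1, hs⟩ := S.contracting
  have key : ∀ᶠ ε in 𝓝[>] (0 : ℝ), 0 ≤ S.realEntropy κ + 2 * ε := by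
    filter_upwards [eventually_exp_mul_lt_one hs1, self_mem_nhdsWithin] with ε hεs hε
    obtain ⟨r₀, -, -, h⟩ := S.ae_eventually_exp_le_ballMass_radius hμ hent hs0 hs hε hεs
    obtain ⟨x, hx⟩ := h.exists
    obtain ⟨n, hn, hn0⟩ := (hx.and (eventually_gt_atTop 0)).exists
    have h1 := hn.trans measureReal_le_one
    rw [Real.exp_le_one_iff, neg_nonpos] at h1
    exact nonneg_of_mul_nonneg_left h1 (by exact_mod_cast hn0)
  have hc : Continuous fun ε : ℝ => S.realEntropy κ + 2 * ε := by fun_prop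
  have := ge_of_tendsto (hc.continuousWithinAt (s := Set.Ioi 0) (x := 0)) key
  simpa using this

include hμ hent in
lemma ae_eventually_rpow_le_ballMass {D : ℝ} (hD0 : 0 < D)
    (hD : ENNReal.ofReal (S.realEntropy κ / D) < S.lyapunovExponent (m ⊗ₘ κ)) :
    ∀ᵐ x ∂(m ⊗ₘ κ), ∀ᶠ r in 𝓝[>] (0 : ℝ), r ^ D ≤ ballMass κ S.jointProj x r := by
  obtain ⟨s, hs0, hs1, hs⟩ := S.contracting
  obtain ⟨a, -, ha1, ha2⟩ := ENNReal.lt_iff_exists_real_btwn.1 hD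
  have hh := S.realEntropy_nonneg hμ hent
  have ha : S.realEntropy κ / D < a :=
    (ENNReal.ofReal_lt_ofReal_iff_of_nonneg (by positivity)).1 ha1
  have ha0 : 0 < a := (div_nonneg hh hD0.le).trans_lt ha
  rw [div_lt_iff₀ hD0, mul_comm] at ha
  obtain ⟨ε, hεs, hε, hε1, hε2⟩ : ∃ ε, Real.exp ε * s < 1 ∧ 0 < ε ∧ ε < a ∧
      S.realEntropy κ + 2 * ε < D * (a - ε) := by
    have hc : Continuous fun ε : ℝ => D * (a - ε) - (S.realEntropy κ + 2 * ε) := by fun_prop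
    have h1 := (hc.continuousWithinAt (s := Set.Ioi 0) (x := 0)).eventually (lt_mem_nhds
      (show 0 < D * (a - 0) - (S.realEntropy κ + 2 * 0) by simpa using ha))
    obtain ⟨ε, h2, h3, h4⟩ := ((eventually_exp_mul_lt_one hs1).and
      (h1.and (Ioo_mem_nhdsGT ha0))).exists
    exact ⟨ε, h2, h4.1, h4.2, by linarith⟩
  obtain ⟨r₀, hr₀, hr₀1, h⟩ := S.ae_eventually_exp_le_ballMass_radius hμ hent hs0 hs hε hεs
  filter_upwards [h, S.ae_eventually_le_birkhoffSum hμ ha2] with x hx hxa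
  refine eventually_rpow_le (ballMass_mono κ _ x) (τ := fun n => -Real.log (S.radius ε r₀ n x))
    (sub_pos.2 hε1) ?_ hD0.le hε2 ?_
  · filter_upwards [hxa] with n hn
    rw [S.neg_log_radius hr₀]
    have := Real.log_nonpos hr₀.le hr₀1
    linarith
  · filter_upwards [hx] with n hn
    rw [neg_neg, Real.exp_log (S.radius_pos hr₀ n x)]
    exact hn

include hμ hent in
lemma ae_eventually_ballMass_le_rpow {D : ℝ} (hD0 : 0 < D)
    (hD : S.lyapunovExponent (m ⊗ₘ κ) < ENNReal.ofReal (S.realEntropy κ / D)) :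
    ∀ᵐ x ∂(m ⊗ₘ κ), ∀ᶠ r in 𝓝[>] (0 : ℝ), ballMass κ S.jointProj x r ≤ r ^ D := by
  obtain ⟨s, hs0, hs1, hs⟩ := S.contracting
  obtain ⟨a, ha0, ha1, ha2⟩ := ENNReal.lt_iff_exists_real_btwn.1 hD
  have ha : a < S.realEntropy κ / D := (ENNReal.ofReal_lt_ofReal_iff_of_nonneg ha0).1 ha2
  rw [lt_div_iff₀ hD0, mul_comm] at ha
  obtain ⟨ε, hε, hε2⟩ : ∃ ε, 0 < ε ∧ D * (a + 2 * ε) < S.realEntropy κ - ε := by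
    have hc : Continuous fun ε : ℝ => S.realEntropy κ - ε - D * (a + 2 * ε) := by fun_prop
    have h1 := (hc.continuousWithinAt (s := Set.Ioi 0) (x := 0)).eventually (lt_mem_nhds
      (show 0 < S.realEntropy κ - 0 - D * (a + 2 * 0) by simpa using ha))
    obtain ⟨ε, h3, h4⟩ := (h1.and self_mem_nhdsWithin).exists
    exact ⟨ε, h4, by linarith⟩
  obtain ⟨r₀, hr₀, hr₀1, h⟩ := S.ae_eventually_ballMass_radius_le hμ hent hs0 hs1 hs hε
  filter_upwards [h, S.ae_eventually_birkhoffSum_le hμ ha1] with x hx hxa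
  have hlog : Real.log r₀ ≤ 0 := Real.log_nonpos hr₀.le hr₀1
  refine eventually_le_rpow (ballMass_mono κ _ x) (τ := fun n => -Real.log (S.radius (-ε) r₀ n x))
    (tendsto_atTop_of_mul_le hε (Eventually.of_forall fun n => ?_)) ?_ hD0.le hε2 ?_
  · rw [S.neg_log_radius hr₀]
    have : 0 ≤ birkhoffSum S.skew (fun y => -Real.log (S.rate y)) n x :=
      Finset.sum_nonneg fun k _ => (S.neg_log_rate_pos _).le
    linarith
  · filter_upwards [hxa,
      ((tendsto_natCast_atTop_atTop (R := ℝ)).const_mul_atTop hε).eventually_ge_atTop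
      (-Real.log r₀)] with n hn hn'
    rw [S.neg_log_radius hr₀]
    linarith
  · filter_upwards [hx] with n hn
    rw [neg_neg, Real.exp_log (S.radius_pos hr₀ n x)]
    exact hn

include hμ hent in
/-- The fibre measures have pointwise dimension entropy divided by exponent almost everywhere. -/
lemma ae_local_dim {d : ℝ} (hd : d = S.realEntropy κ / (S.lyapunovExponent (m ⊗ₘ κ)).toReal) :
    ∀ᵐ x ∂(m ⊗ₘ κ), ∀ η > 0, ∀ᶠ r in 𝓝[>] (0 : ℝ),
      r ^ (d + η) ≤ ballMass κ S.jointProj x r ∧ ballMass κ S.jointProj x r ≤ r ^ (d - η) := by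
  set χ := S.lyapunovExponent (m ⊗ₘ κ) with hχ
  have hχ0 : 0 < χ := S.lyapunovExponent_pos _
  have hh := S.realEntropy_nonneg hμ hent
  have hd0 : 0 ≤ d := hd ▸ div_nonneg hh ENNReal.toReal_nonneg
  have hdχ : χ ≠ ∞ → S.realEntropy κ = d * χ.toReal := fun htop => by
    rw [hd, div_mul_cancel₀ _ (ENNReal.toReal_pos hχ0.ne' htop).ne']
  have hlow : ∀ η > 0, ∀ᵐ x ∂(m ⊗ₘ κ), ∀ᶠ r in 𝓝[>] (0 : ℝ),
      r ^ (d + η) ≤ ballMass κ S.jointProj x r := by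
    intro η hη
    refine S.ae_eventually_rpow_le_ballMass hμ hent (by linarith) ?_
    by_cases htop : χ = ∞
    · rw [← hχ, htop]
      exact ENNReal.ofReal_lt_top
    · have h1 := ENNReal.toReal_pos hχ0.ne' htop
      refine (ENNReal.ofReal_lt_iff_lt_toReal (by positivity) htop).2 ?_
      rw [hdχ htop, div_lt_iff₀ (by linarith)]
      nlinarith
  have hup : ∀ η > 0, ∀ᵐ x ∂(m ⊗ₘ κ), ∀ᶠ r in 𝓝[>] (0 : ℝ),
      ballMass κ S.jointProj x r ≤ r ^ (d - η) := by
    intro η hη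
    rcases le_or_gt (d - η) 0 with h0 | h0
    · refine Eventually.of_forall fun x => ?_
      filter_upwards [Ioo_mem_nhdsGT one_pos] with r hr
      exact measureReal_le_one.trans (Real.one_le_rpow_of_pos_of_le_one_of_nonpos hr.1 hr.2.le h0)
    · refine S.ae_eventually_ballMass_le_rpow hμ hent h0 ?_
      have htop : χ ≠ ∞ := fun htop => by
        rw [htop, ENNReal.toReal_top, div_zero] at hd
        linarith
      have h1 := ENNReal.toReal_pos hχ0.ne' htop
      rw [ENNReal.lt_ofReal_iff_toReal_lt htop, hdχ htop, lt_div_iff₀ h0]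
      nlinarith
  have hη0 : ∀ j : ℕ, (0 : ℝ) < 1 / ((j : ℝ) + 1) := fun j => Nat.one_div_pos_of_nat
  filter_upwards [ae_all_iff.2 fun j : ℕ => hlow _ (hη0 j), ae_all_iff.2 fun j : ℕ => hup _ (hη0 j)]
    with x hx1 hx2 η hη
  obtain ⟨j, hj⟩ := exists_nat_one_div_lt hη
  filter_upwards [hx1 j, hx2 j, Ioo_mem_nhdsGT one_pos] with r hr1 hr2 hr
  exact ⟨(Real.rpow_le_rpow_of_exponent_ge hr.1 hr.2.le (by linarith)).trans hr1,
    hr2.trans (Real.rpow_le_rpow_of_exponent_ge hr.1 hr.2.le (by linarith))⟩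

include hent in
omit [NeZero q] in
lemma projEntropy_div_lyapunovExponent :
    S.projEntropy (m ⊗ₘ κ) / (S.lyapunovExponent (m ⊗ₘ κ) : EReal) =
      ((S.realEntropy κ / (S.lyapunovExponent (m ⊗ₘ κ)).toReal : ℝ) : EReal) := by
  have h1 := (letterEntropy_lt_top hent S.measurable_jointProj).ne
  have h2 := (letterEntropy_lt_top hent (S.measurable_jointProj.comp S.measurable_skew)).ne
  have h3 : S.projEntropy (m ⊗ₘ κ) = (S.realEntropy κ : EReal) := by
    rw [projEntropy, MeasurableSpace.comap_comp]
    change (letterEntropy m κ (S.jointProj ∘ S.skew) : EReal) -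
      (letterEntropy m κ S.jointProj : EReal)
      = _
    rw [realEntropy, EReal.coe_sub, EReal.coe_ennreal_toReal h1, EReal.coe_ennreal_toReal h2]
  rw [h3]
  by_cases htop : S.lyapunovExponent (m ⊗ₘ κ) = ∞
  · rw [htop]
    simp
  · rw [EReal.coe_div, ← EReal.coe_ennreal_toReal htop]

end RandomConformalIFS

theorem mainTheorem3 {Λ : Type*} [MeasurableSpace Λ] (m : Measure Λ) [IsProbabilityMeasure m]
    {E : Type*} [Countable E] [MeasurableSpace E] [DiscreteMeasurableSpace E]
    (q : ℕ) (hq : 1 ≤ q) (S : RandomConformalIFS Λ m E q)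
    (μ : Measure (Λ × (ℕ → E))) [IsProbabilityMeasure μ]
    (hμ : Ergodic S.skew μ) (hmarg : μ.map Prod.fst = m)
    (κ : Kernel Λ (ℕ → E)) [IsMarkovKernel κ] (hκ : m ⊗ₘ κ = μ)
    (hent : condEntropy μ (firstLetterPartition Λ E) (baseSigmaAlgebra Λ E) < ∞) :
    ∀ᵐ l ∂m,
      HasHausdorffDim ((κ l).map (S.proj l))
        (S.projEntropy μ / (S.lyapunovExponent μ : EReal)) ∧
      HasPackingDim ((κ l).map (S.proj l))
        (S.projEntropy μ / (S.lyapunovExponent μ : EReal)) := by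
  subst hκ
  have : NeZero q := ⟨by omega⟩
  rw [S.projEntropy_div_lyapunovExponent hent]
  have h := S.ae_local_dim hμ hent rfl
  filter_upwards [Measure.ae_ae_of_ae_compProd h] with l hl
  exact hasDim_map_of_ae (S.measurable_jointProj.comp measurable_prodMk_left)
    (div_nonneg (S.realEntropy_nonneg hμ hent) ENNReal.toReal_nonneg) hl
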